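/- Let $d\ge 3$ and $m\in\mathbb N$. Let $\Gamma=\{\sum_j n_j\gamma_j: n\in\mathbb Z^d\}$ be the lattice generated by a basis $\gamma_1,\dots,\gamma_d$ of $\mathbb R^d$, $\Gamma^*=\{k: k\cdot\gamma\in2\pi\mathbb Z\ \forall\gamma\in\Gamma\}$ its dual lattice, $\mathbb T_d^*=\mathbb R^d/\Gamma^*$, $\mathcal H_{\rm f}=L^2(\mathbb R^d/\Gamma)$, and $(\tau(\lambda)\varphi)(y)=e^{i\lambda\cdot y}\varphi(y)$ for $\lambda\in\Gamma^*$. Let $P(k)$, $k\in\mathbb R^d$, be a family of orthogonal projectors of rank $m$ on $\mathcal H_{\rm f}$, smooth in operator norm, with $P(k+\lambda)=\tau(\lambda)^{-1}P(k)\tau(\lambda)$ for $\lambda\in\Gamma^*$, and let $\chi=\{\chi_1,\dots,\chi_m\}$ be a real-analytic Bloch frame for it, i.e. $\chi_a:\mathbb R^d\to\mathcal H_{\rm f}$ is real-analytic, $\chi_a(k-\lambda)=\tau(\lambda)\chi_a(k)$ for $\lambda\in\Gamma^*$, and $\chi_1(k),\dots,\chi_m(k)$ is an orthonormal basis of $\operatorname{Ran}P(k)$.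 Put $[A_j(k)]_{cb}=\langle\chi_c(k),\partial_{k_j}\chi_b(k)\rangle$. For $U\in W^{1,2}(\mathbb T_d^*;\mathcal U(m))$ let $$\tilde F_{MV}(U;\chi)=\sum_{j}\int_{\mathbb T_d^*}\Big[\operatorname{tr}\Big(\frac{\partial U^*}{\partial k_j}\frac{\partial U}{\partial k_j}\Big)+m\sum_{a}\Big\|\frac{\partial\chi_a}{\partial k_j}\Big\|^2\Big]d\mu+\sum_j\int_{\mathbb T_d^*}\operatorname{tr}\Big[\Big(U\frac{\partial U^*}{\partial k_j}-\frac{\partial U}{\partial k_j}U^*\Big)A_j\Big]d\mu+\sum_{a,j}\Big(\int_{\mathbb T_d^*}\Big[U^*\Big(\frac{\partial U}{\partial k_j}+A_jU\Big)\Big]_{aa}d\mu\Big)^2,$$ where $\mu=c\,dk$ is Lebesgue measure $dk$ multiplied by a fixed constant $c>0$ (for instance $c=1$, or $\mu$ normalized to be a probability measure). Let $U\in W^{1,2}(\mathbb T_d^*;\mathcal U(m))$ be a minimizer of $\tilde F_{MV}(\cdot;\chi)$ on $W^{1,2}(\mathbb T_d^*;\mathcal U(m))$. Write $|\nabla U|^2=\sum_j\operatorname{tr}(\partial_{k_j}U^*\partial_{k_j}U)$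 and, for given $k_0$, $\partial_rU=\sum_j\frac{(k-k_0)_j}{|k-k_0|}\partial_{k_j}U$ and $|\partial_rU|^2=\operatorname{tr}((\partial_rU)^*\partial_rU)$, where $U$ is regarded as a $\Gamma^*$-periodic map on $\mathbb R^d$ and $B_R(k_0)$ is the Euclidean ball. Then there exist $C>0$ and $\bar R>0$ such that for all $k_0$ and all $0<R_1\le R_2\le\bar R$ $$\frac1{R_1^{d-2}}\int_{B_{R_1}(k_0)}|\nabla U|^2\,dk+\int_{R_1<|k-k_0|<R_2}\frac{2}{|k-k_0|^{d-2}}|\partial_rU|^2\,dk\le 2CR_2+(1+2CR_2)\frac1{R_2^{d-2}}\int_{B_{R_2}(k_0)}|\nabla U|^2\,dk .$$ Consequently, for every $k_0$, the scaled energy $R^{2-d}\int_{B_R(k_0)}|\nabla U|^2\,dk$ has a finite limit as $R\to0^+$, and $\int_{B_R(k_0)}|\partial_rU|^2|k-k_0|^{2-d}\,dk$ is finite for every $R>0$ and tends to $0$ as $R\to0^+$. -/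

import Mathlib

open MeasureTheory Filter Topology
open scoped ContDiff ENNReal InnerProductSpace Matrix

namespace MarzariVanderbilt

noncomputable section

/-- The Euclidean space `ℝᵈ`. -/
abbrev E (d : ℕ) : Type := EuclideanSpace ℝ (Fin d)

/-- The `j`-th standard unit vector of `ℝᵈ`. -/
def unitVec {d : ℕ} (j : Fin d) : E d := EuclideanSpace.single j (1 : ℝ)

/-! ### The lattice, its dual, and the fundamental domains -/

/-- The lattice `Γ` of all integer combinations of `γ₁, …, γ_d`. -/
def lattice {d : ℕ} (γ : Module.Basis (Fin d) ℝ (E d)) : Set (E d) :=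
  {g | ∃ n : Fin d → ℤ, g = ∑ j, (n j : ℝ) • γ j}

/-- The dual lattice `Γ* = {k : k · g ∈ 2πℤ for all g ∈ Γ}`. -/
def dualLattice {d : ℕ} (γ : Module.Basis (Fin d) ℝ (E d)) : Set (E d) :=
  {l | ∀ g ∈ lattice γ, ∃ n : ℤ, ⟪l, g⟫_ℝ = 2 * Real.pi * n}

/-- The centered fundamental domain `Y` of `Γ`. -/
def cell {d : ℕ} (γ : Module.Basis (Fin d) ℝ (E d)) : Set (E d) :=
  {x | ∃ α : Fin d → ℝ, (∀ j, α j ∈ Set.Icc (-(1 / 2) : ℝ) (1 / 2)) ∧ x = ∑ j, α j • γ j}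

/-- The centered fundamental domain `Y*` of `Γ*`.  If `k = ∑ k'ⱼ γ*ⱼ`, where `γ*` is the dual basis,
`γ*ⱼ · γᵢ = 2π δⱼᵢ`, then `k'ᵢ = (k · γᵢ) / 2π`; the condition is `k'ᵢ ∈ [-1/2, 1/2]`. -/
def dualCell {d : ℕ} (γ : Module.Basis (Fin d) ℝ (E d)) : Set (E d) :=
  {k | ∀ i, ⟪k, γ i⟫_ℝ / (2 * Real.pi) ∈ Set.Icc (-(1 / 2) : ℝ) (1 / 2)}

/-! ### The fibre space `H_f = L²(𝕋ᵈ)` and the representation `τ` of `Γ*` -/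

/-- `H_f = L²(𝕋ᵈ)` with `𝕋ᵈ = ℝᵈ/Γ`: a `Γ`-periodic function is represented by its restriction
to the fundamental domain `Y`. -/
abbrev Hf {d : ℕ} (γ : Module.Basis (Fin d) ℝ (E d)) : Type :=
  Lp ℂ 2 ((volume : Measure (E d)).restrict (cell γ))

/-- The character `y ↦ e^{i l·y}`. -/
def character {d : ℕ} (l : E d) (y : E d) : ℂ := Complex.exp (Complex.I * (⟪l, y⟫_ℝ : ℝ))

theorem memLp_character {d : ℕ} (γ : Module.Basis (Fin d) ℝ (E d)) (l : E d) :
    MemLp (character l) ∞ ((volume : Measure (E d)).restrict (cell γ)) := by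
  refine memLp_top_of_bound (C := 1) ?_ ?_
  · apply Continuous.aestronglyMeasurable
    unfold character
    fun_prop
  · refine Eventually.of_forall fun y => ?_
    unfold character
    rw [mul_comm, Complex.norm_exp_ofReal_mul_I]

/-- The operator `τ(l)` on `H_f`, `(τ(l)φ)(y) = e^{i l·y} φ(y)`. -/
def tau {d : ℕ} (γ : Module.Basis (Fin d) ℝ (E d)) (l : E d) : Hf γ →L[ℂ] Hf γ :=
  (ContinuousLinearMap.mul ℂ ℂ).holderL ((volume : Measure (E d)).restrict (cell γ)) ∞ 2 2
    (memLp_character γ l).toLp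

theorem coeFn_tau {d : ℕ} (γ : Module.Basis (Fin d) ℝ (E d)) (l : E d) (φ : Hf γ) :
    tau γ l φ =ᵐ[(volume : Measure (E d)).restrict (cell γ)] fun y => character l y * φ y := by
  have h1 := (ContinuousLinearMap.mul ℂ ℂ).coeFn_holder (r := 2) (memLp_character γ l).toLp φ
  have h2 := (memLp_character γ l).coeFn_toLp
  refine EventuallyEq.trans h1 ?_
  filter_upwards [h2] with y hy
  simp [hy]

/-- Membership in `H_τ`: a function in `L²_loc(ℝᵈ; H_f)` with `φ(k - l) = τ(l) φ(k)` for all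
`l ∈ Γ*` and a.e. `k`. -/
def MemHTau {d : ℕ} (γ : Module.Basis (Fin d) ℝ (E d)) (φ : E d → Hf γ) : Prop :=
  (∀ K : Set (E d), IsCompact K → MemLp φ 2 (volume.restrict K)) ∧
    ∀ l ∈ dualLattice γ, ∀ᵐ k : E d, φ (k - l) = tau γ l (φ k)

/-! ### Families of projectors and Bloch frames -/

/-- A family `P(k)`, `k ∈ ℝᵈ`, of orthogonal projectors of rank `m` on `H_f`, smooth in operator
norm and `τ`-covariant, `P(k + l) = τ(l)⁻¹ P(k) τ(l)`; here `τ(l)⁻¹ = τ(-l)`. -/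
structure IsProjectorFamily {d : ℕ} (γ : Module.Basis (Fin d) ℝ (E d)) (m : ℕ)
    (P : E d → (Hf γ →L[ℂ] Hf γ)) : Prop where
  isStarProjection : ∀ k, IsStarProjection (P k)
  rank_eq : ∀ k, Module.rank ℂ (LinearMap.range (P k).toLinearMap) = m
  smooth : ContDiff ℝ ∞ P
  covariant : ∀ k, ∀ l ∈ dualLattice γ, P (k + l) = (tau γ (-l)).comp ((P k).comp (tau γ l))

/-- A Bloch frame for `P`: functions `χ₁, …, χ_m ∈ H_τ` forming, at a.e. `k`, an orthonormal basis
of `Ran P(k)`. -/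
structure IsBlochFrame {d : ℕ} (γ : Module.Basis (Fin d) ℝ (E d)) {m : ℕ}
    (P : E d → (Hf γ →L[ℂ] Hf γ)) (χ : Fin m → E d → Hf γ) : Prop where
  mem_HTau : ∀ a, MemHTau γ (χ a)
  orthonormal : ∀ᵐ k : E d, Orthonormal ℂ (fun a => χ a k)
  span_eq : ∀ᵐ k : E d,
    Submodule.span ℂ (Set.range fun a => χ a k) = LinearMap.range (P k).toLinearMap

/-- The partial derivative `∂χ_a/∂k_j`. -/
def frameDeriv {d m : ℕ} {γ : Module.Basis (Fin d) ℝ (E d)} (χ : Fin m → E d → Hf γ)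
    (j : Fin d) (a : Fin m) (k : E d) : Hf γ :=
  fderiv ℝ (χ a) k (unitVec j)

/-- The Berry connection matrices, `[A_j(k)]_{cb} = ⟨χ_c(k), ∂χ_b/∂k_j(k)⟩` (the inner product is
conjugate-linear in the first argument). -/
def berry {d m : ℕ} {γ : Module.Basis (Fin d) ℝ (E d)} (χ : Fin m → E d → Hf γ)
    (j : Fin d) (k : E d) : Matrix (Fin m) (Fin m) ℂ :=
  Matrix.of fun c b => ⟪χ c k, frameDeriv χ j b k⟫_ℂ

/-! ### The space `W^{1,2}(𝕋*_d; 𝒰(m))` -/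

/-- `g` is the weak `j`-th partial derivative on `ℝᵈ` of the function `f` (for locally integrable
`f` and `g`). -/
def IsWeakPartialDeriv {d : ℕ} (j : Fin d) (f g : E d → ℂ) : Prop :=
  ∀ φ : E d → ℝ, ContDiff ℝ ∞ φ → HasCompactSupport φ →
    ∫ k, ((fderiv ℝ φ k (unitVec j) : ℝ) : ℂ) * f k = -∫ k, ((φ k : ℝ) : ℂ) * g k

/-- An element of `W^{1,2}(𝕋*_d; 𝒰(m))`, `𝕋*_d = ℝᵈ/Γ*`: a `Γ*`-periodic map from `ℝᵈ` to the unitary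
group `𝒰(m) ⊂ M_m(ℂ)`, together with its weak partial derivatives `grad j = ∂U/∂k_j`, all entries
being locally square integrable.  The derivatives are determined a.e. by the map. -/
structure SobolevMap {d : ℕ} (γ : Module.Basis (Fin d) ℝ (E d)) (m : ℕ) where
  toFun : E d → Matrix (Fin m) (Fin m) ℂ
  grad : Fin d → E d → Matrix (Fin m) (Fin m) ℂ
  unitary : ∀ᵐ k : E d, toFun k ∈ Matrix.unitaryGroup (Fin m) ℂ
  periodic : ∀ l ∈ dualLattice γ, ∀ᵐ k : E d, toFun (k + l) = toFun k
  memLp : ∀ a b, ∀ K : Set (E d), IsCompact K →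
    MemLp (fun k => toFun k a b) 2 (volume.restrict K)
  memLp_grad : ∀ j a b, ∀ K : Set (E d), IsCompact K →
    MemLp (fun k => grad j k a b) 2 (volume.restrict K)
  isWeakPartialDeriv : ∀ j a b,
    IsWeakPartialDeriv j (fun k => toFun k a b) (fun k => grad j k a b)

/-! ### The localization functional -/

/-- Integral over the torus `𝕋*_d` of a `Γ*`-periodic function, with respect to `c` times Lebesgue
measure. -/
def torusIntegral {d : ℕ} (γ : Module.Basis (Fin d) ℝ (E d)) (c : ℝ) (f : E d → ℂ) : ℂ :=
  (c : ℂ) * ∫ k in dualCell γ, f k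

/-- The Marzari–Vanderbilt localization functional `F̃_MV(U; χ)`.  All three complex sums below are
in fact real, since `A_j` and `U* ∂U/∂k_j` are antihermitian. -/
def localizationFunctional {d m : ℕ} {γ : Module.Basis (Fin d) ℝ (E d)} (c : ℝ)
    (χ : Fin m → E d → Hf γ) (U : SobolevMap γ m) : ℝ :=
  ((∑ j, torusIntegral γ c fun k =>
      ((U.grad j k)ᴴ * U.grad j k).trace + m * ∑ a, ((‖frameDeriv χ j a k‖ ^ 2 : ℝ) : ℂ))
    + (∑ j, torusIntegral γ c fun k =>
      ((U.toFun k * (U.grad j k)ᴴ - U.grad j k * (U.toFun k)ᴴ) * berry χ j k).trace)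
    + ∑ a, ∑ j, (torusIntegral γ c fun k =>
      ((U.toFun k)ᴴ * (U.grad j k + berry χ j k * U.toFun k)) a a) ^ 2).re

/-- `U` minimizes `F̃_MV(·; χ)` over `W^{1,2}(𝕋*_d; 𝒰(m))`. -/
def IsMinimizer {d m : ℕ} {γ : Module.Basis (Fin d) ℝ (E d)} (c : ℝ)
    (χ : Fin m → E d → Hf γ) (U : SobolevMap γ m) : Prop :=
  ∀ V : SobolevMap γ m, localizationFunctional c χ U ≤ localizationFunctional c χ V

/-! ### The scaled energy -/

/-- `|M|² = tr(M* M)`, the squared Euclidean norm on `M_m(ℂ)`. -/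
def matNormSq {m : ℕ} (M : Matrix (Fin m) (Fin m) ℂ) : ℝ := ((Mᴴ * M).trace).re

/-- `|∇U|² = ∑_j |∂U/∂k_j|²`. -/
def gradNormSq {d m : ℕ} {γ : Module.Basis (Fin d) ℝ (E d)} (U : SobolevMap γ m) (k : E d) : ℝ :=
  ∑ j, matNormSq (U.grad j k)

/-- The radial derivative `∂U/∂r = ∑_j ((k - k₀)_j / |k - k₀|) ∂U/∂k_j` with respect to `k₀`. -/
def radialDeriv {d m : ℕ} {γ : Module.Basis (Fin d) ℝ (E d)} (U : SobolevMap γ m)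
    (k₀ k : E d) : Matrix (Fin m) (Fin m) ℂ :=
  ∑ j, ((((k - k₀) j / ‖k - k₀‖ : ℝ)) : ℂ) • U.grad j k

/-- The scaled energy `R^{2-d} ∫_{B_R(k₀)} |∇U|² dk`. -/
def scaledEnergy {d m : ℕ} {γ : Module.Basis (Fin d) ℝ (E d)} (U : SobolevMap γ m)
    (k₀ : E d) (R : ℝ) : ℝ :=
  R ^ (2 - (d : ℤ)) * ∫ k in Metric.ball k₀ R, gradNormSq U k

/-- The weighted radial energy density `|∂U/∂r|² |k - k₀|^{2-d}`. -/
def radialDensity {d m : ℕ} {γ : Module.Basis (Fin d) ℝ (E d)} (U : SobolevMap γ m)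
    (k₀ k : E d) : ℝ :=
  matNormSq (radialDeriv U k₀ k) * ‖k - k₀‖ ^ (2 - (d : ℤ))

end

end MarzariVanderbilt

/-! The argument is the inner-variation proof of the monotonicity formula for stationary harmonic
maps, with the connection terms treated as lower-order errors. The competitor is `V = U ∘ Φ⁻¹`,
where `Φ` is the periodic extension of `id + s X` and `X` is supported in a small ball. Composition
keeps the values unitary, so the constraint costs nothing. `exists_deformation` constructs `Φ`;
`SobolevMap.compSymm` makes `V` admissible.

Changing variables back moves all dependence on `s` into coefficients built from `A = s DX`. For the
Dirichlet energy they are the entries of `det(1+A) (1+A)⁻¹ (1+A)⁻ᵀ`, and the linear part in `A`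
gives `stress`. The Berry term is of first order in the gradient with smooth coefficients, and the
quadratic term is a sum of squares of finitely many numbers, each the integral of such an
expression. Both change by at most a constant times `s ∫ (∑ |∂U| + 1)(|DX| + |X|)`. Minimality,
division by `s` and `s → 0` give `exists_first_variation_bound`. Its constant does not depend on the
center, because the Berry matrices are periodic, hence bounded and Lipschitz, and the center
integrals of `U` are fixed numbers.

Next, with `n = d - 2` and `r = |x - k₀|`, take `X = -f(r) (x - k₀)`, where `n f(r) = r⁻ⁿ (1 + Λ r)
- R₂⁻ⁿ (1 + Λ R₂)` for `R₁ < r < R₂`, `f` is frozen for `r ≤ R₁`, and `f` vanishes for `r ≥ R₂`. For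
`Λ = 0` this is the classical field: it produces the two scaled energies and the weighted radial
energy of the shell. The error is split by `∑ |∂U| + 1 ≤ r |∇U|² + C/r`. The first part is absorbed
by the correction `Λ r` once `Λ = 6 K n`; the second leaves a multiple of `r^{1-d}`, whose integral
over the ball is proportional to `R₂`. The pointwise statements are `shell_integrand_le` and
`inner_integrand_le`, integrated in `scaledEnergy_monotonicity`. Since this field has corners, it is
reached from smooth ones in `integral_radialIntegrand_truncated_nonneg`.

The consequences are soft. The scaled energy is increasing up to an error that vanishes with the
radius, so it has a limit (`exists_tendsto_of_almost_monotone`). The shell integrals stay bounded as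
the inner radius shrinks, so the radial density is integrable, and its integral over small balls
tends to zero. -/

namespace MarzariVanderbilt
noncomputable section

/-! ### The dual lattice and its fundamental domains -/

/-- The coordinates `⟨k, γᵢ⟩ / 2π` of `k` with respect to the dual basis, as a linear map. -/
def dualCoordMap {d : ℕ} (γ : Module.Basis (Fin d) ℝ (E d)) : E d →ₗ[ℝ] (Fin d → ℝ) :=
  LinearMap.pi fun i => (2 * Real.pi)⁻¹ • (innerₗ (E d) (γ i))

theorem dualCoordMap_apply {d : ℕ} (γ : Module.Basis (Fin d) ℝ (E d)) (k : E d) (i : Fin d) :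
    dualCoordMap γ k i = ⟪k, γ i⟫_ℝ / (2 * Real.pi) := by
  simp [dualCoordMap, real_inner_comm, div_eq_inv_mul]

theorem dualCoordMap_injective {d : ℕ} (γ : Module.Basis (Fin d) ℝ (E d)) :
    Function.Injective (dualCoordMap γ) := by
  rw [← LinearMap.ker_eq_bot, LinearMap.ker_eq_bot']
  intro k hk
  have h : ∀ i, ⟪k, γ i⟫_ℝ = 0 := fun i => by
    have h1 := congrFun hk i
    rw [dualCoordMap_apply] at h1
    have h2 := Real.pi_pos
    simpa [h2.ne'] using h1
  exact InnerProductSpace.ext_inner_right_basis γ (𝕜 := ℝ) fun i => by rw [h i, inner_zero_left]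

/-- The coordinates `⟨k, γᵢ⟩ / 2π` of `k` with respect to the dual basis. -/
def dualCoord {d : ℕ} (γ : Module.Basis (Fin d) ℝ (E d)) : E d ≃L[ℝ] (Fin d → ℝ) :=
  (LinearEquiv.ofInjectiveOfFinrankEq (dualCoordMap γ) (dualCoordMap_injective γ)
    (by simp)).toContinuousLinearEquiv

theorem dualCoord_apply {d : ℕ} (γ : Module.Basis (Fin d) ℝ (E d)) (k : E d) (i : Fin d) :
    dualCoord γ k i = ⟪k, γ i⟫_ℝ / (2 * Real.pi) :=
  dualCoordMap_apply γ k i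

/-- By linearity it is enough to test against the generators `γ i`; in these coordinates the dual
lattice is `ℤᵈ`. -/
theorem mem_dualLattice_iff {d : ℕ} (γ : Module.Basis (Fin d) ℝ (E d)) (l : E d) :
    l ∈ dualLattice γ ↔ ∃ n : Fin d → ℤ, ∀ i, dualCoord γ l i = n i := by
  have hpi := Real.pi_pos
  constructor
  · intro h
    have h1 : ∀ i, ∃ n : ℤ, dualCoord γ l i = n := fun i => by
      obtain ⟨n, hn⟩ := h (γ i) ⟨Pi.single i 1, by simp [Pi.single_apply]⟩
      refine ⟨n, ?_⟩
      rw [dualCoord_apply, hn]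
      field_simp
    choose n hn using h1
    exact ⟨n, hn⟩
  · rintro ⟨n, hn⟩ g ⟨m, rfl⟩
    refine ⟨∑ j, m j * n j, ?_⟩
    have h1 : ∀ i, ⟪l, γ i⟫_ℝ = 2 * Real.pi * n i := fun i => by
      rw [← hn i, dualCoord_apply]; field_simp
    simp only [inner_sum, inner_smul_right, h1]
    push_cast
    rw [Finset.mul_sum]
    exact Finset.sum_congr rfl fun j _ => by ring

/-- The dual lattice as an additive group. -/
def dualGroup {d : ℕ} (γ : Module.Basis (Fin d) ℝ (E d)) : AddSubgroup (E d) where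
  carrier := dualLattice γ
  zero_mem' := (mem_dualLattice_iff γ 0).2 ⟨0, by simp⟩
  add_mem' := by
    intro a b ha hb
    obtain ⟨n, hn⟩ := (mem_dualLattice_iff γ a).1 ha
    obtain ⟨m, hm⟩ := (mem_dualLattice_iff γ b).1 hb
    exact (mem_dualLattice_iff γ _).2 ⟨n + m, by simp [hn, hm]⟩
  neg_mem' := by
    intro a ha
    obtain ⟨n, hn⟩ := (mem_dualLattice_iff γ a).1 ha
    exact (mem_dualLattice_iff γ _).2 ⟨-n, by simp [hn]⟩

/-- Countability allows almost everywhere periodicity to be used for all lattice translations at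
once. -/
instance countable_dualGroup {d : ℕ} (γ : Module.Basis (Fin d) ℝ (E d)) :
    Countable (dualGroup γ) := by
  have h : ∀ l : dualGroup γ, ∃ n : Fin d → ℤ, ∀ i, dualCoord γ (l : E d) i = n i :=
    fun l => (mem_dualLattice_iff γ _).1 l.2
  choose n hn using h
  refine Function.Injective.countable (f := n) fun a b hab => ?_
  apply Subtype.ext
  apply (dualCoord γ).injective
  funext i
  rw [hn, hn, hab]

/-- The half-open fundamental domain of the dual lattice centered at `k₀`. -/
def halfOpenCell {d : ℕ} (γ : Module.Basis (Fin d) ℝ (E d)) (k₀ : E d) : Set (E d) :=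
  {k | ∀ i, dualCoord γ (k - k₀) i ∈ Set.Ico (-(1 / 2) : ℝ) (1 / 2)}

theorem measurableSet_halfOpenCell {d : ℕ} (γ : Module.Basis (Fin d) ℝ (E d)) (k₀ : E d) :
    MeasurableSet (halfOpenCell γ k₀) := by
  have h : halfOpenCell γ k₀ =
      ⋂ i, (fun k => dualCoord γ (k - k₀) i) ⁻¹' Set.Ico (-(1 / 2) : ℝ) (1 / 2) := by
    ext; simp [halfOpenCell]
  rw [h]
  refine MeasurableSet.iInter fun i => ?_
  have : Continuous fun k => dualCoord γ (k - k₀) i := by fun_prop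
  exact this.measurable measurableSet_Ico

/-- Each coordinate `t i` enters `[-1/2, 1/2)` after exactly one integer shift, namely `-⌊t i +
1/2⌋`. -/
theorem existsUnique_vadd_mem_halfOpenCell {d : ℕ} (γ : Module.Basis (Fin d) ℝ (E d))
    (k₀ x : E d) : ∃! l : dualGroup γ, l +ᵥ x ∈ halfOpenCell γ k₀ := by
  set t := dualCoord γ (x - k₀) with ht
  have hmem : ∀ l : dualGroup γ, l +ᵥ x ∈ halfOpenCell γ k₀ ↔
      ∀ i, dualCoord γ (l : E d) i + t i ∈ Set.Ico (-(1 / 2) : ℝ) (1 / 2) := by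
    intro l
    have : ((l +ᵥ x : E d) - k₀) = (l : E d) + (x - k₀) := by
      change (l : E d) + x - k₀ = _
      abel
    simp only [halfOpenCell, Set.mem_ofPred_eq, this, map_add, Pi.add_apply, ht]
  let n : Fin d → ℝ := fun i => ((-⌊t i + 1 / 2⌋ : ℤ) : ℝ)
  have hn : ∀ i, dualCoord γ ((dualCoord γ).symm n) i = ((-⌊t i + 1 / 2⌋ : ℤ) : ℝ) := by
    intro i; rw [ContinuousLinearEquiv.apply_symm_apply]
  refine ⟨⟨(dualCoord γ).symm n, (mem_dualLattice_iff γ _).2 ⟨fun i => -⌊t i + 1 / 2⌋, hn⟩⟩, ?_, ?_⟩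
  · refine (hmem _).2 fun i => ?_
    rw [hn]
    have h1 := Int.floor_le (t i + 1 / 2)
    have h2 := Int.lt_floor_add_one (t i + 1 / 2)
    push_cast
    constructor <;> linarith
  · rintro ⟨l, hl⟩ h
    apply Subtype.ext
    apply (dualCoord γ).injective
    funext i
    rw [hn]
    obtain ⟨k, hk⟩ := (mem_dualLattice_iff γ l).1 hl
    have h1 := (hmem _).1 h i
    change dualCoord γ l i = _
    change dualCoord γ l i + t i ∈ _ at h1
    rw [hk i] at h1 ⊢
    have : ⌊t i + 1 / 2⌋ = -k i := by
      rw [Int.floor_eq_iff]; push_cast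
      constructor <;> linarith [h1.1, h1.2]
    rw [this]; simp

theorem isAddFundamentalDomain_halfOpenCell {d : ℕ} (γ : Module.Basis (Fin d) ℝ (E d))
    (k₀ : E d) : IsAddFundamentalDomain (dualGroup γ) (halfOpenCell γ k₀) volume :=
  IsAddFundamentalDomain.mk' (measurableSet_halfOpenCell γ k₀).nullMeasurableSet
    (existsUnique_vadd_mem_halfOpenCell γ k₀)

/-- The cells differ only on the faces where a coordinate equals `1/2`; each lies in a translate of
the kernel of a nonzero functional, hence is null. -/
theorem dualCell_ae_eq {d : ℕ} (γ : Module.Basis (Fin d) ℝ (E d)) :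
    dualCell γ =ᵐ[volume] halfOpenCell γ 0 := by
  have hnull : ∀ i : Fin d, ∀ᵐ k : E d, dualCoord γ k i ≠ 1 / 2 := by
    intro i
    let f : E d →ₗ[ℝ] ℝ := (LinearMap.proj i) ∘ₗ (dualCoord γ).toLinearMap
    let p : E d := (dualCoord γ).symm (fun _ => 1 / 2)
    have hp : f p = 1 / 2 := by simp [f, p]
    have hS : {k : E d | f k = 1 / 2} = (fun k => k + -p) ⁻¹' (LinearMap.ker f : Set (E d)) := by
      ext k; simp [hp, sub_eq_zero, ← sub_eq_add_neg]
    have hker : LinearMap.ker f ≠ ⊤ := fun h => by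
      have : f p = 0 := by
        have : p ∈ LinearMap.ker f := h ▸ Submodule.mem_top
        simpa using this
      rw [hp] at this; norm_num at this
    have h0 : volume {k : E d | f k = 1 / 2} = 0 := by
      rw [hS, measure_preimage_add_right]
      exact Measure.addHaar_submodule volume _ hker
    have := measure_eq_zero_iff_ae_notMem.1 h0
    filter_upwards [this] with k hk hk'
    exact hk hk'
  filter_upwards [ae_all_iff.2 hnull] with k hk
  apply propext
  change (∀ i, _) ↔ ∀ i, _
  refine forall_congr' fun i => ?_
  rw [sub_zero, dualCoord_apply]
  have := hk i
  rw [dualCoord_apply] at this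
  exact ⟨fun h => ⟨h.1, lt_of_le_of_ne h.2 this⟩, fun h => ⟨h.1, h.2.le⟩⟩

/-- Integrals of almost everywhere `Γ*`-periodic functions over fundamental domains agree. -/
theorem setIntegral_dualCell_eq {d : ℕ} (γ : Module.Basis (Fin d) ℝ (E d)) (k₀ : E d)
    {f : E d → ℂ} (hf : ∀ l ∈ dualLattice γ, ∀ᵐ k : E d, f (k + l) = f k) :
    ∫ k in dualCell γ, f k = ∫ k in halfOpenCell γ k₀, f k := by
  -- The set where all periodicity relations hold is conull and invariant, so cutting `f` off
  -- outside it yields a representative that is periodic everywhere.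
  let N : Set (E d) := {k | ∀ l : dualGroup γ, f (k + l) = f k}
  have hN : ∀ᵐ k : E d, k ∈ N := ae_all_iff.2 fun l => hf l l.2
  have hNadd : ∀ (l : dualGroup γ) (k : E d), k ∈ N → (l : E d) + k ∈ N := by
    intro l k hk l'
    have h1 := hk (l + l')
    have h2 := hk l
    rw [AddSubgroup.coe_add, ← add_assoc, add_comm k] at h1
    rw [h1, add_comm, h2]
  let g : E d → ℂ := N.indicator f
  have hg : ∀ (l : dualGroup γ) (k : E d), g (l +ᵥ k) = g k := by
    intro l k
    change g ((l : E d) + k) = g k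
    by_cases hk : k ∈ N
    · have := hk l
      simp only [g, Set.indicator_of_mem hk, Set.indicator_of_mem (hNadd l k hk)]
      rw [add_comm, this]
    · have : (l : E d) + k ∉ N := fun h => hk (by
        have := hNadd (-l) _ h
        simpa using this)
      simp only [g, Set.indicator_of_notMem hk, Set.indicator_of_notMem this]
  have hfg : f =ᵐ[volume] g := by
    filter_upwards [hN] with k hk
    simp only [g, Set.indicator_of_mem hk]
  rw [setIntegral_congr_set (dualCell_ae_eq γ), integral_congr_ae (ae_restrict_of_ae hfg),
    integral_congr_ae (ae_restrict_of_ae hfg)]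
  exact (isAddFundamentalDomain_halfOpenCell γ 0).setIntegral_eq
    (isAddFundamentalDomain_halfOpenCell γ k₀) hg

/-- The coordinates of `k` are controlled by its norm. -/
theorem exists_norm_dualCoord_le {d : ℕ} (γ : Module.Basis (Fin d) ℝ (E d)) :
    ∃ M : ℝ, 0 < M ∧ ∀ (k : E d) (i : Fin d), |dualCoord γ k i| ≤ M * ‖k‖ := by
  refine ⟨‖(dualCoord γ : E d →L[ℝ] (Fin d → ℝ))‖ + 1, by positivity, fun k i => ?_⟩
  have h1 := (dualCoord γ : E d →L[ℝ] (Fin d → ℝ)).le_opNorm k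
  have h2 := norm_le_pi_norm (dualCoord γ k) i
  rw [Real.norm_eq_abs] at h2
  have h3 := norm_nonneg k
  refine h2.trans (h1.trans ?_)
  nlinarith

/-- A radius `ρ` such that the balls of radius `ρ` around the points of a `Γ*`-orbit are well
separated and contained in the corresponding cells. -/
theorem exists_separation_radius {d : ℕ} (γ : Module.Basis (Fin d) ℝ (E d)) :
    ∃ ρ : ℝ, 0 < ρ ∧ (∀ l ∈ dualLattice γ, l ≠ 0 → 4 * ρ < ‖l‖) ∧
      ∀ k₀, Metric.closedBall k₀ ρ ⊆ halfOpenCell γ k₀ := by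
  obtain ⟨M, hM, h⟩ := exists_norm_dualCoord_le γ
  -- A lattice vector of norm at most `4ρ` has integer coordinates bounded by `1/2`, hence zero; on
  -- the closed ball of radius `ρ` the coordinates relative to the center are at most `1/8`.
  refine ⟨1 / (8 * M), by positivity, fun l hl hl0 => ?_, fun k₀ k hk i => ?_⟩
  · obtain ⟨n, hn⟩ := (mem_dualLattice_iff γ l).1 hl
    by_contra! hle
    apply hl0
    apply (dualCoord γ).injective
    funext i
    have h1 := h l i
    rw [hn i] at h1 ⊢
    have h2 : |(n i : ℝ)| < 1 := by
      calc _ ≤ M * ‖l‖ := h1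
        _ ≤ M * (4 * (1 / (8 * M))) := by gcongr
        _ = 1 / 2 := by field_simp; norm_num
        _ < 1 := by norm_num
    have h3 : |n i| < 1 := by exact_mod_cast h2
    rw [Int.abs_lt_one_iff.1 h3]; simp
  · rw [mem_closedBall_iff_norm] at hk
    have h1 := h (k - k₀) i
    have h2 : |dualCoord γ (k - k₀) i| ≤ 1 / 8 := by
      calc _ ≤ M * ‖k - k₀‖ := h1
        _ ≤ M * (1 / (8 * M)) := by gcongr
        _ = 1 / 8 := by field_simp
    rw [abs_le] at h2
    constructor <;> linarith [h2.1, h2.2]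

theorem exists_isCompact_halfOpenCell_subset {d : ℕ} (γ : Module.Basis (Fin d) ℝ (E d)) (k₀ : E d) :
    ∃ K : Set (E d), IsCompact K ∧ halfOpenCell γ k₀ ⊆ K := by
  refine ⟨(fun v => (dualCoord γ).symm v + k₀) '' Set.Icc (fun _ => -(1 / 2)) (fun _ => 1 / 2),
    isCompact_Icc.image (by fun_prop), fun k hk => ?_⟩
  refine ⟨dualCoord γ (k - k₀), ⟨fun i => (hk i).1, fun i => (hk i).2.le⟩, ?_⟩
  simp

theorem exists_norm_le_of_periodic {d : ℕ} (γ : Module.Basis (Fin d) ℝ (E d)) {F : Type*}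
    [NormedAddCommGroup F] {f : E d → F} (hf : Continuous f)
    (hper : ∀ l ∈ dualLattice γ, ∀ k, f (k + l) = f k) : ∃ M, 0 < M ∧ ∀ k, ‖f k‖ ≤ M := by
  obtain ⟨K, hK, hsub⟩ := exists_isCompact_halfOpenCell_subset γ 0
  obtain ⟨M, hM⟩ := hK.exists_bound_of_continuousOn hf.continuousOn
  refine ⟨max M 1, by positivity, fun k => ?_⟩
  obtain ⟨l, hl, -⟩ := existsUnique_vadd_mem_halfOpenCell γ 0 k
  rw [← hper l l.2 k, add_comm]
  exact (hM _ (hsub hl)).trans (le_max_left _ _)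

/-! ### Periodic extension of localized vector fields -/

/-- The sum of all `Γ*`-translates of `X`. -/
def periodize {d : ℕ} (γ : Module.Basis (Fin d) ℝ (E d)) (X : E d → E d) (x : E d) : E d :=
  ∑ᶠ l : dualGroup γ, X (x + l)

theorem periodize_add {d : ℕ} {γ : Module.Basis (Fin d) ℝ (E d)} (X : E d → E d) {l : E d}
    (hl : l ∈ dualLattice γ) (x : E d) : periodize γ X (x + l) = periodize γ X x := by
  let l' : dualGroup γ := ⟨l, hl⟩
  unfold periodize
  rw [← finsum_comp_equiv (Equiv.addLeft l') (f := fun k : dualGroup γ => X (x + k))]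
  refine finsum_congr fun k => ?_
  simp [l', add_assoc]

section
variable {d : ℕ} {γ : Module.Basis (Fin d) ℝ (E d)} {X : E d → E d} {k₀ : E d} {ρ : ℝ}
  (hsep : ∀ l ∈ dualLattice γ, l ≠ 0 → 4 * ρ < ‖l‖)
  (hX : ∀ x ∉ Metric.closedBall k₀ ρ, X x = 0)

include hsep hX

/-- Locally, the periodic extension is a single translate. -/
theorem periodize_eq_translate (x : E d) :
    ∃ l : dualGroup γ, ∀ y ∈ Metric.ball x ρ, periodize γ X y = X (y + l) := by
  by_cases h : ∃ l : dualGroup γ, ∃ y ∈ Metric.ball x ρ, y + l ∈ Metric.closedBall k₀ ρ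
  · obtain ⟨l, y, hy, hyl⟩ := h
    refine ⟨l, fun z hz => ?_⟩
    refine finsum_eq_single _ l fun l' hl' => hX _ fun hzl => ?_
    have hne : ((l' - l : dualGroup γ) : E d) ≠ 0 := by
      simpa [sub_eq_zero] using hl'
    have h1 := hsep _ (l' - l).2 hne
    rw [mem_closedBall_iff_norm] at hyl hzl
    rw [mem_ball_iff_norm] at hy hz
    -- Two translates active in the same ball would differ by a lattice vector of norm less than `ρ
    -- + ρ + ρ + ρ`.
    have h2 : ((l' - l : dualGroup γ) : E d)
        = ((z + l' - k₀) - (y + l - k₀)) + ((y - x) - (z - x)) := by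
      push_cast; abel
    have h3 := norm_add_le ((z + l' - k₀) - (y + l - k₀)) ((y - x) - (z - x))
    have h4 := norm_sub_le (z + l' - k₀) (y + l - k₀)
    have h5 := norm_sub_le (y - x) (z - x)
    rw [← h2] at h3
    linarith
  · push Not at h
    refine ⟨0, fun y hy => ?_⟩
    rw [hX _ (h 0 y hy)]
    exact finsum_eq_zero_of_forall_eq_zero fun l => hX _ (h l y hy)

/-- A nonzero translate contributing here would have norm below `3ρ`, which separation excludes. The
doubled radius gives agreement on a neighborhood of the closed ball, so derivatives agree there too.
-/
theorem periodize_eq_self {y : E d} (hy : y ∈ Metric.ball k₀ (2 * ρ)) :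
    periodize γ X y = X y := by
  have := finsum_eq_single (fun l : dualGroup γ => X (y + l)) 0 fun l hl => hX _ fun hyl => by
    have hne : (l : E d) ≠ 0 := by simpa using hl
    have h1 := hsep _ l.2 hne
    rw [mem_closedBall_iff_norm] at hyl
    rw [mem_ball_iff_norm] at hy
    have h2 := norm_sub_le (y + l - k₀) (y - k₀)
    rw [show y + l - k₀ - (y - k₀) = (l : E d) by abel] at h2
    have h3 := norm_nonneg (y - k₀)
    linarith
  unfold periodize
  simpa using this

theorem contDiff_periodize (hρ : 0 < ρ) (hXs : ContDiff ℝ ∞ X) :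
    ContDiff ℝ ∞ (periodize γ X) := by
  rw [contDiff_iff_contDiffAt]
  intro x
  obtain ⟨l, hl⟩ := periodize_eq_translate hsep hX x
  have h1 : ContDiff ℝ ∞ fun y => X (y + (l : E d)) := hXs.comp (contDiff_id.add contDiff_const)
  refine h1.contDiffAt.congr_of_eventuallyEq ?_
  filter_upwards [Metric.ball_mem_nhds x hρ] with y hy using hl y hy

theorem norm_fderiv_periodize_le (hρ : 0 < ρ) {b : ℝ} (hb : ∀ x, ‖fderiv ℝ X x‖ ≤ b) (x : E d) :
    ‖fderiv ℝ (periodize γ X) x‖ ≤ b := by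
  obtain ⟨l, hl⟩ := periodize_eq_translate hsep hX x
  have : periodize γ X =ᶠ[𝓝 x] fun y => X (y + (l : E d)) := by
    filter_upwards [Metric.ball_mem_nhds x hρ] with y hy using hl y hy
  rw [this.fderiv_eq, fderiv_comp_add_right]
  exact hb _

theorem norm_periodize_le (hρ : 0 < ρ) {b : ℝ} (hb : ∀ x, ‖X x‖ ≤ b) (x : E d) :
    ‖periodize γ X x‖ ≤ b := by
  obtain ⟨l, hl⟩ := periodize_eq_translate hsep hX x
  rw [hl x (Metric.mem_ball_self hρ)]
  exact hb _

omit hsep in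
theorem periodize_eq_zero {x : E d} (h : ∀ l ∈ dualLattice γ, x + l ∉ Metric.closedBall k₀ ρ) :
    periodize γ X x = 0 :=
  finsum_eq_zero_of_forall_eq_zero fun l => hX _ (h l l.2)

end

/-! ### Diffeomorphisms close to the identity -/

/-- By the mean value inequality `Z` is `1/2`-Lipschitz, so `id + Z` is a small Lipschitz
perturbation of the identity and thus a homeomorphism. Its derivative is invertible by the Neumann
series, which makes the inverse smooth. -/
theorem exists_homeomorph_id_add {d : ℕ} {Z : E d → E d} (hZ : ContDiff ℝ ∞ Z)
    (hb : ∀ x, ‖fderiv ℝ Z x‖ ≤ 1 / 2) :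
    ∃ Φ : E d ≃ₜ E d, (∀ x, Φ x = x + Z x) ∧ ContDiff ℝ ∞ Φ ∧ ContDiff ℝ ∞ Φ.symm := by
  have hdiff : Differentiable ℝ Z := hZ.differentiable (by simp)
  have happ : ApproximatesLinearOn (fun x => x + Z x)
      ((ContinuousLinearEquiv.refl ℝ (E d) : E d ≃L[ℝ] E d) : E d →L[ℝ] E d) Set.univ
      (1 / 2 : NNReal) := by
    intro x _ y _
    have h1 := convex_univ.norm_image_sub_le_of_norm_fderiv_le (𝕜 := ℝ) (f := Z) (C := 1 / 2)
      (fun x _ => hdiff x) (fun x _ => hb x) (Set.mem_univ y) (Set.mem_univ x)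
    have h2 : x + Z x - (y + Z y)
        - ((ContinuousLinearEquiv.refl ℝ (E d) : E d ≃L[ℝ] E d) : E d →L[ℝ] E d) (x - y)
        = Z x - Z y := by
      simp; abel
    rw [h2]
    simpa using h1
  have hc : Subsingleton (E d) ∨ (1 / 2 : NNReal) <
      ‖((ContinuousLinearEquiv.refl ℝ (E d)).symm : E d →L[ℝ] E d)‖₊⁻¹ := by
    rcases subsingleton_or_nontrivial (E d) with h | h
    · exact Or.inl h
    · right
      have : ‖((ContinuousLinearEquiv.refl ℝ (E d)).symm : E d →L[ℝ] E d)‖₊ = 1 := by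
        have : ‖ContinuousLinearMap.id ℝ (E d)‖₊ = 1 := by
          apply NNReal.eq; simp
        exact this
      rw [this, inv_one]
      rw [← NNReal.coe_lt_coe]; norm_num
  let Φ := happ.toHomeomorph _ hc
  have hΦ : ∀ x, Φ x = x + Z x := fun x => rfl
  have hΦs : ContDiff ℝ ∞ Φ := contDiff_id.add hZ
  have hinv : ∀ x, ∃ e : E d ≃L[ℝ] E d, HasFDerivAt Φ (e : E d →L[ℝ] E d) x := by
    intro x
    have hlt : ‖-fderiv ℝ Z x‖ < 1 := by rw [norm_neg]; linarith [hb x]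
    refine ⟨ContinuousLinearEquiv.unitsEquiv ℝ (E d) (Units.oneSub _ hlt), ?_⟩
    have h1 : HasFDerivAt (fun x => x + Z x) (ContinuousLinearMap.id ℝ (E d) + fderiv ℝ Z x) x :=
      (hasFDerivAt_id x).add (hdiff x).hasFDerivAt
    have h2 : ((ContinuousLinearEquiv.unitsEquiv ℝ (E d) (Units.oneSub _ hlt) : E d ≃L[ℝ] E d) :
        E d →L[ℝ] E d) = ContinuousLinearMap.id ℝ (E d) + fderiv ℝ Z x := by
      ext1 v
      change ((Units.oneSub _ hlt : (E d →L[ℝ] E d)ˣ) : E d →L[ℝ] E d) v = _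
      simp
    rw [h2]
    exact h1
  choose e he using hinv
  exact ⟨Φ, hΦ, hΦs, Φ.contDiff_symm he hΦs⟩

/-! ### Determinants and the change of variables -/

theorem continuousLinearMap_det_eq {d : ℕ} (A : E d →L[ℝ] E d) :
    A.det = Matrix.det (Matrix.of fun i j => (A (unitVec j)) i) := by
  rw [ContinuousLinearMap.det, ← LinearMap.det_toMatrix (EuclideanSpace.basisFun (Fin d) ℝ).toBasis]
  congr 1

theorem contDiff_continuousLinearMap_det {d : ℕ} {n : WithTop ℕ∞} :
    ContDiff ℝ n (fun A : E d →L[ℝ] E d => A.det) := by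
  simp only [continuousLinearMap_det_eq]
  simp only [Matrix.det_apply, Matrix.of_apply]
  refine ContDiff.sum fun σ _ => ?_
  refine ContDiff.const_smul _ (contDiff_prod fun i _ => ?_)
  have : IsBoundedLinearMap ℝ fun A : E d →L[ℝ] E d => (A (unitVec i)) (σ i) := by
    exact ((EuclideanSpace.proj (σ i) : E d →L[ℝ] ℝ).comp
      (ContinuousLinearMap.apply ℝ (E d) (unitVec i))).isBoundedLinearMap
  exact this.contDiff

theorem integral_eq_integral_comp_homeomorph {d : ℕ} {Φ : E d ≃ₜ E d} (hΦ : ContDiff ℝ ∞ Φ)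
    (hJ : ∀ x, 0 < (fderiv ℝ Φ x).det) (h : E d → ℂ) :
    ∫ y, h y = ∫ x, (((fderiv ℝ Φ x).det : ℝ) : ℂ) * h (Φ x) := by
  have h1 := integral_image_eq_integral_abs_det_fderiv_smul volume (s := Set.univ) (f := Φ)
    MeasurableSet.univ (fun x _ => ((hΦ.differentiable (by simp)) x).hasFDerivAt.hasFDerivWithinAt)
    Φ.injective.injOn h
  rw [Set.image_univ, Φ.surjective.range_eq, setIntegral_univ, setIntegral_univ] at h1
  rw [h1]
  refine integral_congr_ae (Eventually.of_forall fun x => ?_)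
  simp [abs_of_pos (hJ x)]

/-! ### The chain rule for weak derivatives -/

theorem sum_smul_unitVec {d : ℕ} (v : E d) : ∑ i, v i • (unitVec i : E d) = v := by
  have := (EuclideanSpace.basisFun (Fin d) ℝ).sum_repr v
  simpa [unitVec] using this

theorem fderiv_apply_eq_sum {d : ℕ} {F : Type*} [NormedAddCommGroup F] [NormedSpace ℝ F]
    (L : E d →L[ℝ] F) (v : E d) : L v = ∑ i, v i • L (unitVec i) := by
  conv_lhs => rw [← sum_smul_unitVec v]
  simp

theorem contDiff_fderiv_apply {d : ℕ} {F : Type*} [NormedAddCommGroup F] [NormedSpace ℝ F]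
    {f : E d → F} (hf : ContDiff ℝ ∞ f) (v : E d) : ContDiff ℝ ∞ fun x => fderiv ℝ f x v :=
  (hf.fderiv_right (m := ∞) (by simp)).clm_apply contDiff_const

/-- Integration by parts for a smooth function against a test function. -/
theorem integral_mul_fderiv_eq_neg {d : ℕ} {f g : E d → ℝ} (hf : ContDiff ℝ ∞ f)
    (hg : ContDiff ℝ ∞ g) (hgs : HasCompactSupport g) (v : E d) :
    ∫ x, fderiv ℝ g x v * f x = -∫ x, g x * fderiv ℝ f x v := by
  have hfd := (contDiff_fderiv_apply hf v).continuous
  have hgd := (contDiff_fderiv_apply hg v).continuous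
  have hgs' : HasCompactSupport fun x => fderiv ℝ g x v := hgs.fderiv_apply ℝ v
  rw [integral_mul_fderiv_eq_neg_fderiv_mul_of_integrable, neg_neg]
  · exact (hgd.mul hf.continuous).integrable_of_hasCompactSupport hgs'.mul_right
  · exact (hg.continuous.mul hfd).integrable_of_hasCompactSupport hgs.mul_right
  · exact (hg.continuous.mul hf.continuous).integrable_of_hasCompactSupport hgs.mul_right
  · exact fun x _ => hg.differentiable (by simp) x
  · exact fun x _ => hf.differentiable (by simp) x

theorem integrable_ofReal_mul_of_hasCompactSupport {d : ℕ} {ψ : E d → ℝ} {f : E d → ℂ}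
    (hψ : Continuous ψ) (hs : HasCompactSupport ψ) (hf : LocallyIntegrable f) :
    Integrable fun x => ((ψ x : ℝ) : ℂ) * f x := by
  have := hf.integrable_smul_left_of_hasCompactSupport hψ hs
  simpa using this

/-- A change of variables moves the diffeomorphism onto the test function: `ψ i` is the test
function to be used with the `i`-th weak derivative of `f`. What makes the two sides match is the
Piola-type identity `J · (∂ⱼφ ∘ Φ) = ∑ᵢ ∂ᵢ ψᵢ`. -/
theorem IsWeakPartialDeriv.comp_homeomorph {d : ℕ} {Φ : E d ≃ₜ E d} (hΦ : ContDiff ℝ ∞ Φ)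
    (hG : ContDiff ℝ ∞ Φ.symm) (hJ : ∀ x, 0 < (fderiv ℝ Φ x).det) {f : E d → ℂ}
    {g : Fin d → E d → ℂ} (hf : LocallyIntegrable f) (hg : ∀ i, LocallyIntegrable (g i))
    (hfg : ∀ i, IsWeakPartialDeriv i f (g i)) (j : Fin d) :
    IsWeakPartialDeriv j (fun y => f (Φ.symm y))
      (fun y => ∑ i, ((fderiv ℝ Φ.symm y (unitVec j) i : ℝ) : ℂ) * g i (Φ.symm y)) := by
  intro φ hφ hφs
  let J : E d → ℝ := fun x => (fderiv ℝ Φ x).det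
  have hJs : ContDiff ℝ ∞ J :=
    contDiff_continuousLinearMap_det.comp (hΦ.fderiv_right (m := ∞) (by simp))
  let D : Fin d → E d → ℝ := fun i y => fderiv ℝ Φ.symm y (unitVec j) i
  have hD : ∀ i, ContDiff ℝ ∞ (D i) := fun i =>
    (EuclideanSpace.proj i : E d →L[ℝ] ℝ).contDiff.comp (contDiff_fderiv_apply hG (unitVec j))
  let ψ : Fin d → E d → ℝ := fun i x => J x * (D i (Φ x) * φ (Φ x))
  have hφΦ : HasCompactSupport fun x => φ (Φ x) := hφs.comp_homeomorph Φ
  have hψ : ∀ i, ContDiff ℝ ∞ (ψ i) := fun i =>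
    hJs.mul (((hD i).comp hΦ).mul (hφ.comp hΦ))
  have hψs : ∀ i, HasCompactSupport (ψ i) := fun i => (hφΦ.mul_left).mul_left
  let ψ0 : E d → ℝ := fun x => J x * fderiv ℝ φ (Φ x) (unitVec j)
  have hψ0 : Continuous ψ0 :=
    hJs.continuous.mul ((contDiff_fderiv_apply hφ (unitVec j)).continuous.comp Φ.continuous)
  have hψ0s : HasCompactSupport ψ0 :=
    ((hφs.fderiv_apply ℝ (unitVec j)).comp_homeomorph Φ).mul_left
  let dψ : Fin d → E d → ℝ := fun i x => fderiv ℝ (ψ i) x (unitVec i)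
  have hdψ : ∀ i, Continuous (dψ i) := fun i => (contDiff_fderiv_apply (hψ i) _).continuous
  have hdψs : ∀ i, HasCompactSupport (dψ i) := fun i => (hψs i).fderiv_apply ℝ _
  -- The identity is verified weakly, by testing with a smooth `h`, transporting to `h ∘ Φ⁻¹`,
  -- integrating by parts there and transporting back. This avoids differentiating the Jacobian and
  -- the inverse matrix.
  have key : ∀ᵐ x : E d, ψ0 x - ∑ i, dψ i x = 0 := by
    have hcont : Continuous fun x => ψ0 x - ∑ i, dψ i x :=
      hψ0.sub (continuous_finsetSum _ fun i _ => hdψ i)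
    refine ae_eq_zero_of_integral_contDiff_smul_eq_zero hcont.locallyIntegrable ?_
    intro h hh hhs
    have int1 : Integrable fun x => h x * ψ0 x :=
      (hh.continuous.mul hψ0).integrable_of_hasCompactSupport hhs.mul_right
    have int2 : ∀ i, Integrable fun x => h x * dψ i x := fun i =>
      (hh.continuous.mul (hdψ i)).integrable_of_hasCompactSupport hhs.mul_right
    have int3 : ∀ i, Integrable fun x => ψ i x * fderiv ℝ h x (unitVec i) := fun i =>
      ((hψ i).continuous.mul (contDiff_fderiv_apply hh _).continuous).integrable_of_hasCompactSupport
        (hψs i).mul_right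
    have e1 : ∀ i, ∫ x, h x * dψ i x = -∫ x, ψ i x * fderiv ℝ h x (unitVec i) := fun i => by
      rw [← integral_mul_fderiv_eq_neg hh (hψ i) (hψs i)]
      exact integral_congr_ae (Eventually.of_forall fun x => mul_comm _ _)
    have cov : ∀ u : E d → ℝ, ∫ y, u y = ∫ x, J x * u (Φ x) := fun u => by
      have := integral_eq_integral_comp_homeomorph hΦ hJ (fun y => ((u y : ℝ) : ℂ))
      simp only [← Complex.ofReal_mul, integral_complex_ofReal] at this
      exact_mod_cast this
    have hhG : ContDiff ℝ ∞ fun y => h (Φ.symm y) := hh.comp hG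
    have e2 : ∫ x, h x * ψ0 x = -∑ i, ∫ x, ψ i x * fderiv ℝ h x (unitVec i) := by
      have h1 := integral_mul_fderiv_eq_neg hhG hφ hφs (unitVec j)
      rw [cov (fun y => fderiv ℝ φ y (unitVec j) * h (Φ.symm y)),
        cov (fun y => φ y * fderiv ℝ (fun y => h (Φ.symm y)) y (unitVec j))] at h1
      rw [← integral_finsetSum _ fun i _ => int3 i]
      calc _ = ∫ x, J x * (fderiv ℝ φ (Φ x) (unitVec j) * h (Φ.symm (Φ x))) := by
            refine integral_congr_ae (Eventually.of_forall fun x => ?_)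
            simp only [ψ0, Homeomorph.symm_apply_apply]; ring
        _ = _ := h1
        _ = _ := by
            congr 1
            refine integral_congr_ae (Eventually.of_forall fun x => ?_)
            have h2 : fderiv ℝ (fun y => h (Φ.symm y)) (Φ x)
                = (fderiv ℝ h x).comp (fderiv ℝ Φ.symm (Φ x)) := by
              have := fderiv_comp (𝕜 := ℝ) (g := h) (f := Φ.symm) (Φ x)
                (hh.differentiable (by simp) _) (hG.differentiable (by simp) _)
              rw [Homeomorph.symm_apply_apply] at this
              exact this
            simp only [h2, ContinuousLinearMap.comp_apply]
            rw [fderiv_apply_eq_sum (fderiv ℝ h x), Finset.mul_sum, Finset.mul_sum]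
            refine Finset.sum_congr rfl fun i _ => ?_
            simp only [ψ, D, smul_eq_mul]; ring
    simp only [smul_eq_mul, mul_sub, Finset.mul_sum]
    rw [integral_sub int1 (integrable_finsetSum _ fun i _ => int2 i),
      integral_finsetSum _ fun i _ => int2 i, e2, Finset.sum_congr rfl fun i _ => e1 i]
    simp
  have lhs : ∫ y, ((fderiv ℝ φ y (unitVec j) : ℝ) : ℂ) * f (Φ.symm y)
      = ∫ x, ((ψ0 x : ℝ) : ℂ) * f x := by
    rw [integral_eq_integral_comp_homeomorph hΦ hJ]
    refine integral_congr_ae (Eventually.of_forall fun x => ?_)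
    simp only [ψ0, J, Homeomorph.symm_apply_apply, Complex.ofReal_mul, mul_assoc]
  have rhs : ∫ y, ((φ y : ℝ) : ℂ) *
      ∑ i, ((fderiv ℝ Φ.symm y (unitVec j) i : ℝ) : ℂ) * g i (Φ.symm y)
      = ∑ i, ∫ x, ((ψ i x : ℝ) : ℂ) * g i x := by
    rw [integral_eq_integral_comp_homeomorph hΦ hJ, ← integral_finsetSum _ fun i _ =>
      integrable_ofReal_mul_of_hasCompactSupport (hψ i).continuous (hψs i) (hg i)]
    refine integral_congr_ae (Eventually.of_forall fun x => ?_)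
    simp only [ψ, J, D, Homeomorph.symm_apply_apply, Complex.ofReal_mul, Finset.mul_sum]
    exact Finset.sum_congr rfl fun i _ => by ring
  rw [lhs, rhs, ← Finset.sum_neg_distrib]
  have e3 : ∀ i, -∫ x, ((ψ i x : ℝ) : ℂ) * g i x = ∫ x, ((dψ i x : ℝ) : ℂ) * f x := fun i =>
    (hfg i (ψ i) (hψ i) (hψs i)).symm
  rw [Finset.sum_congr rfl fun i _ => e3 i, ← integral_finsetSum _ fun i _ =>
    integrable_ofReal_mul_of_hasCompactSupport (hdψ i) (hdψs i) hf]
  refine integral_congr_ae ?_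
  filter_upwards [key] with x hx
  rw [sub_eq_zero.1 hx, Complex.ofReal_sum, Finset.sum_mul]

/-! ### Composition of Sobolev maps with periodic diffeomorphisms -/

/-- Local square integrability. -/
def MemL2Loc {d : ℕ} (f : E d → ℂ) : Prop :=
  ∀ K : Set (E d), IsCompact K → MemLp f 2 (volume.restrict K)

theorem MemL2Loc.locallyIntegrable {d : ℕ} {f : E d → ℂ} (hf : MemL2Loc f) :
    LocallyIntegrable f := by
  rw [locallyIntegrable_iff]
  intro K hK
  have : IsFiniteMeasure ((volume : Measure (E d)).restrict K) :=
    ⟨by rw [Measure.restrict_apply_univ]; exact hK.measure_lt_top⟩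
  exact (hf K hK).integrable (by norm_num)

theorem MemL2Loc.continuous_mul {d : ℕ} {c f : E d → ℂ} (hc : Continuous c) (hf : MemL2Loc f) :
    MemL2Loc fun x => c x * f x := by
  intro K hK
  obtain ⟨M, hM⟩ := hK.exists_bound_of_continuousOn hc.continuousOn
  refine MemLp.of_le_mul (c := M) (hf K hK) (hc.aestronglyMeasurable.mul (hf K hK).1) ?_
  filter_upwards [ae_restrict_mem hK.measurableSet] with x hx
  rw [norm_mul]
  exact mul_le_mul_of_nonneg_right (hM x hx) (norm_nonneg _)

theorem MemL2Loc.sum {d : ℕ} {ι : Type*} (s : Finset ι) {f : ι → E d → ℂ}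
    (hf : ∀ i ∈ s, MemL2Loc (f i)) : MemL2Loc fun x => ∑ i ∈ s, f i x :=
  fun K hK => memLp_finsetSum _ fun i hi => hf i hi K hK

section
variable {d : ℕ} {Φ : E d ≃ₜ E d} (hΦ : ContDiff ℝ ∞ Φ)
include hΦ

theorem volume_preimage_symm (S : Set (E d)) (hS : MeasurableSet S) :
    volume (Φ.symm ⁻¹' S) = ∫⁻ x in S, ENNReal.ofReal |(fderiv ℝ Φ x).det| := by
  rw [lintegral_abs_det_fderiv_eq_addHaar_image volume hS
    (fun x _ => ((hΦ.differentiable (by simp)) x).hasFDerivAt.hasFDerivWithinAt)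
    Φ.injective.injOn]
  congr 1
  exact (Φ.image_eq_preimage_symm S).symm

theorem quasiMeasurePreserving_symm :
    Measure.QuasiMeasurePreserving Φ.symm (volume : Measure (E d)) volume := by
  refine ⟨Φ.symm.continuous.measurable, Measure.AbsolutelyContinuous.mk fun S hS h0 => ?_⟩
  rw [Measure.map_apply Φ.symm.continuous.measurable hS, volume_preimage_symm hΦ S hS,
    Measure.restrict_eq_zero.2 h0, lintegral_zero_measure]

/-- On a compact set the Jacobian is bounded, so the image under `Φ⁻¹` of Lebesgue measure on `K` is
dominated by a multiple of Lebesgue measure on `Φ⁻¹(K)`. -/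
theorem MemL2Loc.comp_symm {f : E d → ℂ} (hf : MemL2Loc f) :
    MemL2Loc fun y => f (Φ.symm y) := by
  intro K hK
  have hGK : IsCompact (Φ.symm '' K) := hK.image Φ.symm.continuous
  have hJ : Continuous fun x => (fderiv ℝ Φ x).det :=
    (contDiff_continuousLinearMap_det (n := ∞)).continuous.comp (hΦ.continuous_fderiv (by simp))
  obtain ⟨C, hC⟩ := hGK.exists_bound_of_continuousOn hJ.continuousOn
  have hmeas : Measurable Φ.symm := Φ.symm.continuous.measurable
  have hle : Measure.map Φ.symm ((volume : Measure (E d)).restrict K)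
      ≤ ENNReal.ofReal C • (volume : Measure (E d)).restrict (Φ.symm '' K) := by
    refine Measure.le_iff.2 fun S hS => ?_
    rw [Measure.map_apply hmeas hS, Measure.restrict_apply (hmeas hS), Measure.smul_apply,
      Measure.restrict_apply hS, smul_eq_mul]
    have h1 : Φ.symm ⁻¹' S ∩ K = Φ.symm ⁻¹' (S ∩ Φ.symm '' K) := by
      rw [Set.preimage_inter, Set.preimage_image_eq _ Φ.symm.injective]
    have hm : MeasurableSet (S ∩ Φ.symm '' K) := hS.inter hGK.measurableSet
    rw [h1, volume_preimage_symm hΦ _ hm]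
    calc _ ≤ ∫⁻ _ in S ∩ Φ.symm '' K, ENNReal.ofReal C := by
          refine setLIntegral_mono measurable_const fun x hx => ?_
          exact ENNReal.ofReal_le_ofReal (by simpa using hC x hx.2)
      _ = _ := by rw [setLIntegral_const]
  have h2 := (hf _ hGK).of_measure_le_smul ENNReal.ofReal_ne_top hle
  exact (memLp_map_measure_iff h2.1 hmeas.aemeasurable).1 h2

end

/-- The composition `U ∘ Φ⁻¹` of a Sobolev map with a periodic diffeomorphism. -/
def SobolevMap.compSymm {d m : ℕ} {γ : Module.Basis (Fin d) ℝ (E d)} (U : SobolevMap γ m)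
    (Φ : E d ≃ₜ E d) (hΦ : ContDiff ℝ ∞ Φ) (hG : ContDiff ℝ ∞ Φ.symm)
    (hJ : ∀ x, 0 < (fderiv ℝ Φ x).det)
    (hper : ∀ l ∈ dualLattice γ, ∀ x, Φ (x + l) = Φ x + l) : SobolevMap γ m where
  toFun y := U.toFun (Φ.symm y)
  grad j y := ∑ i, ((fderiv ℝ Φ.symm y (unitVec j) i : ℝ) : ℂ) • U.grad i (Φ.symm y)
  unitary := (quasiMeasurePreserving_symm hΦ).ae U.unitary
  periodic l hl := by
    filter_upwards [(quasiMeasurePreserving_symm hΦ).ae (U.periodic l hl)] with y hy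
    rw [← hy]
    congr 1
    rw [Homeomorph.symm_apply_eq, hper l hl, Homeomorph.apply_symm_apply]
  memLp a b := MemL2Loc.comp_symm hΦ (U.memLp a b)
  memLp_grad j a b := by
    simp only [Matrix.sum_apply, Matrix.smul_apply, smul_eq_mul]
    refine MemL2Loc.sum _ fun i _ => MemL2Loc.continuous_mul ?_
      (MemL2Loc.comp_symm hΦ (U.memLp_grad i a b))
    exact Complex.continuous_ofReal.comp ((EuclideanSpace.proj i : E d →L[ℝ] ℝ).continuous.comp
      (contDiff_fderiv_apply hG (unitVec j)).continuous)
  isWeakPartialDeriv j a b := by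
    simp only [Matrix.sum_apply, Matrix.smul_apply, smul_eq_mul]
    exact IsWeakPartialDeriv.comp_homeomorph hΦ hG hJ
      (f := fun k => U.toFun k a b) (g := fun i k => U.grad i k a b)
      (MemL2Loc.locallyIntegrable (U.memLp a b))
      (fun i => MemL2Loc.locallyIntegrable (U.memLp_grad i a b))
      (fun i => U.isWeakPartialDeriv i a b) j

/-- Weak derivatives are unique: as `U` is periodic, its gradient and the translated gradient have
the same integral against every test function. -/
theorem SobolevMap.grad_periodic {d m : ℕ} {γ : Module.Basis (Fin d) ℝ (E d)}
    (U : SobolevMap γ m) (j : Fin d) {l : E d} (hl : l ∈ dualLattice γ) :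
    ∀ᵐ k : E d, U.grad j (k + l) = U.grad j k := by
  have h : ∀ a b, ∀ᵐ k : E d, U.grad j (k + l) a b = U.grad j k a b := by
    intro a b
    have hg : LocallyIntegrable fun k => U.grad j k a b :=
      MemL2Loc.locallyIntegrable (U.memLp_grad j a b)
    have hgl : LocallyIntegrable fun k => U.grad j (k + l) a b := by
      rw [locallyIntegrable_iff] at hg ⊢
      intro K hK
      have h1 := hg _ (hK.image (continuous_add_const l))
      have h2 := (measurePreserving_add_right (volume : Measure (E d)) l).integrableOn_image
        (MeasurableEquiv.addRight l).measurableEmbedding (f := fun k => U.grad j k a b) (s := K)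
      exact h2.1 h1
    have key := ae_eq_zero_of_integral_contDiff_smul_eq_zero (hgl.sub hg) (μ := volume) ?_
    · filter_upwards [key] with k hk
      exact sub_eq_zero.1 hk
    · intro φ hφ hφs
      have i1 := integrable_ofReal_mul_of_hasCompactSupport hφ.continuous hφs hgl
      have i2 := integrable_ofReal_mul_of_hasCompactSupport hφ.continuous hφs hg
      have hφl : ContDiff ℝ ∞ fun k => φ (k - l) := hφ.comp (contDiff_id.sub contDiff_const)
      have hφls : HasCompactSupport fun k => φ (k - l) :=
        hφs.comp_homeomorph (Homeomorph.subRight l)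
      have e1 : ∫ k, ((φ k : ℝ) : ℂ) * U.grad j (k + l) a b
          = ∫ k, ((φ (k - l) : ℝ) : ℂ) * U.grad j k a b := by
        rw [← integral_add_right_eq_self
          (fun k => ((φ (k - l) : ℝ) : ℂ) * U.grad j k a b) l]
        simp only [add_sub_cancel_right]
      have e2 : ∫ k, ((fderiv ℝ (fun k => φ (k - l)) k (unitVec j) : ℝ) : ℂ) * U.toFun k a b
          = ∫ k, ((fderiv ℝ φ k (unitVec j) : ℝ) : ℂ) * U.toFun k a b := by
        rw [← integral_add_right_eq_self _ l]
        refine integral_congr_ae ?_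
        filter_upwards [U.periodic l hl] with k hk
        rw [hk, fderiv_comp_sub, add_sub_cancel_right]
      have e3 := U.isWeakPartialDeriv j a b _ hφl hφls
      have e4 := U.isWeakPartialDeriv j a b _ hφ hφs
      have e5 : ∀ k, φ k • ((fun k => U.grad j (k + l) a b) - fun k => U.grad j k a b) k
          = ((φ k : ℝ) : ℂ) * U.grad j (k + l) a b - ((φ k : ℝ) : ℂ) * U.grad j k a b := by
        intro k
        simp [mul_sub]
      simp only [e5]
      rw [integral_sub i1 i2, e1]
      have e6 := (e2.symm.trans e3).symm.trans e4
      rw [neg_inj.1 e6, sub_self]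
  filter_upwards [ae_all_iff.2 fun a => ae_all_iff.2 (h a)] with k hk
  ext a b
  exact hk a b

/-! ### Properties of the Berry connection -/

theorem exists_forall_le_of_fintype {ι α : Type*} [Fintype ι] {f : ι → α → ℝ}
    (h : ∀ i, ∃ M, ∀ k, f i k ≤ M) : ∃ M, 0 < M ∧ ∀ i k, f i k ≤ M := by
  choose M hM using h
  have h0 : 0 ≤ ∑ i, |M i| := Finset.sum_nonneg fun _ _ => abs_nonneg _
  refine ⟨∑ i, |M i| + 1, by linarith, fun i k => ?_⟩
  have h1 := Finset.single_le_sum (f := fun i => |M i|) (fun _ _ => abs_nonneg _)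
    (Finset.mem_univ i)
  linarith [hM i k, le_abs_self (M i)]

/-- Multiplication by a unimodular function is isometric. -/
theorem inner_tau {d : ℕ} (γ : Module.Basis (Fin d) ℝ (E d)) (l : E d) (φ ψ : Hf γ) :
    ⟪tau γ l φ, tau γ l ψ⟫_ℂ = ⟪φ, ψ⟫_ℂ := by
  rw [L2.inner_def, L2.inner_def]
  refine integral_congr_ae ?_
  filter_upwards [coeFn_tau γ l φ, coeFn_tau γ l ψ] with y h1 h2
  rw [h1, h2]
  have h3 : ‖character l y‖ = 1 := by
    unfold character
    rw [mul_comm, Complex.norm_exp_ofReal_mul_I]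
  have h4 : character l y * (starRingEnd ℂ) (character l y) = 1 := by
    rw [Complex.mul_conj, Complex.normSq_eq_norm_sq, h3]; simp
  simp only [RCLike.inner_apply, map_mul]
  linear_combination (ψ y * (starRingEnd ℂ) (φ y)) * h4

section
variable {d m : ℕ} {γ : Module.Basis (Fin d) ℝ (E d)} {χ : Fin m → E d → Hf γ}
  (hτ : ∀ a, MemHTau γ (χ a)) (hs : ∀ a, ContDiff ℝ ∞ (χ a))
include hs

theorem contDiff_frameDeriv (j : Fin d) (a : Fin m) : ContDiff ℝ ∞ (frameDeriv χ j a) :=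
  contDiff_fderiv_apply (hs a) _

theorem contDiff_berry (j : Fin d) (a b : Fin m) : ContDiff ℝ ∞ fun k => berry χ j k a b :=
  (hs a).inner ℂ (contDiff_frameDeriv hs j b)

include hτ

/-- Both sides are continuous in `k`, so the almost everywhere relation in `MemHTau` holds at every
point. -/
theorem frame_sub {l : E d} (hl : l ∈ dualLattice γ) (a : Fin m) (k : E d) :
    χ a (k - l) = tau γ l (χ a k) := by
  have h1 : Continuous fun k => χ a (k - l) := (hs a).continuous.comp (continuous_sub_right l)
  have h2 : Continuous fun k => tau γ l (χ a k) := (tau γ l).continuous.comp (hs a).continuous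
  exact congrFun ((h1.ae_eq_iff_eq volume h2).1 ((hτ a).2 l hl)) k

theorem frameDeriv_sub {l : E d} (hl : l ∈ dualLattice γ) (j : Fin d) (a : Fin m) (k : E d) :
    frameDeriv χ j a (k - l) = tau γ l (frameDeriv χ j a k) := by
  have h1 : (fun k => χ a (k - l)) = fun k => (tau γ l).restrictScalars ℝ (χ a k) :=
    funext fun k => frame_sub hτ hs hl a k
  have h2 := congrArg (fun f => fderiv ℝ f k (unitVec j)) h1
  simp only [fderiv_comp_sub] at h2
  have h3 := (((tau γ l).restrictScalars ℝ).hasFDerivAt.comp k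
    ((hs a).differentiable (by simp) k).hasFDerivAt).fderiv
  have h4 := h2.trans (congrArg (fun L => L (unitVec j)) h3)
  exact h4

/-- The isometry `τ(l)` acts on both arguments of the inner product and drops out. Periodicity is
what makes the bounds on the connection uniform. -/
theorem berry_periodic {l : E d} (hl : l ∈ dualLattice γ) (j : Fin d) (k : E d) :
    berry χ j (k + l) = berry χ j k := by
  ext a b
  have h1 := frame_sub hτ hs hl a (k + l)
  have h2 := frameDeriv_sub hτ hs hl j b (k + l)
  rw [add_sub_cancel_right] at h1 h2
  simp only [berry, Matrix.of_apply, h1, h2, inner_tau]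

theorem exists_berry_bound : ∃ M : ℝ, 0 < M ∧ ∀ j k a b, ‖berry χ j k a b‖ ≤ M := by
  have h : ∀ i : Fin d × Fin m × Fin m, ∃ M, ∀ k, ‖berry χ i.1 k i.2.1 i.2.2‖ ≤ M := fun i => by
    obtain ⟨M, -, hM⟩ := exists_norm_le_of_periodic γ
      (contDiff_berry hs i.1 i.2.1 i.2.2).continuous fun l hl k => by rw [berry_periodic hτ hs hl]
    exact ⟨M, hM⟩
  obtain ⟨M, hM, h⟩ := exists_forall_le_of_fintype h
  exact ⟨M, hM, fun j k a b => h (j, a, b) k⟩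

theorem exists_berry_lipschitz :
    ∃ M : ℝ, 0 < M ∧ ∀ j x y a b, ‖berry χ j x a b - berry χ j y a b‖ ≤ M * ‖x - y‖ := by
  have h : ∀ i : Fin d × Fin m × Fin m, ∃ M, ∀ k,
      ‖fderiv ℝ (fun k => berry χ i.1 k i.2.1 i.2.2) k‖ ≤ M := by
    intro i
    obtain ⟨M, -, hM⟩ := exists_norm_le_of_periodic γ
      ((contDiff_berry hs i.1 i.2.1 i.2.2).continuous_fderiv (by simp)) fun l hl k => by
        rw [← fderiv_comp_add_right]
        simp only [berry_periodic hτ hs hl]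
    exact ⟨M, hM⟩
  obtain ⟨M, hM, h⟩ := exists_forall_le_of_fintype h
  exact ⟨M, hM, fun j x y a b => convex_univ.norm_image_sub_le_of_norm_fderiv_le (𝕜 := ℝ)
    (f := fun k => berry χ j k a b) (fun x _ => (contDiff_berry hs j a b).differentiable (by simp) x)
    (fun x _ => h (j, a, b) x) (Set.mem_univ y) (Set.mem_univ x)⟩

end

/-! ### Expansion of the Jacobian near the identity -/

/-- The matrix entries of a linear map of `ℝᵈ`. -/
def entry {d : ℕ} (i j : Fin d) : (E d →L[ℝ] E d) →L[ℝ] ℝ :=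
  (EuclideanSpace.proj i : E d →L[ℝ] ℝ).comp (ContinuousLinearMap.apply ℝ (E d) (unitVec j))

theorem entry_apply {d : ℕ} (i j : Fin d) (A : E d →L[ℝ] E d) :
    entry i j A = (A (unitVec j)) i := rfl

theorem entry_one {d : ℕ} (i j : Fin d) : entry i j (1 : E d →L[ℝ] E d) = if i = j then 1 else 0 := by
  simp [entry_apply, unitVec]

/-- The divergence. -/
def traceCLM {d : ℕ} : (E d →L[ℝ] E d) →L[ℝ] ℝ := ∑ i, entry i i

/-- Jacobi's formula at the identity. Differentiability holds because the determinant is polynomial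
in the entries; the derivative is then read off along lines from `det(1 + sM) = 1 + s tr M + O(s²)`.
-/
theorem hasFDerivAt_det_one_add {d : ℕ} :
    HasFDerivAt (fun A : E d →L[ℝ] E d => (1 + A).det) traceCLM 0 := by
  have hd : DifferentiableAt ℝ (fun A : E d →L[ℝ] E d => (1 + A).det) 0 :=
    ((contDiff_continuousLinearMap_det (n := ∞)).comp
      (contDiff_const.add contDiff_id)).differentiable (by simp) 0
  refine hd.hasFDerivAt.congr_fderiv ?_
  ext B
  symm
  have h1 : HasDerivAt (fun s : ℝ => (1 + s • B).det)
      (fderiv ℝ (fun A : E d →L[ℝ] E d => (1 + A).det) 0 B) 0 := by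
    have h0 : HasDerivAt (fun s : ℝ => s • B) B 0 := by
      simpa using (hasDerivAt_id (0 : ℝ)).smul_const B
    have h2 : HasFDerivAt (fun A : E d →L[ℝ] E d => (1 + A).det)
      (fderiv ℝ (fun A : E d →L[ℝ] E d => (1 + A).det) 0) ((fun s : ℝ => s • B) 0) := by
      have e : (fun s : ℝ => s • B) 0 = 0 := zero_smul ℝ B
      rw [e]
      exact hd.hasFDerivAt
    exact h2.comp_hasDerivAt (0 : ℝ) h0
  let M : Matrix (Fin d) (Fin d) ℝ := Matrix.of fun i j => entry i j B
  have h3 : (fun s : ℝ => (1 + s • B).det) = fun s => Matrix.det (1 + s • M) := by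
    funext s
    rw [continuousLinearMap_det_eq]
    congr 1
    ext i j
    have := entry_one i j
    rw [entry_apply] at this
    simp only [Matrix.of_apply, _root_.add_apply, PiLp.add_apply, this,
      Matrix.add_apply, Matrix.one_apply]
    rfl
  rw [h3] at h1
  have h4 : HasDerivAt (fun s : ℝ => Matrix.det (1 + s • M)) M.trace 0 := by
    rw [funext fun s : ℝ => Matrix.det_one_add_smul s M]
    set q := (1 + (Polynomial.X : Polynomial ℝ) • M.map Polynomial.C).det.divX.divX
    have e1 : HasDerivAt (fun s : ℝ => 1 + M.trace * s) M.trace 0 := by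
      simpa using ((hasDerivAt_id (0 : ℝ)).const_mul M.trace).const_add 1
    have e2 : HasDerivAt (fun s : ℝ => q.eval s * s ^ 2) 0 0 := by
      convert! (q.hasDerivAt 0).mul (hasDerivAt_pow 2 (0 : ℝ)) using 1
      simp
    convert! e1.add e2 using 1
    simp
  rw [← h4.unique h1]
  simp [traceCLM, Matrix.trace, M]

/-- The inverse of `1 + A`. -/
def invOneAdd {d : ℕ} (A : E d →L[ℝ] E d) : E d →L[ℝ] E d := Ring.inverse (1 + A)

theorem invOneAdd_zero {d : ℕ} : invOneAdd (0 : E d →L[ℝ] E d) = 1 := by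
  simp [invOneAdd]

theorem hasFDerivAt_entry_invOneAdd {d : ℕ} (i j : Fin d) :
    HasFDerivAt (fun A : E d →L[ℝ] E d => entry i j (invOneAdd A)) (-entry i j) 0 := by
  have h1 : HasFDerivAt (fun A : E d →L[ℝ] E d => 1 + A) (ContinuousLinearMap.id ℝ _) 0 :=
    (hasFDerivAt_id _).const_add _
  have h2 := hasFDerivAt_ringInverse (𝕜 := ℝ) (1 : (E d →L[ℝ] E d)ˣ)
  have h3 : ((1 : (E d →L[ℝ] E d)ˣ) : E d →L[ℝ] E d) = 1 + 0 := by simp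
  rw [h3] at h2
  have h4 := (entry i j).hasFDerivAt.comp (0 : E d →L[ℝ] E d) (h2.comp 0 h1)
  refine h4.congr_fderiv ?_
  ext B
  simp

/-- The coefficients `det(1 + A) (1 + A)⁻¹` of the transformed first-order terms. -/
def firstCoeff {d : ℕ} (i j : Fin d) (A : E d →L[ℝ] E d) : ℝ :=
  (1 + A).det * entry i j (invOneAdd A)

/-- The coefficients `det(1 + A) (1 + A)⁻¹ (1 + A)⁻ᵀ` of the transformed Dirichlet energy. -/
def dirichletCoeff {d : ℕ} (i l : Fin d) (A : E d →L[ℝ] E d) : ℝ :=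
  (1 + A).det * ∑ j, entry i j (invOneAdd A) * entry l j (invOneAdd A)

theorem det_one_add_zero {d : ℕ} : (1 + (0 : E d →L[ℝ] E d)).det = 1 := by
  simp only [add_zero, ContinuousLinearMap.det]
  exact LinearMap.det_id

/-- The determinant contributes the trace and each of the two inverse factors contributes minus one
entry. This derivative is the origin of `stress`. -/
theorem hasFDerivAt_dirichletCoeff {d : ℕ} (i l : Fin d) :
    HasFDerivAt (dirichletCoeff (d := d) i l)
      ((if i = l then (1 : ℝ) else 0) • traceCLM - entry i l - entry l i) 0 := by
  have h1 := (HasFDerivAt.fun_sum (u := Finset.univ) fun j _ =>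
    (hasFDerivAt_entry_invOneAdd (d := d) i j).mul (hasFDerivAt_entry_invOneAdd l j))
  refine (hasFDerivAt_det_one_add.mul h1).congr_fderiv ?_
  ext B
  simp only [det_one_add_zero, Pi.mul_apply, invOneAdd_zero, entry_one]
  simp [Finset.sum_add_distrib]
  by_cases h : i = l
  · subst h; simp; ring
  · simp [h]; ring

theorem hasFDerivAt_firstCoeff {d : ℕ} (i j : Fin d) :
    ∃ L : (E d →L[ℝ] E d) →L[ℝ] ℝ, HasFDerivAt (firstCoeff (d := d) i j) L 0 :=
  ⟨_, hasFDerivAt_det_one_add.mul (hasFDerivAt_entry_invOneAdd i j)⟩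

theorem firstCoeff_zero {d : ℕ} (i j : Fin d) :
    firstCoeff i j (0 : E d →L[ℝ] E d) = if i = j then 1 else 0 := by
  rw [firstCoeff, det_one_add_zero, invOneAdd_zero, entry_one, one_mul]

theorem dirichletCoeff_zero {d : ℕ} (i l : Fin d) :
    dirichletCoeff i l (0 : E d →L[ℝ] E d) = if i = l then 1 else 0 := by
  rw [dirichletCoeff, det_one_add_zero, invOneAdd_zero]
  simp [entry_one]

theorem eventually_dirichletCoeff {d : ℕ} {ε : ℝ} (hε : 0 < ε) :
    ∀ᶠ A : E d →L[ℝ] E d in 𝓝 0, ∀ i l,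
      |dirichletCoeff i l A - (if i = l then 1 else 0)
        - ((if i = l then 1 else 0) * traceCLM A - entry i l A - entry l i A)| ≤ ε * ‖A‖ := by
  rw [eventually_all]; intro i
  rw [eventually_all]; intro l
  have h := ((hasFDerivAt_dirichletCoeff (d := d) i l).isLittleO).def hε
  filter_upwards [h] with A hA
  rw [dirichletCoeff_zero, sub_zero] at hA
  exact hA

/-- For the lower-order terms a bound linear in `‖A‖` is enough, and differentiability at `0`
provides it; only the Dirichlet coefficients need their exact linear part. -/
theorem exists_coeff_bound (d : ℕ) : ∃ C δ : ℝ, 0 < C ∧ 0 < δ ∧ δ ≤ 1 / 2 ∧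
    ∀ A : E d →L[ℝ] E d, ‖A‖ ≤ δ → 0 < (1 + A).det ∧ |(1 + A).det - 1| ≤ C * ‖A‖ ∧
      ∀ i j, |firstCoeff i j A - (if i = j then 1 else 0)| ≤ C * ‖A‖ := by
  have key : ∀ {f : (E d →L[ℝ] E d) → ℝ} {L : (E d →L[ℝ] E d) →L[ℝ] ℝ}, HasFDerivAt f L 0 →
      ∃ C : ℝ, ∀ᶠ A in 𝓝 0, |f A - f 0| ≤ C * ‖A‖ := fun {f L} h => by
    obtain ⟨C, hC⟩ := h.isBigO_sub.bound
    refine ⟨C, ?_⟩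
    filter_upwards [hC] with A hA
    simpa using hA
  obtain ⟨C0, h0⟩ := key (hasFDerivAt_det_one_add (d := d))
  have h1 : ∀ i : Fin d × Fin d, ∃ C : ℝ, ∀ᶠ A in 𝓝 (0 : E d →L[ℝ] E d),
      |firstCoeff i.1 i.2 A - firstCoeff i.1 i.2 0| ≤ C * ‖A‖ := fun i => by
    obtain ⟨L, hL⟩ := hasFDerivAt_firstCoeff (d := d) i.1 i.2
    exact key hL
  choose C1 h1 using h1
  have hpos : ∀ᶠ A in 𝓝 (0 : E d →L[ℝ] E d), 0 < (1 + A).det := by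
    have := (hasFDerivAt_det_one_add (d := d)).continuousAt
    refine this.eventually (lt_mem_nhds ?_)
    change 0 < (1 + (0 : E d →L[ℝ] E d)).det
    rw [det_one_add_zero]; norm_num
  obtain ⟨δ, hδ, h⟩ := Metric.eventually_nhds_iff.1 (h0.and ((eventually_all.2 h1).and hpos))
  have hS : 0 ≤ ∑ i, |C1 i| := Finset.sum_nonneg fun _ _ => abs_nonneg _
  refine ⟨|C0| + ∑ i, |C1 i| + 1, min (δ / 2) (1 / 2), by positivity, by positivity,
    min_le_right _ _, fun A hA => ?_⟩
  have hA' : dist A 0 < δ := by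
    rw [dist_zero_right]
    have := hA.trans (min_le_left _ _)
    linarith
  obtain ⟨g0, g1, g2⟩ := h hA'
  have hn := norm_nonneg A
  refine ⟨g2, ?_, fun i j => ?_⟩
  · rw [det_one_add_zero] at g0
    refine g0.trans (mul_le_mul_of_nonneg_right ?_ hn)
    linarith [le_abs_self C0]
  · have g := g1 (i, j)
    rw [firstCoeff_zero] at g
    refine g.trans (mul_le_mul_of_nonneg_right ?_ hn)
    have := Finset.single_le_sum (f := fun i => |C1 i|) (fun _ _ => abs_nonneg _)
      (Finset.mem_univ (i, j))
    linarith [le_abs_self (C1 (i, j)), abs_nonneg C0]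

/-! ### Periodic deformations generated by a localized vector field -/

theorem fderiv_symm_apply {d : ℕ} {Φ : E d ≃ₜ E d} (hΦ : ContDiff ℝ ∞ Φ)
    (hG : ContDiff ℝ ∞ Φ.symm) (x : E d) :
    fderiv ℝ Φ.symm (Φ x) = Ring.inverse (fderiv ℝ Φ x) := by
  have hd := hΦ.differentiable (by simp)
  have hd' := hG.differentiable (by simp)
  have h1 : fderiv ℝ Φ.symm (Φ x) * fderiv ℝ Φ x = 1 := by
    have h := ((hd' (Φ x)).hasFDerivAt.comp x (hd x).hasFDerivAt).fderiv
    rw [Homeomorph.symm_comp_self, fderiv_id] at h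
    exact h.symm
  have h2 : fderiv ℝ Φ x * fderiv ℝ Φ.symm (Φ x) = 1 := by
    have h3 := (hd (Φ.symm (Φ x))).hasFDerivAt
    have h := (h3.comp (Φ x) (hd' (Φ x)).hasFDerivAt).fderiv
    rw [Homeomorph.self_comp_symm, fderiv_id, Homeomorph.symm_apply_apply] at h
    exact h.symm
  exact (Ring.inverse_unit (⟨fderiv ℝ Φ x, fderiv ℝ Φ.symm (Φ x), h2, h1⟩ :
    (E d →L[ℝ] E d)ˣ)).symm

theorem fderiv_eq_zero_of_notMem_closedBall {d : ℕ} {X : E d → E d} {k₀ : E d} {ρ : ℝ}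
    (hX : ∀ x ∉ Metric.closedBall k₀ ρ, X x = 0) {x : E d} (hx : x ∉ Metric.closedBall k₀ ρ) :
    fderiv ℝ X x = 0 := by
  have : X =ᶠ[𝓝 x] fun _ => 0 := by
    filter_upwards [Metric.isClosed_closedBall.isOpen_compl.mem_nhds hx] with y hy using hX y hy
  rw [this.fderiv_eq, fderiv_fun_const]; rfl

/-- A diffeomorphism of `ℝᵈ/Γ*` that moves points of the ball only, along the vector field `sX`. -/
theorem exists_deformation {d : ℕ} {γ : Module.Basis (Fin d) ℝ (E d)} {X : E d → E d} {k₀ : E d}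
    {ρ : ℝ} (hρ : 0 < ρ) (hsep : ∀ l ∈ dualLattice γ, l ≠ 0 → 4 * ρ < ‖l‖)
    (hcell : Metric.closedBall k₀ ρ ⊆ halfOpenCell γ k₀)
    (hX : ∀ x ∉ Metric.closedBall k₀ ρ, X x = 0) (hXs : ContDiff ℝ ∞ X)
    {s b b' δ : ℝ} (hs : 0 ≤ s) (hb : ∀ x, ‖fderiv ℝ X x‖ ≤ b) (hb' : ∀ x, ‖X x‖ ≤ b')
    (hδ : δ ≤ 1 / 2) (hsb : s * b ≤ δ) (hsb' : s * b' ≤ ρ)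
    (hdet : ∀ A : E d →L[ℝ] E d, ‖A‖ ≤ δ → 0 < (1 + A).det) :
    ∃ Φ : E d ≃ₜ E d, ContDiff ℝ ∞ Φ ∧ ContDiff ℝ ∞ Φ.symm ∧
      (∀ x, 0 < (fderiv ℝ Φ x).det) ∧ (∀ l ∈ dualLattice γ, ∀ x, Φ (x + l) = Φ x + l) ∧
      Φ '' Metric.closedBall k₀ ρ = Metric.closedBall k₀ ρ ∧
      (∀ x ∈ Metric.closedBall k₀ ρ, Φ x = x + s • X x) ∧
      (∀ x ∈ Metric.closedBall k₀ ρ, fderiv ℝ Φ x = 1 + s • fderiv ℝ X x) ∧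
      (∀ y ∈ halfOpenCell γ k₀ \ Metric.closedBall k₀ ρ, Φ.symm y = y) ∧
      (∀ y ∈ halfOpenCell γ k₀ \ Metric.closedBall k₀ ρ, fderiv ℝ Φ.symm y = 1) := by
  set B := Metric.closedBall k₀ ρ with hB
  let Y : E d → E d := periodize γ X
  have hYs : ContDiff ℝ ∞ Y := contDiff_periodize hsep hX hρ hXs
  have hYd : Differentiable ℝ Y := hYs.differentiable (by simp)
  have hfd : ∀ x, fderiv ℝ (fun x => s • Y x) x = s • fderiv ℝ Y x := fun x =>
    fderiv_const_smul (hYd x) s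
  have hZb : ∀ x, ‖fderiv ℝ (fun x => s • Y x) x‖ ≤ δ := fun x => by
    rw [hfd, norm_smul, Real.norm_of_nonneg hs]
    exact (mul_le_mul_of_nonneg_left (norm_fderiv_periodize_le hsep hX hρ hb x) hs).trans hsb
  obtain ⟨Φ, hΦ, hΦs, hG⟩ := exists_homeomorph_id_add (hYs.const_smul s)
    fun x => (hZb x).trans hδ
  have hΦd : ∀ x, fderiv ℝ Φ x = 1 + s • fderiv ℝ Y x := fun x => by
    have h1 : (Φ : E d → E d) = fun x => x + s • Y x := funext hΦ
    rw [h1, ← hfd]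
    exact ((hasFDerivAt_id x).add (hYd.const_smul s x).hasFDerivAt).fderiv
  have hoff : ∀ y, (∀ l ∈ dualLattice γ, y + l ∉ B) → Φ y = y ∧ fderiv ℝ Φ y = 1 := by
    intro y hy
    constructor
    · rw [hΦ]
      change y + s • periodize γ X y = y
      rw [periodize_eq_zero hX hy, smul_zero, add_zero]
    · obtain ⟨l, hl⟩ := periodize_eq_translate hsep hX y
      have h1 : Y =ᶠ[𝓝 y] fun z => X (z + (l : E d)) := by
        filter_upwards [Metric.ball_mem_nhds y hρ] with z hz using hl z hz
      rw [hΦd, h1.fderiv_eq, fderiv_comp_add_right,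
        fderiv_eq_zero_of_notMem_closedBall hX (hy l l.2)]
      ext1 v
      simp
  have hper : ∀ l ∈ dualLattice γ, ∀ x, Φ (x + l) = Φ x + l := fun l hl x => by
    rw [hΦ, hΦ]
    change x + l + s • periodize γ X (x + l) = x + s • periodize γ X x + l
    rw [periodize_add X hl]
    abel
  -- If `Φ x` left the ball, there would be two cases. Outside all translates `Φ` is the identity,
  -- which contradicts injectivity. In another translate, the displacement bound `ρ` would give a
  -- nonzero lattice vector of norm at most `3ρ`.
  have hmaps : ∀ x ∈ B, Φ x ∈ B := by
    intro x hx
    by_contra hn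
    by_cases h : ∀ l ∈ dualLattice γ, Φ x + l ∉ B
    · have h1 := Φ.injective (hoff _ h).1
      rw [h1] at hn
      exact hn hx
    · push Not at h
      obtain ⟨l, hl, hxl⟩ := h
      have hl0 : l ≠ 0 := by
        rintro rfl
        rw [add_zero] at hxl
        exact hn hxl
      have h1 := hsep l hl hl0
      have h2 : ‖Φ x - x‖ ≤ ρ := by
        rw [hΦ, add_sub_cancel_left, norm_smul, Real.norm_of_nonneg hs]
        exact (mul_le_mul_of_nonneg_left (norm_periodize_le hsep hX hρ hb' x) hs).trans hsb'
      rw [hB, mem_closedBall_iff_norm] at hx hxl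
      have h3 := norm_sub_le (Φ x + l - k₀) ((Φ x - x) + (x - k₀))
      rw [show Φ x + l - k₀ - (Φ x - x + (x - k₀)) = l by abel] at h3
      have h4 := norm_add_le (Φ x - x) (x - k₀)
      linarith
  have hself : ∀ x ∈ B, x ∈ Metric.ball k₀ (2 * ρ) := fun x hx =>
    Metric.closedBall_subset_ball (by linarith) hx
  -- Otherwise one orbit would have two representatives in the cell.
  have hcompl : ∀ y ∈ halfOpenCell γ k₀ \ B, ∀ l ∈ dualLattice γ, y + l ∉ B := by
    rintro y ⟨hy, hyB⟩ l hl hyl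
    have h1 := (existsUnique_vadd_mem_halfOpenCell γ k₀ y).unique
      (y₁ := ⟨l, hl⟩) (y₂ := 0) (by
        change l + y ∈ _
        rw [add_comm]; exact hcell hyl) (by
        change (0 : E d) + y ∈ _
        rwa [zero_add])
    have h2 : l = 0 := congrArg Subtype.val h1
    rw [h2, add_zero] at hyl
    exact hyB hyl
  refine ⟨Φ, hΦs, hG, fun x => ?_, hper, ?_, fun x hx => ?_, fun x hx => ?_, fun y hy => ?_,
    fun y hy => ?_⟩
  · rw [hΦd, ← hfd]
    exact hdet _ (hZb x)
  · refine Set.Subset.antisymm (Set.image_subset_iff.2 hmaps) fun y hy => ?_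
    refine ⟨Φ.symm y, ?_, Φ.apply_symm_apply y⟩
    -- Surjectivity onto the ball: the preimage is either a fixed point or lies in some translate,
    -- and since `Φ` commutes with translations, separation forces the translation to be trivial.
    by_cases h : ∀ l ∈ dualLattice γ, Φ.symm y + l ∉ B
    · have h1 := (hoff _ h).1
      rw [Homeomorph.apply_symm_apply] at h1
      rwa [← h1]
    · push Not at h
      obtain ⟨l, hl, hxl⟩ := h
      have h1 := hmaps _ hxl
      rw [hper l hl, Homeomorph.apply_symm_apply] at h1
      have hl0 : l = 0 := by
        by_contra hne
        have h2 := hsep l hl hne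
        rw [hB, mem_closedBall_iff_norm] at h1 hy
        have h3 := norm_sub_le (y + l - k₀) (y - k₀)
        rw [show y + l - k₀ - (y - k₀) = l by abel] at h3
        linarith
      rwa [hl0, add_zero] at hxl
  · rw [hΦ]
    change x + s • periodize γ X x = _
    rw [periodize_eq_self hsep hX (hself x hx)]
  · have h1 : Y =ᶠ[𝓝 x] X := by
      filter_upwards [Metric.isOpen_ball.mem_nhds (hself x hx)] with z hz using
        periodize_eq_self hsep hX hz
    rw [hΦd, h1.fderiv_eq]
  · rw [Homeomorph.symm_apply_eq]
    exact (hoff y (hcompl y hy)).1.symm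
  · obtain ⟨h1, h2⟩ := hoff y (hcompl y hy)
    have h3 := fderiv_symm_apply hΦs hG y
    rw [h1, h2, Ring.inverse_one] at h3
    exact h3

/-! ### Pointwise estimates for matrices -/

/-- The sum of the absolute values of the entries of a matrix. -/
def entrySum {m : ℕ} (M : Matrix (Fin m) (Fin m) ℂ) : ℝ := ∑ a, ∑ b, ‖M a b‖

/-- The real inner product `Re tr(M* N)`. -/
def pairing {m : ℕ} (M N : Matrix (Fin m) (Fin m) ℂ) : ℝ := ((Mᴴ * N).trace).re

theorem pairing_eq {m : ℕ} (M N : Matrix (Fin m) (Fin m) ℂ) :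
    pairing M N = ∑ b, ∑ a, (star (M a b) * N a b).re := by
  simp [pairing, Matrix.trace, Matrix.mul_apply]

theorem pairing_self {m : ℕ} (M : Matrix (Fin m) (Fin m) ℂ) : pairing M M = matNormSq M := rfl

theorem matNormSq_eq {m : ℕ} (M : Matrix (Fin m) (Fin m) ℂ) :
    matNormSq M = ∑ b, ∑ a, ‖M a b‖ ^ 2 := by
  rw [← pairing_self, pairing_eq]
  refine Finset.sum_congr rfl fun b _ => Finset.sum_congr rfl fun a _ => ?_
  have : star (M a b) * M a b = ((‖M a b‖ ^ 2 : ℝ) : ℂ) := by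
    rw [mul_comm]
    simpa using Complex.mul_conj' (M a b)
  rw [this, Complex.ofReal_re]

theorem matNormSq_nonneg {m : ℕ} (M : Matrix (Fin m) (Fin m) ℂ) : 0 ≤ matNormSq M := by
  rw [matNormSq_eq]; positivity

theorem pairing_comm {m : ℕ} (M N : Matrix (Fin m) (Fin m) ℂ) : pairing M N = pairing N M := by
  simp only [pairing_eq]
  refine Finset.sum_congr rfl fun b _ => Finset.sum_congr rfl fun a _ => ?_
  simp only [Complex.star_def, Complex.mul_re, Complex.conj_re, Complex.conj_im]; ring

theorem pairing_sum_left {m : ℕ} {ι : Type*} (s : Finset ι) (c : ι → ℝ)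
    (M : ι → Matrix (Fin m) (Fin m) ℂ) (N : Matrix (Fin m) (Fin m) ℂ) :
    pairing (∑ i ∈ s, ((c i : ℝ) : ℂ) • M i) N = ∑ i ∈ s, c i * pairing (M i) N := by
  unfold pairing
  rw [Matrix.conjTranspose_sum, Finset.sum_mul, Matrix.trace_sum, Complex.re_sum]
  refine Finset.sum_congr rfl fun i _ => ?_
  rw [Matrix.conjTranspose_smul, Matrix.smul_mul, Matrix.trace_smul]
  simp

theorem pairing_sum_sum {m : ℕ} {ι : Type*} (s : Finset ι) (c : ι → ℝ)
    (M : ι → Matrix (Fin m) (Fin m) ℂ) :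
    matNormSq (∑ i ∈ s, ((c i : ℝ) : ℂ) • M i)
      = ∑ i ∈ s, ∑ l ∈ s, c i * c l * pairing (M i) (M l) := by
  rw [← pairing_self, pairing_sum_left]
  refine Finset.sum_congr rfl fun i _ => ?_
  rw [pairing_comm, pairing_sum_left, Finset.mul_sum]
  refine Finset.sum_congr rfl fun l _ => ?_
  rw [pairing_comm]; ring

theorem abs_pairing_le {m : ℕ} (M N : Matrix (Fin m) (Fin m) ℂ) :
    |pairing M N| ≤ (matNormSq M + matNormSq N) / 2 := by
  rw [pairing_eq, matNormSq_eq, matNormSq_eq, ← Finset.sum_add_distrib, Finset.sum_div]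
  refine (Finset.abs_sum_le_sum_abs _ _).trans (Finset.sum_le_sum fun b _ => ?_)
  rw [← Finset.sum_add_distrib, Finset.sum_div]
  refine (Finset.abs_sum_le_sum_abs _ _).trans (Finset.sum_le_sum fun a _ => ?_)
  refine (Complex.abs_re_le_norm _).trans ?_
  rw [norm_mul, norm_star]
  nlinarith [sq_nonneg (‖M a b‖ - ‖N a b‖)]

theorem norm_trace_commutator_le {m : ℕ} {u p M : Matrix (Fin m) (Fin m) ℂ} {μ : ℝ}
    (hu : ∀ a b, ‖u a b‖ ≤ 1) (hM : ∀ a b, ‖M a b‖ ≤ μ) :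
    ‖((u * pᴴ - p * uᴴ) * M).trace‖ ≤ 2 * m * μ * entrySum p := by
  have h1 : ∀ a c, ‖(u * pᴴ - p * uᴴ) a c * M c a‖ ≤ (∑ b, ‖p c b‖ + ∑ b, ‖p a b‖) * μ := by
    intro a c
    rw [norm_mul, Matrix.sub_apply, Matrix.mul_apply, Matrix.mul_apply]
    refine mul_le_mul ((norm_sub_le _ _).trans (add_le_add ?_ ?_)) (hM c a) (norm_nonneg _)
      (by positivity)
    · refine (norm_sum_le _ _).trans (Finset.sum_le_sum fun b _ => ?_)
      rw [norm_mul, Matrix.conjTranspose_apply, norm_star]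
      exact mul_le_of_le_one_left (norm_nonneg _) (hu _ _)
    · refine (norm_sum_le _ _).trans (Finset.sum_le_sum fun b _ => ?_)
      rw [norm_mul, Matrix.conjTranspose_apply, norm_star]
      exact mul_le_of_le_one_right (norm_nonneg _) (hu _ _)
  calc ‖((u * pᴴ - p * uᴴ) * M).trace‖
      = ‖∑ a, ∑ c, (u * pᴴ - p * uᴴ) a c * M c a‖ := by
        simp only [Matrix.trace, Matrix.diag_apply, Matrix.mul_apply (N := M)]
    _ ≤ ∑ a, ∑ c, (∑ b, ‖p c b‖ + ∑ b, ‖p a b‖) * μ := by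
        refine (norm_sum_le _ _).trans (Finset.sum_le_sum fun a _ => ?_)
        exact (norm_sum_le _ _).trans (Finset.sum_le_sum fun c _ => h1 a c)
    _ = 2 * m * μ * entrySum p := by
        simp only [← Finset.sum_mul, Finset.sum_add_distrib, Finset.sum_const, Finset.card_univ,
          Fintype.card_fin, entrySum, nsmul_eq_mul, ← Finset.mul_sum]
        ring

theorem norm_conjTranspose_mul_apply_le {m : ℕ} {u Q : Matrix (Fin m) (Fin m) ℂ}
    (hu : ∀ a b, ‖u a b‖ ≤ 1) (a : Fin m) : ‖(uᴴ * Q) a a‖ ≤ ∑ b, ‖Q b a‖ := by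
  rw [Matrix.mul_apply]
  refine (norm_sum_le _ _).trans (Finset.sum_le_sum fun b _ => ?_)
  rw [norm_mul, Matrix.conjTranspose_apply, norm_star]
  exact mul_le_of_le_one_left (norm_nonneg _) (hu _ _)

theorem sum_norm_le_entrySum {m : ℕ} (Q : Matrix (Fin m) (Fin m) ℂ) (a : Fin m) :
    ∑ b, ‖Q b a‖ ≤ entrySum Q :=
  Finset.sum_le_sum fun b _ =>
    Finset.single_le_sum (f := fun a => ‖Q b a‖) (fun _ _ => norm_nonneg _) (Finset.mem_univ a)

theorem entrySum_nonneg {m : ℕ} (M : Matrix (Fin m) (Fin m) ℂ) : 0 ≤ entrySum M := by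
  unfold entrySum; positivity

/-! ### The densities of the localization functional -/

section
variable {d m : ℕ} {γ : Module.Basis (Fin d) ℝ (E d)}

/-- The density of the Dirichlet energy. -/
def dirDensity (W : SobolevMap γ m) (j : Fin d) (k : E d) : ℂ :=
  ((W.grad j k)ᴴ * W.grad j k).trace

/-- The density of the term linear in the Berry connection. -/
def berryDensity (χ : Fin m → E d → Hf γ) (W : SobolevMap γ m) (j : Fin d) (k : E d) : ℂ :=
  ((W.toFun k * (W.grad j k)ᴴ - W.grad j k * (W.toFun k)ᴴ) * berry χ j k).trace

/-- The density of the center of the `a`-th Wannier function. -/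
def centerDensity (χ : Fin m → E d → Hf γ) (W : SobolevMap γ m) (a : Fin m) (j : Fin d)
    (k : E d) : ℂ :=
  ((W.toFun k)ᴴ * (W.grad j k + berry χ j k * W.toFun k)) a a

theorem MemL2Loc.star {f : E d → ℂ} (hf : MemL2Loc f) : MemL2Loc fun k => star (f k) :=
  fun K hK => (hf K hK).star

theorem MemL2Loc.integrableOn_mul {f g : E d → ℂ} (hf : MemL2Loc f) (hg : MemL2Loc g)
    {K : Set (E d)} (hK : IsCompact K) : IntegrableOn (fun k => f k * g k) K :=
  (hf K hK).integrable_mul (hg K hK)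

theorem MemL2Loc.add {f g : E d → ℂ} (hf : MemL2Loc f) (hg : MemL2Loc g) :
    MemL2Loc fun k => f k + g k := fun K hK => (hf K hK).add (hg K hK)

theorem SobolevMap.integrableOn_trace (W : SobolevMap γ m) (i l : Fin d) {K : Set (E d)}
    (hK : IsCompact K) : IntegrableOn (fun k => ((W.grad i k)ᴴ * W.grad l k).trace) K := by
  simp only [Matrix.trace, Matrix.diag_apply, Matrix.mul_apply, Matrix.conjTranspose_apply]
  exact integrable_finsetSum _ fun a _ => integrable_finsetSum _ fun b _ =>
    MemL2Loc.integrableOn_mul (MemL2Loc.star (W.memLp_grad i b a)) (W.memLp_grad l b a) hK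

theorem SobolevMap.integrableOn_dirDensity (W : SobolevMap γ m) (j : Fin d) {K : Set (E d)}
    (hK : IsCompact K) : IntegrableOn (dirDensity W j) K := W.integrableOn_trace j j hK

theorem SobolevMap.integrableOn_pairing (W : SobolevMap γ m) (i l : Fin d) {K : Set (E d)}
    (hK : IsCompact K) : IntegrableOn (fun k => pairing (W.grad i k) (W.grad l k)) K :=
  (W.integrableOn_trace i l hK).re

theorem SobolevMap.integrableOn_gradNormSq (W : SobolevMap γ m) {K : Set (E d)}
    (hK : IsCompact K) : IntegrableOn (gradNormSq W) K :=
  integrable_finsetSum _ fun j _ => W.integrableOn_pairing j j hK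

theorem SobolevMap.integrableOn_entrySum (W : SobolevMap γ m) {K : Set (E d)}
    (hK : IsCompact K) : IntegrableOn (fun k => ∑ i, entrySum (W.grad i k)) K := by
  refine integrable_finsetSum _ fun j _ => integrable_finsetSum _ fun a _ =>
    integrable_finsetSum _ fun b _ => ?_
  exact ((MemL2Loc.locallyIntegrable (W.memLp_grad j a b)).integrableOn_isCompact hK).norm

section
variable {χ : Fin m → E d → Hf γ} (hs : ∀ a, ContDiff ℝ ∞ (χ a))
include hs

theorem SobolevMap.integrableOn_berryDensity (W : SobolevMap γ m) (j : Fin d) {K : Set (E d)}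
    (hK : IsCompact K) : IntegrableOn (berryDensity χ W j) K := by
  unfold berryDensity
  simp only [Matrix.trace, Matrix.diag_apply, Matrix.mul_apply (N := berry χ j _)]
  refine integrable_finsetSum _ fun a _ => integrable_finsetSum _ fun c _ => ?_
  refine IntegrableOn.mul_continuousOn ?_ (contDiff_berry hs j c a).continuous.continuousOn hK
  simp only [Matrix.sub_apply, Matrix.mul_apply, Matrix.conjTranspose_apply]
  refine Integrable.sub ?_ ?_
  · exact integrable_finsetSum _ fun b _ =>
      MemL2Loc.integrableOn_mul (W.memLp a b) (MemL2Loc.star (W.memLp_grad j c b)) hK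
  · exact integrable_finsetSum _ fun b _ =>
      MemL2Loc.integrableOn_mul (W.memLp_grad j a b) (MemL2Loc.star (W.memLp c b)) hK

theorem SobolevMap.integrableOn_centerDensity (W : SobolevMap γ m) (a : Fin m) (j : Fin d)
    {K : Set (E d)} (hK : IsCompact K) : IntegrableOn (centerDensity χ W a j) K := by
  unfold centerDensity
  simp only [Matrix.mul_apply, Matrix.add_apply, Matrix.conjTranspose_apply]
  refine integrable_finsetSum _ fun b _ =>
    MemL2Loc.integrableOn_mul (MemL2Loc.star (W.memLp b a)) ?_ hK
  exact MemL2Loc.add (W.memLp_grad j b a) (MemL2Loc.sum _ fun c _ =>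
    MemL2Loc.continuous_mul (contDiff_berry hs j b c).continuous (W.memLp c a))

variable (hτ : ∀ a, MemHTau γ (χ a))
include hτ

theorem norm_frameDeriv_periodic {l : E d} (hl : l ∈ dualLattice γ) (j : Fin d) (a : Fin m)
    (k : E d) : ‖frameDeriv χ j a (k + l)‖ = ‖frameDeriv χ j a k‖ := by
  have h2 := frameDeriv_sub hτ hs hl j a (k + l)
  rw [add_sub_cancel_right] at h2
  rw [h2, norm_eq_sqrt_re_inner (𝕜 := ℂ), norm_eq_sqrt_re_inner (𝕜 := ℂ), inner_tau]

theorem torusIntegral_centerDensity_eq (c : ℝ) (k₀ : E d) (W : SobolevMap γ m) (a : Fin m)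
    (j : Fin d) : torusIntegral γ c (centerDensity χ W a j)
      = (c : ℂ) * ∫ k in halfOpenCell γ k₀, centerDensity χ W a j k := by
  rw [torusIntegral, setIntegral_dualCell_eq γ k₀]
  intro l hl
  filter_upwards [W.grad_periodic j hl, W.periodic l hl] with k hk hk'
  rw [centerDensity, centerDensity, hk, hk', berry_periodic hτ hs hl]

/-- The functional as an integral over a cell centered at `k₀`. -/
theorem localizationFunctional_eq (c : ℝ) (k₀ : E d) (W : SobolevMap γ m) :
    localizationFunctional c χ W =
      ((∑ j, (c : ℂ) * ((∫ k in halfOpenCell γ k₀, dirDensity W j k)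
          + ∫ k in halfOpenCell γ k₀, m * ∑ a, ((‖frameDeriv χ j a k‖ ^ 2 : ℝ) : ℂ)))
        + (∑ j, (c : ℂ) * ∫ k in halfOpenCell γ k₀, berryDensity χ W j k)
        + ∑ a, ∑ j, ((c : ℂ) * ∫ k in halfOpenCell γ k₀, centerDensity χ W a j k) ^ 2).re := by
  obtain ⟨K, hK, hsub⟩ := exists_isCompact_halfOpenCell_subset γ k₀
  have h1 : ∀ j, (torusIntegral γ c fun k =>
      ((W.grad j k)ᴴ * W.grad j k).trace + m * ∑ a, ((‖frameDeriv χ j a k‖ ^ 2 : ℝ) : ℂ))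
      = (c : ℂ) * ((∫ k in halfOpenCell γ k₀, dirDensity W j k)
          + ∫ k in halfOpenCell γ k₀, m * ∑ a, ((‖frameDeriv χ j a k‖ ^ 2 : ℝ) : ℂ)) := by
    intro j
    rw [torusIntegral, setIntegral_dualCell_eq γ k₀, integral_add]
    · rfl
    · exact (W.integrableOn_dirDensity j hK).mono_set hsub
    · refine IntegrableOn.mono_set (t := K) (ContinuousOn.integrableOn_compact hK ?_) hsub
      refine Continuous.continuousOn (continuous_const.mul (continuous_finsetSum _ fun a _ => ?_))
      exact Complex.continuous_ofReal.comp ((contDiff_frameDeriv hs j a).continuous.norm.pow 2)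
    · intro l hl
      filter_upwards [W.grad_periodic j hl] with k hk
      simp only [hk, norm_frameDeriv_periodic hs hτ hl]
  have h2 : ∀ j, (torusIntegral γ c fun k =>
      ((W.toFun k * (W.grad j k)ᴴ - W.grad j k * (W.toFun k)ᴴ) * berry χ j k).trace)
      = (c : ℂ) * ∫ k in halfOpenCell γ k₀, berryDensity χ W j k := by
    intro j
    rw [torusIntegral, setIntegral_dualCell_eq γ k₀]
    · rfl
    · intro l hl
      filter_upwards [W.grad_periodic j hl, W.periodic l hl] with k hk hk'
      rw [hk, hk', berry_periodic hτ hs hl]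
  have h3 : ∀ a j, (torusIntegral γ c fun k =>
      ((W.toFun k)ᴴ * (W.grad j k + berry χ j k * W.toFun k)) a a)
      = (c : ℂ) * ∫ k in halfOpenCell γ k₀, centerDensity χ W a j k := fun a j =>
    torusIntegral_centerDensity_eq hs hτ c k₀ W a j
  unfold localizationFunctional
  simp only [h1, h2, h3]

end
end

/-- Integrals over a cell before and after a deformation inside a ball. -/
theorem setIntegral_sub_setIntegral_eq {d : ℕ} {γ : Module.Basis (Fin d) ℝ (E d)} {k₀ : E d}
    {ρ : ℝ} (hcell : Metric.closedBall k₀ ρ ⊆ halfOpenCell γ k₀) {Φ : E d ≃ₜ E d}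
    (hΦ : ContDiff ℝ ∞ Φ) (hJ : ∀ x, 0 < (fderiv ℝ Φ x).det)
    (himg : Φ '' Metric.closedBall k₀ ρ = Metric.closedBall k₀ ρ) {f g : E d → ℂ}
    (hf : ∀ K, IsCompact K → IntegrableOn f K) (hg : ∀ K, IsCompact K → IntegrableOn g K)
    (hfg : ∀ y ∈ halfOpenCell γ k₀ \ Metric.closedBall k₀ ρ, f y = g y) :
    IntegrableOn (fun x => (((fderiv ℝ Φ x).det : ℝ) : ℂ) * f (Φ x) - g x)
        (Metric.closedBall k₀ ρ) ∧
      (∫ k in halfOpenCell γ k₀, f k) - ∫ k in halfOpenCell γ k₀, g k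
        = ∫ x in Metric.closedBall k₀ ρ, ((((fderiv ℝ Φ x).det : ℝ) : ℂ) * f (Φ x) - g x) := by
  obtain ⟨K, hK, hsub⟩ := exists_isCompact_halfOpenCell_subset γ k₀
  set B := Metric.closedBall k₀ ρ with hB
  have hBc : IsCompact B := isCompact_closedBall k₀ ρ
  have hder : ∀ x ∈ B, HasFDerivWithinAt Φ (fderiv ℝ Φ x) B x := fun x _ =>
    ((hΦ.differentiable (by simp)) x).hasFDerivAt.hasFDerivWithinAt
  have hsmul : ∀ x, |(fderiv ℝ Φ x).det| • f (Φ x) = (((fderiv ℝ Φ x).det : ℝ) : ℂ) * f (Φ x) :=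
    fun x => by simp [abs_of_pos (hJ x)]
  have hi : IntegrableOn (fun x => (((fderiv ℝ Φ x).det : ℝ) : ℂ) * f (Φ x)) B := by
    have h := (integrableOn_image_iff_integrableOn_abs_det_fderiv_smul volume hBc.measurableSet
      hder Φ.injective.injOn f).1 (by rw [himg]; exact hf B hBc)
    simpa only [hsmul] using h
  have hint : ∫ y in B, f y = ∫ x in B, (((fderiv ℝ Φ x).det : ℝ) : ℂ) * f (Φ x) := by
    have h := integral_image_eq_integral_abs_det_fderiv_smul volume hBc.measurableSet
      hder Φ.injective.injOn f
    rw [himg] at h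
    simpa only [hsmul] using h
  refine ⟨hi.sub (hg B hBc), ?_⟩
  have hsplit : ∀ h : E d → ℂ, (∀ K, IsCompact K → IntegrableOn h K) →
      ∫ k in halfOpenCell γ k₀, h k = (∫ k in halfOpenCell γ k₀ \ B, h k) + ∫ k in B, h k := by
    intro h hh
    rw [← setIntegral_union Set.disjoint_sdiff_left hBc.measurableSet
      (((hh K hK).mono_set hsub).mono_set Set.sdiff_subset) (hh B hBc),
      Set.sdiff_union_of_subset hcell]
  rw [hsplit f hf, hsplit g hg, integral_sub hi (hg B hBc), hint,
    setIntegral_congr_fun ((measurableSet_halfOpenCell γ k₀).diff hBc.measurableSet) hfg]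
  ring

/-! ### Transformation of the densities under a deformation -/

section
variable {d m : ℕ}

/-- The transformed partial derivatives `∑ᵢ [(1 + A)⁻¹]ᵢⱼ pᵢ`. -/
def transGrad (A : E d →L[ℝ] E d) (p : Fin d → Matrix (Fin m) (Fin m) ℂ) (j : Fin d) :
    Matrix (Fin m) (Fin m) ℂ :=
  ∑ i, ((entry i j (invOneAdd A) : ℝ) : ℂ) • p i

theorem sum_det_mul_matNormSq_transGrad (A : E d →L[ℝ] E d)
    (p : Fin d → Matrix (Fin m) (Fin m) ℂ) :
    ∑ j, (1 + A).det * matNormSq (transGrad A p j)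
      = ∑ i, ∑ l, dirichletCoeff i l A * pairing (p i) (p l) := by
  simp only [transGrad, pairing_sum_sum, dirichletCoeff, Finset.mul_sum, Finset.sum_mul]
  rw [Finset.sum_comm]
  refine Finset.sum_congr rfl fun i _ => ?_
  rw [Finset.sum_comm]
  exact Finset.sum_congr rfl fun l _ => Finset.sum_congr rfl fun j _ => by ring

theorem sum_matNormSq_eq (p : Fin d → Matrix (Fin m) (Fin m) ℂ) :
    ∑ j, matNormSq (p j) = ∑ i, ∑ l, (if i = l then (1 : ℝ) else 0) * pairing (p i) (p l) := by
  simp [pairing_self]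

/-- The coefficient error multiplies `d²` pairings, each bounded by the full gradient energy through
`abs_pairing_le`. -/
theorem dirichlet_expansion_le {A : E d →L[ℝ] E d} {ε : ℝ}
    (hA : ∀ i l, |dirichletCoeff i l A - (if i = l then 1 else 0)
        - ((if i = l then 1 else 0) * traceCLM A - entry i l A - entry l i A)| ≤ ε)
    (p : Fin d → Matrix (Fin m) (Fin m) ℂ) :
    ∑ j, ((1 + A).det * matNormSq (transGrad A p j) - matNormSq (p j))
      ≤ (∑ i, ∑ l, ((if i = l then 1 else 0) * traceCLM A - entry i l A - entry l i A)
          * pairing (p i) (p l)) + ε * (d ^ 2 * ∑ j, matNormSq (p j)) := by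
  rw [Finset.sum_sub_distrib, sum_det_mul_matNormSq_transGrad, sum_matNormSq_eq]
  have hp : ∀ i l, |pairing (p i) (p l)| ≤ ∑ j, matNormSq (p j) := by
    intro i l
    have h0 := fun i => Finset.single_le_sum (f := fun j => matNormSq (p j))
      (fun _ _ => matNormSq_nonneg _) (Finset.mem_univ i)
    have := abs_pairing_le (p i) (p l)
    linarith [h0 i, h0 l]
  rw [← sum_matNormSq_eq]
  have h1 : ε * (d ^ 2 * ∑ j, matNormSq (p j))
      = ∑ _i : Fin d, ∑ _l : Fin d, ε * ∑ j, matNormSq (p j) := by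
    simp; ring
  rw [h1, sum_matNormSq_eq, ← Finset.sum_sub_distrib, ← Finset.sum_add_distrib,
    ← sum_matNormSq_eq]
  refine Finset.sum_le_sum fun i _ => ?_
  rw [← Finset.sum_sub_distrib, ← Finset.sum_add_distrib]
  refine Finset.sum_le_sum fun l _ => ?_
  have h2 := mul_le_mul (hA i l) (hp i l) (abs_nonneg _) ((abs_nonneg _).trans (hA i l))
  rw [← abs_mul] at h2
  have h3 := (le_abs_self _).trans h2
  linarith

variable {u : Matrix (Fin m) (Fin m) ℂ} (hu : ∀ a b, ‖u a b‖ ≤ 1)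
  {A : E d →L[ℝ] E d} {η M ν : ℝ}
  (hdet : |(1 + A).det - 1| ≤ η)
  (hfirst : ∀ i j, |firstCoeff i j A - (if i = j then 1 else 0)| ≤ η)
  {b₁ b₀ : Fin d → Matrix (Fin m) (Fin m) ℂ} (hb : ∀ j a b, ‖b₁ j a b‖ ≤ M)
  (hbb : ∀ j a b, ‖b₁ j a b - b₀ j a b‖ ≤ ν)

-- Regrouping by untransformed derivatives shifts the coefficients onto the connection: the
-- difference is the original expression with `b₀ i` replaced by `Q i`. This matrix is small because
-- `firstCoeff` is near the identity and `b₁` is near `b₀`.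
include hu hfirst hb hbb in
theorem norm_berry_transform_le (p : Fin d → Matrix (Fin m) (Fin m) ℂ) :
    ‖∑ j, ((((1 + A).det : ℝ) : ℂ)
          * ((u * (transGrad A p j)ᴴ - transGrad A p j * uᴴ) * b₁ j).trace
        - ((u * (p j)ᴴ - p j * uᴴ) * b₀ j).trace)‖
      ≤ 2 * m * (d * (η * M) + ν) * ∑ i, entrySum (p i) := by
  let Q : Fin d → Matrix (Fin m) (Fin m) ℂ := fun i =>
    (∑ j, ((firstCoeff i j A : ℝ) : ℂ) • b₁ j) - b₀ i
  have h1 : ∀ j, (((1 + A).det : ℝ) : ℂ)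
          * ((u * (transGrad A p j)ᴴ - transGrad A p j * uᴴ) * b₁ j).trace
      = ∑ i, ((firstCoeff i j A : ℝ) : ℂ) * ((u * (p i)ᴴ - p i * uᴴ) * b₁ j).trace := by
    intro j
    have : u * (transGrad A p j)ᴴ - transGrad A p j * uᴴ
        = ∑ i, ((entry i j (invOneAdd A) : ℝ) : ℂ) • (u * (p i)ᴴ - p i * uᴴ) := by
      simp only [transGrad, Matrix.conjTranspose_sum, Matrix.conjTranspose_smul, Matrix.mul_sum,
        Matrix.sum_mul, smul_sub, Finset.sum_sub_distrib, Matrix.mul_smul, Matrix.smul_mul,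
        Complex.star_def, Complex.conj_ofReal]
    rw [this, Finset.sum_mul, Matrix.trace_sum, Finset.mul_sum]
    refine Finset.sum_congr rfl fun i _ => ?_
    rw [Matrix.smul_mul, Matrix.trace_smul, firstCoeff, smul_eq_mul]
    push_cast; ring
  have h2 : ∑ j, ((((1 + A).det : ℝ) : ℂ)
          * ((u * (transGrad A p j)ᴴ - transGrad A p j * uᴴ) * b₁ j).trace
        - ((u * (p j)ᴴ - p j * uᴴ) * b₀ j).trace)
      = ∑ i, ((u * (p i)ᴴ - p i * uᴴ) * Q i).trace := by
    rw [Finset.sum_sub_distrib]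
    simp only [h1, Q, Matrix.mul_sub, Matrix.trace_sub, Finset.sum_sub_distrib, Matrix.mul_sum,
      Matrix.trace_sum, Matrix.mul_smul, Matrix.trace_smul, smul_eq_mul]
    rw [Finset.sum_comm]
  have hQ : ∀ i a b, ‖Q i a b‖ ≤ d * (η * M) + ν := by
    intro i a b
    have e : Q i a b = (∑ j, ((firstCoeff i j A - (if i = j then 1 else 0) : ℝ) : ℂ) * b₁ j a b)
        + (b₁ i a b - b₀ i a b) := by
      have hsum : ∑ j, (((if i = j then 1 else 0 : ℝ)) : ℂ) * b₁ j a b = b₁ i a b := by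
        rw [Finset.sum_eq_single i (fun j _ hj => by simp [hj.symm]) (by simp)]
        simp
      simp only [Q, Matrix.sub_apply, Matrix.sum_apply, Matrix.smul_apply, smul_eq_mul,
        Complex.ofReal_sub, sub_mul, Finset.sum_sub_distrib, hsum]
      ring
    rw [e]
    refine (norm_add_le _ _).trans (add_le_add ?_ (hbb i a b))
    refine (norm_sum_le _ _).trans ?_
    calc _ ≤ ∑ _j : Fin d, η * M := Finset.sum_le_sum fun j _ => by
          rw [norm_mul, Complex.norm_real]
          exact mul_le_mul (hfirst i j) (hb j a b) (norm_nonneg _)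
            ((abs_nonneg _).trans (hfirst i j))
      _ = _ := by simp
  rw [h2, Finset.mul_sum]
  refine (norm_sum_le _ _).trans (Finset.sum_le_sum fun i _ => ?_)
  exact norm_trace_commutator_le hu (hQ i)

-- The gradient part again carries `firstCoeff`, but the zeroth-order part `b₁ j * u` carries the
-- bare determinant; hence both closeness hypotheses enter.
include hu hdet hfirst hb hbb in
theorem norm_center_transform_le (p : Fin d → Matrix (Fin m) (Fin m) ℂ) (a : Fin m) (j : Fin d) :
    ‖(((1 + A).det : ℝ) : ℂ) * (uᴴ * (transGrad A p j + b₁ j * u)) a a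
        - (uᴴ * (p j + b₀ j * u)) a a‖
      ≤ η * (∑ i, entrySum (p i)) + m ^ 2 * (η * M + ν) := by
  let Q : Matrix (Fin m) (Fin m) ℂ :=
    (∑ i, ((firstCoeff i j A - (if i = j then 1 else 0) : ℝ) : ℂ) • p i)
      + ((((1 + A).det : ℝ) : ℂ) • b₁ j - b₀ j) * u
  have e : (((1 + A).det : ℝ) : ℂ) * (uᴴ * (transGrad A p j + b₁ j * u)) a a
        - (uᴴ * (p j + b₀ j * u)) a a = (uᴴ * Q) a a := by
    have h1 : Q = (((1 + A).det : ℝ) : ℂ) • (transGrad A p j + b₁ j * u) - (p j + b₀ j * u) := by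
      simp only [Q, transGrad, smul_add, Finset.smul_sum, smul_smul, Complex.ofReal_sub, sub_smul,
        Finset.sum_sub_distrib, firstCoeff, Complex.ofReal_mul, Matrix.sub_mul, Matrix.smul_mul]
      simp
      abel
    rw [h1, Matrix.mul_sub, Matrix.mul_smul, Matrix.sub_apply, Matrix.smul_apply, smul_eq_mul]
  rw [e]
  refine (norm_conjTranspose_mul_apply_le hu a).trans ?_
  have hη : 0 ≤ η := (abs_nonneg _).trans hdet
  have hQ : ∀ b, ‖Q b a‖ ≤ η * (∑ i, ‖p i b a‖) + m * (η * M + ν) := by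
    intro b
    simp only [Q, Matrix.add_apply, Matrix.sum_apply, Matrix.smul_apply, smul_eq_mul]
    refine (norm_add_le _ _).trans (add_le_add ?_ ?_)
    · rw [Finset.mul_sum]
      refine (norm_sum_le _ _).trans (Finset.sum_le_sum fun i _ => ?_)
      rw [norm_mul, Complex.norm_real]
      exact mul_le_mul_of_nonneg_right (hfirst i j) (norm_nonneg _)
    · rw [Matrix.mul_apply]
      refine (norm_sum_le _ _).trans ?_
      calc _ ≤ ∑ _c : Fin m, (η * M + ν) := Finset.sum_le_sum fun c _ => by
            rw [norm_mul]
            refine (mul_le_of_le_one_right (norm_nonneg _) (hu c a)).trans ?_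
            rw [Matrix.sub_apply, Matrix.smul_apply, smul_eq_mul]
            have : (((1 + A).det : ℝ) : ℂ) * b₁ j b c - b₀ j b c
                = (((1 + A).det - 1 : ℝ) : ℂ) * b₁ j b c + (b₁ j b c - b₀ j b c) := by
              push_cast; ring
            rw [this]
            refine (norm_add_le _ _).trans (add_le_add ?_ (hbb j b c))
            rw [norm_mul, Complex.norm_real]
            exact mul_le_mul hdet (hb j b c) (norm_nonneg _) hη
        _ = _ := by simp; ring
  calc _ ≤ ∑ b, (η * (∑ i, ‖p i b a‖) + m * (η * M + ν)) := Finset.sum_le_sum fun b _ => hQ b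
    _ = η * (∑ i, ∑ b, ‖p i b a‖) + m ^ 2 * (η * M + ν) := by
        rw [Finset.sum_add_distrib, ← Finset.mul_sum, Finset.sum_comm]
        simp; ring
    _ ≤ _ := by
        refine add_le_add (mul_le_mul_of_nonneg_left ?_ hη) le_rfl
        exact Finset.sum_le_sum fun i _ => sum_norm_le_entrySum (p i) a

end

/-! ### The first variation with respect to deformations of the domain -/

/-- The energy-momentum density `|p|² div X - 2 ∑ ∂ₗXᵢ ⟨pᵢ, pₗ⟩`, where `A` is the derivative of
the vector field. -/
def stress {d m : ℕ} (A : E d →L[ℝ] E d) (p : Fin d → Matrix (Fin m) (Fin m) ℂ) : ℝ :=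
  ∑ i, ∑ l, ((if i = l then 1 else 0) * traceCLM A - entry i l A - entry l i A)
    * pairing (p i) (p l)

theorem stress_smul {d m : ℕ} (s : ℝ) (A : E d →L[ℝ] E d)
    (p : Fin d → Matrix (Fin m) (Fin m) ℂ) : stress (s • A) p = s * stress A p := by
  simp only [stress, map_smul, smul_eq_mul, Finset.mul_sum]
  exact Finset.sum_congr rfl fun i _ => Finset.sum_congr rfl fun l _ => by ring

section
variable {d m : ℕ} {γ : Module.Basis (Fin d) ℝ (E d)} (U : SobolevMap γ m) {X : E d → E d}
  (hX : ContDiff ℝ ∞ X) {K : Set (E d)} (hK : IsCompact K)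
include hX hK

theorem integrableOn_stress :
    IntegrableOn (fun x => stress (fderiv ℝ X x) fun i => U.grad i x) K := by
  have hc : Continuous (fderiv ℝ X) := hX.continuous_fderiv (by simp)
  refine integrable_finsetSum _ fun i _ => integrable_finsetSum _ fun l _ => ?_
  refine IntegrableOn.continuousOn_mul ?_ (U.integrableOn_pairing i l hK) hK
  exact (((continuous_const.mul (traceCLM.continuous.comp hc)).sub
    ((entry i l).continuous.comp hc)).sub ((entry l i).continuous.comp hc)).continuousOn

theorem integrableOn_entrySum_mul : IntegrableOn (fun x =>
    ((∑ i, entrySum (U.grad i x)) + 1) * (‖fderiv ℝ X x‖ + ‖X x‖)) K := by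
  have hc : Continuous (fderiv ℝ X) := hX.continuous_fderiv (by simp)
  refine IntegrableOn.mul_continuousOn ?_ (hc.norm.add hX.continuous.norm).continuousOn hK
  exact (U.integrableOn_entrySum hK).add (continuous_const.continuousOn.integrableOn_compact hK)

end

theorem norm_setIntegral_le_setIntegral {d : ℕ} {B : Set (E d)} {f : E d → ℂ} {g : E d → ℝ}
    (hg : IntegrableOn g B) (h : ∀ᵐ x ∂volume.restrict B, ‖f x‖ ≤ g x) :
    ‖∫ x in B, f x‖ ≤ ∫ x in B, g x :=
  norm_integral_le_of_norm_le hg h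

/-- Comparison of a minimizer with its deformation along a vector field. -/
theorem deformation_inequality {d m : ℕ} {γ : Module.Basis (Fin d) ℝ (E d)}
    {χ : Fin m → E d → Hf γ} (hτ : ∀ a, MemHTau γ (χ a)) (hs : ∀ a, ContDiff ℝ ∞ (χ a))
    {c : ℝ} (hc : 0 < c) {U : SobolevMap γ m} (hU : IsMinimizer c χ U)
    {C δ M L : ℝ} (hC : 0 < C) (hδ : δ ≤ 1 / 2) (hM : 0 < M) (hL : 0 < L)
    (hcoeff : ∀ A : E d →L[ℝ] E d, ‖A‖ ≤ δ → 0 < (1 + A).det ∧ |(1 + A).det - 1| ≤ C * ‖A‖ ∧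
      ∀ i j, |firstCoeff i j A - (if i = j then 1 else 0)| ≤ C * ‖A‖)
    (hbM : ∀ j k a b, ‖berry χ j k a b‖ ≤ M)
    (hbL : ∀ j x y a b, ‖berry χ j x a b - berry χ j y a b‖ ≤ L * ‖x - y‖)
    {ρ : ℝ} (hρ : 0 < ρ) (hsep : ∀ l ∈ dualLattice γ, l ≠ 0 → 4 * ρ < ‖l‖) {k₀ : E d}
    (hcell : Metric.closedBall k₀ ρ ⊆ halfOpenCell γ k₀) {X : E d → E d} (hXs : ContDiff ℝ ∞ X)
    (hX : ∀ x ∉ Metric.closedBall k₀ ρ, X x = 0) {s b b' ε : ℝ} (hs0 : 0 < s)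
    (hb : ∀ x, ‖fderiv ℝ X x‖ ≤ b) (hb' : ∀ x, ‖X x‖ ≤ b')
    (hsb : s * b ≤ δ) (hsb' : s * b' ≤ ρ) (hε : 0 < ε)
    (hexp : ∀ A : E d →L[ℝ] E d, ‖A‖ ≤ s * b → ∀ i l,
      |dirichletCoeff i l A - (if i = l then 1 else 0)
        - ((if i = l then 1 else 0) * traceCLM A - entry i l A - entry l i A)| ≤ ε * ‖A‖)
    {κ S : ℝ} (hκ : κ = 2 * m * (d * (C * M) + L) + (C + m ^ 2 * (C * M + L)))
    (hS : S = ∫ x in Metric.closedBall k₀ ρ,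
      ((∑ i, entrySum (U.grad i x)) + 1) * (‖fderiv ℝ X x‖ + ‖X x‖)) :
    0 ≤ (∫ x in Metric.closedBall k₀ ρ, stress (fderiv ℝ X x) fun i => U.grad i x)
      + ε * (b * (d ^ 2 * ∫ x in Metric.closedBall k₀ ρ, gradNormSq U x)) + κ * S
      + ∑ a, ∑ j, κ * S * (2 * ‖torusIntegral γ c (centerDensity χ U a j)‖ + s * (c * (κ * S))) := by
  set B := Metric.closedBall k₀ ρ with hB
  have hBc : IsCompact B := isCompact_closedBall k₀ ρ
  obtain ⟨Φ, hΦ, hG, hJ, hper, himg, hΦB, hdB, hoff, hoffd⟩ := exists_deformation hρ hsep hcell hX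
    hXs hs0.le hb hb' hδ hsb hsb' fun A hA => (hcoeff A hA).1
  -- The competitor. It agrees with `U` in the cell outside the ball, so only integrals over the
  -- ball have to be compared.
  let V : SobolevMap γ m := U.compSymm Φ hΦ hG hJ hper
  have hVoff : ∀ y ∈ halfOpenCell γ k₀ \ B, V.toFun y = U.toFun y ∧ ∀ j, V.grad j y = U.grad j y := by
    intro y hy
    refine ⟨?_, fun j => ?_⟩
    · change U.toFun (Φ.symm y) = _
      rw [hoff y hy]
    · change ∑ i, ((fderiv ℝ Φ.symm y (unitVec j) i : ℝ) : ℂ) • U.grad i (Φ.symm y) = _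
      rw [hoff y hy, hoffd y hy]
      simp [unitVec]
  let A : E d → (E d →L[ℝ] E d) := fun x => s • fderiv ℝ X x
  have hAb : ∀ x, ‖A x‖ ≤ s * b := fun x => by
    simp only [A]
    rw [norm_smul, Real.norm_of_nonneg hs0.le]
    exact mul_le_mul_of_nonneg_left (hb x) hs0.le
  have hAn : ∀ x, ‖A x‖ = s * ‖fderiv ℝ X x‖ := fun x => by
    simp only [A]
    rw [norm_smul, Real.norm_of_nonneg hs0.le]
  have hdet : ∀ x ∈ B, (fderiv ℝ Φ x).det = (1 + A x).det := fun x hx => by rw [hdB x hx]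
  have hVΦ : ∀ x ∈ B, V.toFun (Φ x) = U.toFun x ∧
      ∀ j, V.grad j (Φ x) = transGrad (A x) (fun i => U.grad i x) j := by
    intro x hx
    refine ⟨?_, fun j => ?_⟩
    · change U.toFun (Φ.symm (Φ x)) = _
      rw [Homeomorph.symm_apply_apply]
    · change ∑ i, ((fderiv ℝ Φ.symm (Φ x) (unitVec j) i : ℝ) : ℂ) • U.grad i (Φ.symm (Φ x)) = _
      rw [Homeomorph.symm_apply_apply, fderiv_symm_apply hΦ hG, hdB x hx]
      rfl
  have hunit : ∀ᵐ x ∂volume.restrict B, x ∈ B ∧ ∀ a b, ‖U.toFun x a b‖ ≤ 1 := by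
    filter_upwards [ae_restrict_mem hBc.measurableSet, ae_restrict_of_ae U.unitary] with x hx hu
    exact ⟨hx, entry_norm_bound_of_unitary hu⟩
  have hdir := fun j => setIntegral_sub_setIntegral_eq hcell hΦ hJ himg
    (f := dirDensity V j) (g := dirDensity U j) (fun _ h => V.integrableOn_dirDensity j h)
    (fun _ h => U.integrableOn_dirDensity j h)
    (fun y hy => by rw [dirDensity, dirDensity, (hVoff y hy).2])
  have hber := fun j => setIntegral_sub_setIntegral_eq hcell hΦ hJ himg
    (f := berryDensity χ V j) (g := berryDensity χ U j)
    (fun _ h => V.integrableOn_berryDensity hs j h) (fun _ h => U.integrableOn_berryDensity hs j h)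
    (fun y hy => by rw [berryDensity, berryDensity, (hVoff y hy).2, (hVoff y hy).1])
  have hcen := fun a j => setIntegral_sub_setIntegral_eq hcell hΦ hJ himg
    (f := centerDensity χ V a j) (g := centerDensity χ U a j)
    (fun _ h => V.integrableOn_centerDensity hs a j h)
    (fun _ h => U.integrableOn_centerDensity hs a j h)
    (fun y hy => by rw [centerDensity, centerDensity, (hVoff y hy).2, (hVoff y hy).1])
  have hSint := integrableOn_entrySum_mul U hXs hBc
  have hQint := integrableOn_stress U hXs hBc
  have hGint := U.integrableOn_gradNormSq hBc
  have hP0 : ∀ x, 0 ≤ ∑ i, entrySum (U.grad i x) :=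
    fun x => Finset.sum_nonneg fun _ _ => entrySum_nonneg _
  have hS0 : 0 ≤ S := by
    rw [hS]
    exact integral_nonneg fun x => mul_nonneg (by linarith [hP0 x]) (by positivity)
  have hκ1 : 2 * m * (d * (C * M) + L) ≤ κ := by
    rw [hκ]
    have : 0 ≤ C + (m : ℝ) ^ 2 * (C * M + L) := by positivity
    linarith
  have hκ2 : C + m ^ 2 * (C * M + L) ≤ κ := by
    rw [hκ]
    have : 0 ≤ 2 * (m : ℝ) * (d * (C * M) + L) := by positivity
    linarith
  have hκ0 : 0 ≤ κ := le_trans (by positivity) hκ1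
  have hblip : ∀ x ∈ B, ∀ j a b, ‖berry χ j (Φ x) a b - berry χ j x a b‖ ≤ s * (L * ‖X x‖) := by
    intro x hx j a b
    refine (hbL j _ _ a b).trans (le_of_eq ?_)
    rw [hΦB x hx, add_sub_cancel_left, norm_smul, Real.norm_of_nonneg hs0.le]; ring
  -- Dirichlet part: the linear term is kept exactly, with remainder `ε` times `s`.
  have d1 : (∑ j, ((∫ k in halfOpenCell γ k₀, dirDensity V j k)
      - ∫ k in halfOpenCell γ k₀, dirDensity U j k)).re
      ≤ s * ((∫ x in B, stress (fderiv ℝ X x) fun i => U.grad i x)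
        + ε * (b * (d ^ 2 * ∫ x in B, gradNormSq U x))) := by
    rw [Finset.sum_congr rfl fun j _ => (hdir j).2, ← integral_finsetSum _ fun j _ => (hdir j).1]
    have hint := integrable_finsetSum (μ := volume.restrict B) Finset.univ fun j _ => (hdir j).1
    have hre := Complex.reCLM.integral_comp_comm hint
    rw [← Complex.reCLM_apply, ← hre]
    have : s * ((∫ x in B, stress (fderiv ℝ X x) fun i => U.grad i x)
        + ε * (b * (d ^ 2 * ∫ x in B, gradNormSq U x)))
        = ∫ x in B, (s * (stress (fderiv ℝ X x) fun i => U.grad i x)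
          + (s * (ε * (b * d ^ 2))) * gradNormSq U x) := by
      rw [integral_add (hQint.const_mul s) (hGint.const_mul _), integral_const_mul,
        integral_const_mul]
      ring
    rw [this]
    refine setIntegral_mono_on (Complex.reCLM.integrable_comp hint)
      ((hQint.const_mul s).add (hGint.const_mul _)) hBc.measurableSet fun x hx => ?_
    have h1 := dirichlet_expansion_le (A := A x) (ε := ε * (s * b))
      (fun i l => (hexp (A x) (hAb x) i l).trans (mul_le_mul_of_nonneg_left (hAb x) hε.le))
      (fun i => U.grad i x)
    rw [Complex.reCLM_apply, Complex.re_sum]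
    have h2 : ∀ j, ((((fderiv ℝ Φ x).det : ℝ) : ℂ) * dirDensity V j (Φ x) - dirDensity U j x).re
        = (1 + A x).det * matNormSq (transGrad (A x) (fun i => U.grad i x) j)
          - matNormSq (U.grad j x) := by
      intro j
      rw [Complex.sub_re, Complex.re_ofReal_mul, dirDensity, dirDensity, (hVΦ x hx).2, hdet x hx]
      rfl
    rw [Finset.sum_congr rfl fun j _ => h2 j]
    refine h1.trans (le_of_eq ?_)
    have h3 := stress_smul s (fderiv ℝ X x) fun i => U.grad i x
    rw [← h3]
    simp only [stress, A, gradNormSq]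
    ring
  -- The Berry part changes by `O(s)`. The weight is enlarged from `P` to `P + 1`, so that the same
  -- integral `S` also controls the centers, where a zeroth-order term occurs.
  have d2 : ‖∑ j, ((∫ k in halfOpenCell γ k₀, berryDensity χ V j k)
      - ∫ k in halfOpenCell γ k₀, berryDensity χ U j k)‖ ≤ s * (κ * S) := by
    rw [Finset.sum_congr rfl fun j _ => (hber j).2, ← integral_finsetSum _ fun j _ => (hber j).1,
      hS, ← mul_assoc, ← integral_const_mul]
    refine norm_setIntegral_le_setIntegral (hSint.const_mul _) ?_
    filter_upwards [hunit] with x hx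
    obtain ⟨hx, hu⟩ := hx
    have h1 := norm_berry_transform_le hu ((hcoeff (A x) ((hAb x).trans hsb)).2.2)
      (fun j => hbM j (Φ x)) (hblip x hx) (fun i => U.grad i x)
    have h2 : ∀ j, (((fderiv ℝ Φ x).det : ℝ) : ℂ) * berryDensity χ V j (Φ x) - berryDensity χ U j x
        = (((1 + A x).det : ℝ) : ℂ)
          * ((U.toFun x * (transGrad (A x) (fun i => U.grad i x) j)ᴴ
            - transGrad (A x) (fun i => U.grad i x) j * (U.toFun x)ᴴ) * berry χ j (Φ x)).trace
        - ((U.toFun x * (U.grad j x)ᴴ - U.grad j x * (U.toFun x)ᴴ) * berry χ j x).trace := by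
      intro j
      rw [berryDensity, berryDensity, (hVΦ x hx).2, (hVΦ x hx).1, hdet x hx]
    rw [Finset.sum_congr rfl fun j _ => h2 j]
    refine h1.trans ?_
    rw [hAn]
    set P := ∑ i, entrySum (U.grad i x) with hP
    have hP' := hP0 x
    have hn1 := norm_nonneg (fderiv ℝ X x)
    have hn2 := norm_nonneg (X x)
    calc 2 * m * (d * (C * (s * ‖fderiv ℝ X x‖) * M) + s * (L * ‖X x‖)) * P
        ≤ 2 * m * ((d * (C * M) + L) * (s * (‖fderiv ℝ X x‖ + ‖X x‖))) * (P + 1) := by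
          have : d * (C * (s * ‖fderiv ℝ X x‖) * M) + s * (L * ‖X x‖)
              ≤ (d * (C * M) + L) * (s * (‖fderiv ℝ X x‖ + ‖X x‖)) := by
            have e1 : 0 ≤ (d : ℝ) * (C * M) * (s * ‖X x‖) := by positivity
            have e2 : 0 ≤ L * (s * ‖fderiv ℝ X x‖) := by positivity
            linarith
          refine mul_le_mul (mul_le_mul_of_nonneg_left this (by positivity)) (by linarith) hP'
            (by positivity)
      _ = s * (2 * m * (d * (C * M) + L)) * ((P + 1) * (‖fderiv ℝ X x‖ + ‖X x‖)) := by ring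
      _ ≤ s * κ * ((P + 1) * (‖fderiv ℝ X x‖ + ‖X x‖)) := by
          refine mul_le_mul_of_nonneg_right (mul_le_mul_of_nonneg_left hκ1 hs0.le) ?_
          exact mul_nonneg (by linarith) (by positivity)
  have d3 : ∀ a j, ‖(∫ k in halfOpenCell γ k₀, centerDensity χ V a j k)
      - ∫ k in halfOpenCell γ k₀, centerDensity χ U a j k‖ ≤ s * (κ * S) := by
    intro a j
    rw [(hcen a j).2, hS, ← mul_assoc, ← integral_const_mul]
    refine norm_setIntegral_le_setIntegral (hSint.const_mul _) ?_
    filter_upwards [hunit] with x hx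
    obtain ⟨hx, hu⟩ := hx
    have hA := hcoeff (A x) ((hAb x).trans hsb)
    have h1 := norm_center_transform_le hu hA.2.1 hA.2.2
      (fun j => hbM j (Φ x)) (hblip x hx) (fun i => U.grad i x) a j
    rw [centerDensity, centerDensity, (hVΦ x hx).2, (hVΦ x hx).1, hdet x hx]
    refine h1.trans ?_
    rw [hAn]
    set P := ∑ i, entrySum (U.grad i x) with hP
    have hP' := hP0 x
    have hn1 := norm_nonneg (fderiv ℝ X x)
    have hn2 := norm_nonneg (X x)
    calc C * (s * ‖fderiv ℝ X x‖) * P + m ^ 2 * (C * (s * ‖fderiv ℝ X x‖) * M + s * (L * ‖X x‖))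
        ≤ s * (C + m ^ 2 * (C * M + L)) * ((P + 1) * (‖fderiv ℝ X x‖ + ‖X x‖)) := by
          have e1 : 0 ≤ s * (C * (P * ‖X x‖)) := by positivity
          have e2 : 0 ≤ s * (C * (‖fderiv ℝ X x‖ + ‖X x‖)) := by positivity
          have e3 : 0 ≤ s * ((m : ℝ) ^ 2 * ((C * M + L) * (P * (‖fderiv ℝ X x‖ + ‖X x‖)))) := by
            positivity
          have e4 : 0 ≤ s * ((m : ℝ) ^ 2 * (C * M * ‖X x‖ + L * ‖fderiv ℝ X x‖)) := by positivity
          nlinarith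
      _ ≤ s * κ * ((P + 1) * (‖fderiv ℝ X x‖ + ‖X x‖)) := by
          refine mul_le_mul_of_nonneg_right (mul_le_mul_of_nonneg_left hκ2 hs0.le) ?_
          exact mul_nonneg (by linarith) (by positivity)
  -- Over the cell centered at `k₀`, the frame term is common to both functionals and cancels.
  have hmin := hU V
  rw [localizationFunctional_eq hs hτ c k₀, localizationFunctional_eq hs hτ c k₀, ← sub_nonneg,
    ← Complex.sub_re] at hmin
  let z : SobolevMap γ m → Fin m → Fin d → ℂ := fun W a j =>
    (c : ℂ) * ∫ k in halfOpenCell γ k₀, centerDensity χ W a j k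
  have hz : ∀ a j, z U a j = torusIntegral γ c (centerDensity χ U a j) := fun a j =>
    (torusIntegral_centerDensity_eq hs hτ c k₀ U a j).symm
  have key : 0 ≤ c * (∑ j, ((∫ k in halfOpenCell γ k₀, dirDensity V j k)
      - ∫ k in halfOpenCell γ k₀, dirDensity U j k)).re
      + c * (∑ j, ((∫ k in halfOpenCell γ k₀, berryDensity χ V j k)
      - ∫ k in halfOpenCell γ k₀, berryDensity χ U j k)).re
      + ∑ a, ∑ j, (z V a j ^ 2 - z U a j ^ 2).re := by
    refine hmin.trans (le_of_eq ?_)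
    simp only [← Complex.re_ofReal_mul, ← Complex.re_sum, ← Complex.add_re]
    congr 1
    simp only [z, Finset.mul_sum, Finset.sum_sub_distrib, mul_sub, mul_add, Finset.sum_add_distrib]
    ring
  -- The squared centers are nonlocal, but in the factorization of the difference of squares one
  -- factor is `O(s)` and local, while the other is bounded by a fixed center of `U` plus `O(s)`.
  have d4 : ∀ a j, (z V a j ^ 2 - z U a j ^ 2).re
      ≤ s * c * (κ * S * (2 * ‖torusIntegral γ c (centerDensity χ U a j)‖
        + s * (c * (κ * S)))) := by
    intro a j
    have h1 : ‖z V a j - z U a j‖ ≤ s * c * (κ * S) := by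
      simp only [z]
      rw [← mul_sub, norm_mul, Complex.norm_real, Real.norm_of_nonneg hc.le]
      calc _ ≤ c * (s * (κ * S)) := mul_le_mul_of_nonneg_left (d3 a j) hc.le
        _ = _ := by ring
    have h2 : z V a j ^ 2 - z U a j ^ 2
        = (z V a j - z U a j) * (2 * z U a j + (z V a j - z U a j)) := by ring
    refine (Complex.re_le_norm _).trans ?_
    rw [h2, norm_mul, ← hz]
    have h3 : ‖2 * z U a j + (z V a j - z U a j)‖ ≤ 2 * ‖z U a j‖ + s * (c * (κ * S)) := by
      refine (norm_add_le _ _).trans (add_le_add (by simp) (h1.trans (le_of_eq (by ring))))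
    calc _ ≤ s * c * (κ * S) * (2 * ‖z U a j‖ + s * (c * (κ * S))) :=
          mul_le_mul h1 h3 (norm_nonneg _) (by positivity)
      _ = _ := by ring
  have d2' := (Complex.re_le_norm _).trans d2
  have d5 : ∑ a, ∑ j, (z V a j ^ 2 - z U a j ^ 2).re ≤ s * c *
      ∑ a, ∑ j, κ * S * (2 * ‖torusIntegral γ c (centerDensity χ U a j)‖ + s * (c * (κ * S))) := by
    simp only [Finset.mul_sum]
    exact Finset.sum_le_sum fun a _ => Finset.sum_le_sum fun j _ => d4 a j
  have h1 := mul_le_mul_of_nonneg_left d1 hc.le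
  have h2 := mul_le_mul_of_nonneg_left d2' hc.le
  -- All bounds carry the common factor `s c`, which is divided out.
  refine le_of_mul_le_mul_left (a := s * c) ?_ (by positivity)
  rw [mul_zero]
  linarith

/-- The first variation inequality for minimizers. -/
theorem exists_first_variation_bound {d m : ℕ} {γ : Module.Basis (Fin d) ℝ (E d)}
    {χ : Fin m → E d → Hf γ} (hτ : ∀ a, MemHTau γ (χ a)) (hs : ∀ a, ContDiff ℝ ∞ (χ a))
    {c : ℝ} (hc : 0 < c) {U : SobolevMap γ m} (hU : IsMinimizer c χ U)
    {ρ : ℝ} (hρ : 0 < ρ) (hsep : ∀ l ∈ dualLattice γ, l ≠ 0 → 4 * ρ < ‖l‖)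
    (hcell : ∀ k₀, Metric.closedBall k₀ ρ ⊆ halfOpenCell γ k₀) :
    ∃ K, 0 < K ∧ ∀ (k₀ : E d) (X : E d → E d), ContDiff ℝ ∞ X →
      (∀ x ∉ Metric.closedBall k₀ ρ, X x = 0) →
      0 ≤ (∫ x in Metric.closedBall k₀ ρ, stress (fderiv ℝ X x) fun i => U.grad i x)
        + K * ∫ x in Metric.closedBall k₀ ρ,
          ((∑ i, entrySum (U.grad i x)) + 1) * (‖fderiv ℝ X x‖ + ‖X x‖) := by
  obtain ⟨C, δ, hC, hδ, hδ', hcoeff⟩ := exists_coeff_bound d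
  obtain ⟨M, hM, hbM⟩ := exists_berry_bound hτ hs
  obtain ⟨L, hL, hbL⟩ := exists_berry_lipschitz hτ hs
  set κ := 2 * m * (d * (C * M) + L) + (C + m ^ 2 * (C * M + L)) with hκ
  have hκ0 : 0 < κ := by positivity
  -- The `1` accounts for the Berry term and the sum for the linearized squared centers; nothing
  -- here depends on `k₀` or `X`.
  refine ⟨κ * (1 + ∑ a, ∑ j, 2 * ‖torusIntegral γ c (centerDensity χ U a j)‖), by positivity,
    fun k₀ X hXs hX => ?_⟩
  have hXc : HasCompactSupport X := HasCompactSupport.intro (isCompact_closedBall k₀ ρ) hX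
  obtain ⟨b, hb⟩ := (hXc.fderiv ℝ).exists_bound_of_continuous (hXs.continuous_fderiv (by simp))
  obtain ⟨b', hb'⟩ := hXc.exists_bound_of_continuous hXs.continuous
  set S := ∫ x in Metric.closedBall k₀ ρ,
    ((∑ i, entrySum (U.grad i x)) + 1) * (‖fderiv ℝ X x‖ + ‖X x‖) with hS
  set Q := ∫ x in Metric.closedBall k₀ ρ, stress (fderiv ℝ X x) fun i => U.grad i x
  set G := b * (d ^ 2 * ∫ x in Metric.closedBall k₀ ρ, gradNormSq U x)
  -- At fixed `ε` the limit `s → 0⁺` removes the second-order part of the squares, leaving the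
  -- factor `0`; afterwards `ε → 0⁺` removes the Taylor remainder, whose factor `G` depends on `X`.
  have step : ∀ ε : ℝ, 0 < ε → 0 ≤ Q + ε * G + κ * S
      + ∑ a, ∑ j, κ * S * (2 * ‖torusIntegral γ c (centerDensity χ U a j)‖ + 0 * (c * (κ * S))) := by
    intro ε hε
    obtain ⟨r, hr, hexp⟩ := Metric.eventually_nhds_iff.1 (eventually_dirichletCoeff (d := d) hε)
    have hlim : Tendsto (fun s : ℝ => Q + ε * G + κ * S + ∑ a, ∑ j, κ * S *
        (2 * ‖torusIntegral γ c (centerDensity χ U a j)‖ + s * (c * (κ * S)))) (𝓝[>] 0)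
        (𝓝 (Q + ε * G + κ * S + ∑ a, ∑ j, κ * S *
        (2 * ‖torusIntegral γ c (centerDensity χ U a j)‖ + 0 * (c * (κ * S))))) := by
      refine (Continuous.tendsto ?_ 0).mono_left nhdsWithin_le_nhds
      fun_prop
    have small : ∀ (B t : ℝ), 0 < t → ∀ᶠ s in 𝓝[>] (0 : ℝ), s * B < t := by
      intro B t ht
      have : Tendsto (fun s : ℝ => s * B) (𝓝[>] 0) (𝓝 (0 * B)) :=
        (Continuous.tendsto (by fun_prop) 0).mono_left nhdsWithin_le_nhds
      rw [zero_mul] at this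
      exact this.eventually (gt_mem_nhds ht)
    refine ge_of_tendsto hlim ?_
    filter_upwards [self_mem_nhdsWithin, small b δ hδ, small b' ρ hρ, small b r hr]
      with s hs0 h1 h2 h3
    refine deformation_inequality hτ hs hc hU hC hδ' hM hL hcoeff hbM hbL hρ hsep (hcell k₀) hXs hX
      hs0 hb hb' h1.le h2.le hε (fun A hA => ?_) hκ hS
    exact hexp (by rw [dist_zero_right]; exact hA.trans_lt h3)
  have hlim : Tendsto (fun ε : ℝ => Q + ε * G + κ * S
      + ∑ a, ∑ j, κ * S * (2 * ‖torusIntegral γ c (centerDensity χ U a j)‖ + 0 * (c * (κ * S))))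
      (𝓝[>] 0) (𝓝 (Q + 0 * G + κ * S
      + ∑ a, ∑ j, κ * S * (2 * ‖torusIntegral γ c (centerDensity χ U a j)‖
        + 0 * (c * (κ * S))))) := by
    refine (Continuous.tendsto ?_ 0).mono_left nhdsWithin_le_nhds
    fun_prop
  have h := ge_of_tendsto hlim (by filter_upwards [self_mem_nhdsWithin] with ε hε using step ε hε)
  refine h.trans (le_of_eq ?_)
  simp only [zero_mul, add_zero, mul_add, mul_one, add_mul, Finset.mul_sum, Finset.sum_mul]
  rw [add_assoc]
  congr 2
  exact Finset.sum_congr rfl fun a _ => Finset.sum_congr rfl fun j _ => by ring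

/-! ### Radial vector fields -/

/-- The contracting radial vector field `-F(|x - k₀|²) (x - k₀)`. -/
def radialField {d : ℕ} (k₀ : E d) (F : ℝ → ℝ) (x : E d) : E d :=
  -(F (‖x - k₀‖ ^ 2) • (x - k₀))

section
variable {d : ℕ} {k₀ : E d} {F : ℝ → ℝ} (hF : ContDiff ℝ ∞ F)
include hF

theorem contDiff_radialField : ContDiff ℝ ∞ (radialField k₀ F) :=
  ((hF.comp ((contDiff_id.sub contDiff_const).norm_sq ℝ)).smul
    (contDiff_id.sub contDiff_const)).neg

theorem fderiv_radialField_apply (x v : E d) :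
    fderiv ℝ (radialField k₀ F) x v = -(F (‖x - k₀‖ ^ 2) • v
      + (2 * deriv F (‖x - k₀‖ ^ 2) * ⟪x - k₀, v⟫_ℝ) • (x - k₀)) := by
  have h1 : HasFDerivAt (fun x : E d => x - k₀) (ContinuousLinearMap.id ℝ (E d)) x :=
    (hasFDerivAt_id x).sub_const k₀
  have h2 := h1.norm_sq
  have h3 := (hF.differentiable (by simp) (‖x - k₀‖ ^ 2)).hasDerivAt
  have h4 : HasFDerivAt (fun x : E d => F (‖x - k₀‖ ^ 2)) _ x := h3.comp_hasFDerivAt x h2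
  have h5 : HasFDerivAt (radialField k₀ F) _ x := (h4.smul h1).neg
  rw [h5.fderiv]
  simp [inner_sub_left]
  ring_nf

theorem entry_fderiv_radialField (x : E d) (i j : Fin d) :
    entry i j (fderiv ℝ (radialField k₀ F) x) = -((if i = j then F (‖x - k₀‖ ^ 2) else 0)
      + 2 * deriv F (‖x - k₀‖ ^ 2) * ((x - k₀) i * (x - k₀) j)) := by
  rw [entry_apply, fderiv_radialField_apply hF]
  simp [unitVec, EuclideanSpace.inner_single_right]
  ring

theorem traceCLM_fderiv_radialField (x : E d) :
    traceCLM (fderiv ℝ (radialField k₀ F) x)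
      = -(d * F (‖x - k₀‖ ^ 2) + 2 * deriv F (‖x - k₀‖ ^ 2) * ‖x - k₀‖ ^ 2) := by
  have h : ∑ i, (x - k₀) i * (x - k₀) i = ‖x - k₀‖ ^ 2 := by
    rw [EuclideanSpace.real_norm_sq_eq]
    exact Finset.sum_congr rfl fun i _ => by ring
  simp only [traceCLM, _root_.sum_apply, entry_fderiv_radialField hF,
    Finset.sum_neg_distrib, Finset.sum_add_distrib, ← Finset.mul_sum, h]
  simp

theorem norm_fderiv_radialField_le (x : E d) :
    ‖fderiv ℝ (radialField k₀ F) x‖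
      ≤ |F (‖x - k₀‖ ^ 2)| + 2 * |deriv F (‖x - k₀‖ ^ 2)| * ‖x - k₀‖ ^ 2 := by
  refine ContinuousLinearMap.opNorm_le_bound _ (by positivity) fun v => ?_
  rw [fderiv_radialField_apply hF, norm_neg, add_mul]
  refine (norm_add_le _ _).trans (add_le_add ?_ ?_)
  · rw [norm_smul, Real.norm_eq_abs]
  · rw [norm_smul, Real.norm_eq_abs, abs_mul, abs_mul, abs_two]
    have := abs_real_inner_le_norm (x - k₀) v
    calc 2 * |deriv F (‖x - k₀‖ ^ 2)| * |⟪x - k₀, v⟫_ℝ| * ‖x - k₀‖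
        ≤ 2 * |deriv F (‖x - k₀‖ ^ 2)| * (‖x - k₀‖ * ‖v‖) * ‖x - k₀‖ := by gcongr
      _ = _ := by ring

end

theorem norm_radialField {d : ℕ} (k₀ : E d) (F : ℝ → ℝ) (x : E d) :
    ‖radialField k₀ F x‖ = |F (‖x - k₀‖ ^ 2)| * ‖x - k₀‖ := by
  rw [radialField, norm_neg, norm_smul, Real.norm_eq_abs]

section
variable {d m : ℕ} {γ : Module.Basis (Fin d) ℝ (E d)} (U : SobolevMap γ m)

theorem sum_mul_pairing_eq (k₀ x : E d) :
    ∑ i, ∑ l, (x - k₀) i * (x - k₀) l * pairing (U.grad i x) (U.grad l x)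
      = ‖x - k₀‖ ^ 2 * matNormSq (radialDeriv U k₀ x) := by
  rw [radialDeriv, pairing_sum_sum, Finset.mul_sum]
  refine Finset.sum_congr rfl fun i _ => ?_
  rw [Finset.mul_sum]
  refine Finset.sum_congr rfl fun l _ => ?_
  by_cases h : x - k₀ = 0
  · simp [h]
  · have := norm_ne_zero_iff.2 h
    field_simp

theorem matNormSq_sum_le (c : Fin d → ℝ) (p : Fin d → Matrix (Fin m) (Fin m) ℂ) :
    matNormSq (∑ j, ((c j : ℝ) : ℂ) • p j) ≤ (∑ j, c j ^ 2) * ∑ j, matNormSq (p j) := by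
  simp only [matNormSq_eq]
  rw [Finset.sum_comm (s := (Finset.univ : Finset (Fin d))), Finset.mul_sum]
  refine Finset.sum_le_sum fun b _ => ?_
  rw [Finset.sum_comm (s := (Finset.univ : Finset (Fin d))), Finset.mul_sum]
  refine Finset.sum_le_sum fun a _ => ?_
  rw [Matrix.sum_apply]
  have h1 : ‖∑ j, (((c j : ℝ) : ℂ) • p j) a b‖ ≤ ∑ j, |c j| * ‖p j a b‖ := by
    refine (norm_sum_le _ _).trans (Finset.sum_le_sum fun j _ => ?_)
    rw [Matrix.smul_apply, norm_smul, Complex.norm_real, Real.norm_eq_abs]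
  have h2 := Finset.sum_mul_sq_le_sq_mul_sq Finset.univ (fun j => |c j|) (fun j => ‖p j a b‖)
  simp only [sq_abs] at h2
  exact (pow_le_pow_left₀ (norm_nonneg _) h1 2).trans h2

theorem gradNormSq_nonneg (x : E d) : 0 ≤ gradNormSq U x :=
  Finset.sum_nonneg fun _ _ => matNormSq_nonneg _

theorem matNormSq_radialDeriv_le (k₀ x : E d) :
    matNormSq (radialDeriv U k₀ x) ≤ gradNormSq U x := by
  have h := matNormSq_sum_le (fun j => (x - k₀) j / ‖x - k₀‖) fun j => U.grad j x
  have h0 : ∑ j, ((x - k₀) j / ‖x - k₀‖) ^ 2 ≤ 1 := by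
    simp only [div_pow, ← Finset.sum_div]
    rw [← EuclideanSpace.real_norm_sq_eq]
    exact div_self_le_one _
  exact h.trans (mul_le_of_le_one_left (gradNormSq_nonneg U x) h0)

/-- The derivative of the field is `-(F · 1 + 2F' y ⊗ y)` with `y = x - k₀`. The isotropic part
gives `(2 - d) F |∇U|²`; the rank-one part gives `-2F' r² |∇U|²` through the divergence and `4F' r²
|∂ᵣU|²` through the pairing. -/
theorem stress_radialField {F : ℝ → ℝ} (hF : ContDiff ℝ ∞ F) (k₀ x : E d) :
    (stress (fderiv ℝ (radialField k₀ F) x) fun i => U.grad i x)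
      = ((2 - d) * F (‖x - k₀‖ ^ 2) - 2 * deriv F (‖x - k₀‖ ^ 2) * ‖x - k₀‖ ^ 2)
          * gradNormSq U x
        + 4 * deriv F (‖x - k₀‖ ^ 2) * ‖x - k₀‖ ^ 2 * matNormSq (radialDeriv U k₀ x) := by
  have h1 : gradNormSq U x
      = ∑ i, ∑ l, (if i = l then (1 : ℝ) else 0) * pairing (U.grad i x) (U.grad l x) :=
    sum_matNormSq_eq fun i => U.grad i x
  rw [mul_assoc (4 * _), ← sum_mul_pairing_eq, h1]
  simp only [stress, entry_fderiv_radialField hF, traceCLM_fderiv_radialField hF, Finset.mul_sum,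
    ← Finset.sum_add_distrib]
  refine Finset.sum_congr rfl fun i _ => Finset.sum_congr rfl fun l _ => ?_
  by_cases h : i = l
  · subst h; simp; ring
  · simp [h, Ne.symm h]; ring

/-- The integrand of the first variation inequality for a radial vector field with profile `f`
and profile derivative `f'`. -/
def radialIntegrand (K : ℝ) (k₀ : E d) (f f' : ℝ) (x : E d) : ℝ :=
  ((2 - d) * f - 2 * f' * ‖x - k₀‖ ^ 2) * gradNormSq U x
    + 4 * f' * ‖x - k₀‖ ^ 2 * matNormSq (radialDeriv U k₀ x)
    + K * (((∑ i, entrySum (U.grad i x)) + 1) * (|f| * (1 + ‖x - k₀‖) + 2 * |f'| * ‖x - k₀‖ ^ 2))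

theorem aestronglyMeasurable_matNormSq_radialDeriv (k₀ : E d) {B : Set (E d)} (hB : IsCompact B) :
    AEStronglyMeasurable (fun x => matNormSq (radialDeriv U k₀ x)) (volume.restrict B) := by
  simp only [radialDeriv, pairing_sum_sum]
  have hc : ∀ i : Fin d, Measurable fun x : E d => (x - k₀) i / ‖x - k₀‖ := fun i => by
    fun_prop
  refine Finset.aestronglyMeasurable_fun_sum _ fun i _ =>
    Finset.aestronglyMeasurable_fun_sum _ fun l _ => ?_
  exact ((hc i).mul (hc l)).aestronglyMeasurable.mul (U.integrableOn_pairing i l hB).1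

theorem integrableOn_matNormSq_radialDeriv (k₀ : E d) {B : Set (E d)} (hB : IsCompact B) :
    IntegrableOn (fun x => matNormSq (radialDeriv U k₀ x)) B := by
  refine Integrable.mono' (U.integrableOn_gradNormSq hB)
    (aestronglyMeasurable_matNormSq_radialDeriv U k₀ hB) (Eventually.of_forall fun x => ?_)
  rw [Real.norm_of_nonneg (matNormSq_nonneg _)]
  exact matNormSq_radialDeriv_le U k₀ x

/-- As `K ≥ 0`, the norms of the field and its derivative can be replaced by bounds in terms of the
profile. The resulting integrand also makes sense for profiles with corners. -/
theorem integral_radialIntegrand_nonneg {K ρ : ℝ} (hK : 0 ≤ K) {k₀ : E d}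
    (h : ∀ X : E d → E d, ContDiff ℝ ∞ X → (∀ x ∉ Metric.closedBall k₀ ρ, X x = 0) →
      0 ≤ (∫ x in Metric.closedBall k₀ ρ, stress (fderiv ℝ X x) fun i => U.grad i x)
        + K * ∫ x in Metric.closedBall k₀ ρ,
          ((∑ i, entrySum (U.grad i x)) + 1) * (‖fderiv ℝ X x‖ + ‖X x‖))
    (hρ : 0 < ρ) {F : ℝ → ℝ} (hF : ContDiff ℝ ∞ F) (hF0 : ∀ t, ρ ^ 2 ≤ t → F t = 0) :
    0 ≤ ∫ x in Metric.closedBall k₀ ρ,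
      radialIntegrand U K k₀ (F (‖x - k₀‖ ^ 2)) (deriv F (‖x - k₀‖ ^ 2)) x := by
  have hBc : IsCompact (Metric.closedBall k₀ ρ) := isCompact_closedBall k₀ ρ
  have hXs := contDiff_radialField (k₀ := k₀) hF
  have h1 := h (radialField k₀ F) hXs fun x hx => by
    rw [mem_closedBall_iff_norm, not_le] at hx
    rw [radialField, hF0 _ (pow_le_pow_left₀ hρ.le hx.le 2), zero_smul, neg_zero]
  have hcr : Continuous fun x : E d => ‖x - k₀‖ := (continuous_id.sub continuous_const).norm
  have hcF : Continuous fun x : E d => F (‖x - k₀‖ ^ 2) := hF.continuous.comp (hcr.pow 2)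
  have hcF' : Continuous fun x : E d => deriv F (‖x - k₀‖ ^ 2) :=
    (hF.continuous_deriv (by simp)).comp (hcr.pow 2)
  have i1 := integrableOn_stress U hXs hBc
  have i2 := integrableOn_entrySum_mul U hXs hBc
  have i3 : IntegrableOn (fun x => ((∑ i, entrySum (U.grad i x)) + 1)
      * (|F (‖x - k₀‖ ^ 2)| * (1 + ‖x - k₀‖) + 2 * |deriv F (‖x - k₀‖ ^ 2)| * ‖x - k₀‖ ^ 2))
      (Metric.closedBall k₀ ρ) := by
    refine IntegrableOn.mul_continuousOn ((U.integrableOn_entrySum hBc).add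
      (continuous_const.continuousOn.integrableOn_compact hBc)) (Continuous.continuousOn ?_) hBc
    exact (hcF.abs.mul (continuous_const.add hcr)).add
      ((continuous_const.mul hcF'.abs).mul (hcr.pow 2))
  have h2 : ∫ x in Metric.closedBall k₀ ρ, radialIntegrand U K k₀ (F (‖x - k₀‖ ^ 2))
        (deriv F (‖x - k₀‖ ^ 2)) x
      = (∫ x in Metric.closedBall k₀ ρ, stress (fderiv ℝ (radialField k₀ F) x) fun i => U.grad i x)
        + K * ∫ x in Metric.closedBall k₀ ρ, ((∑ i, entrySum (U.grad i x)) + 1)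
          * (|F (‖x - k₀‖ ^ 2)| * (1 + ‖x - k₀‖)
            + 2 * |deriv F (‖x - k₀‖ ^ 2)| * ‖x - k₀‖ ^ 2) := by
    rw [← integral_const_mul, ← integral_add i1 (i3.const_mul K)]
    refine integral_congr_ae (Eventually.of_forall fun x => ?_)
    simp only [radialIntegrand, stress_radialField U hF]
  rw [h2]
  refine h1.trans (add_le_add le_rfl (mul_le_mul_of_nonneg_left ?_ hK))
  refine integral_mono i2 i3 fun x => ?_
  refine mul_le_mul_of_nonneg_left ?_
    (add_nonneg (Finset.sum_nonneg fun _ _ => entrySum_nonneg _) zero_le_one)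
  rw [norm_radialField]
  have := norm_fderiv_radialField_le (k₀ := k₀) hF x
  linarith

end

/-! ### Smooth approximation of truncated profiles -/

/-- A smooth approximation of `t ↦ max t 0`. -/
def smoothPos (n : ℕ) (t : ℝ) : ℝ := t * Real.smoothTransition (n * t)

theorem contDiff_smoothPos (n : ℕ) : ContDiff ℝ ∞ (smoothPos n) :=
  contDiff_id.mul (Real.smoothTransition.contDiff.comp (contDiff_const.mul contDiff_id))

theorem smoothPos_of_nonpos (n : ℕ) {t : ℝ} (ht : t ≤ 0) : smoothPos n t = 0 := by
  rw [smoothPos, Real.smoothTransition.zero_of_nonpos (mul_nonpos_of_nonneg_of_nonpos (by positivity) ht),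
    mul_zero]

theorem smoothPos_of_one_le {n : ℕ} {t : ℝ} (ht : 1 ≤ n * t) : smoothPos n t = t := by
  rw [smoothPos, Real.smoothTransition.one_of_one_le ht, mul_one]

theorem smoothPos_nonneg (n : ℕ) (t : ℝ) : 0 ≤ smoothPos n t := by
  rcases le_total t 0 with h | h
  · rw [smoothPos_of_nonpos n h]
  · exact mul_nonneg h (Real.smoothTransition.nonneg _)

theorem smoothPos_le (n : ℕ) {t : ℝ} (ht : 0 ≤ t) : smoothPos n t ≤ t :=
  mul_le_of_le_one_right ht (Real.smoothTransition.le_one _)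

/-- For `n > 0` the function is the rescaling `n⁻¹ q(n t)` of `q = smoothPos 1`, so its derivative
takes values of `q'`, which is constant on each side of `[0, 1]`. -/
theorem exists_abs_deriv_smoothPos_le : ∃ M, ∀ n t, |deriv (smoothPos n) t| ≤ M := by
  have hst : ContDiff ℝ ∞ Real.smoothTransition := Real.smoothTransition.contDiff
  let q : ℝ → ℝ := smoothPos 1
  have hq : ContDiff ℝ ∞ q := contDiff_smoothPos 1
  obtain ⟨M, hM⟩ := (isCompact_Icc (a := (0 : ℝ)) (b := 1)).exists_bound_of_continuousOn
    (hq.continuous_deriv (by simp)).continuousOn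
  have hq' : ∀ t, |deriv q t| ≤ max M 1 := by
    intro t
    rcases lt_or_ge t 0 with h | h
    · have : q =ᶠ[𝓝 t] fun _ => 0 := by
        filter_upwards [gt_mem_nhds h] with u hu using smoothPos_of_nonpos 1 hu.le
      rw [this.deriv_eq]; simp
    rcases le_or_gt t 1 with h1 | h1
    · exact (hM t ⟨h, h1⟩).trans (le_max_left _ _)
    · have : q =ᶠ[𝓝 t] fun u => u := by
        filter_upwards [lt_mem_nhds h1] with u hu using smoothPos_of_one_le (by simpa using hu.le)
      rw [this.deriv_eq]; simp
  refine ⟨max M 1, fun n t => ?_⟩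
  rcases Nat.eq_zero_or_pos n with rfl | hn
  · have : smoothPos 0 = fun _ => 0 := by
      funext t; simp [smoothPos, Real.smoothTransition.zero]
    rw [this]; simp
  · have hn' : (n : ℝ) ≠ 0 := by positivity
    have h1 : smoothPos n = fun t => (n : ℝ)⁻¹ * q (n * t) := by
      funext t; simp only [q, smoothPos, Nat.cast_one, one_mul]; field_simp
    have h2 : HasDerivAt (smoothPos n) ((n : ℝ)⁻¹ * (deriv q (n * t) * n)) t := by
      rw [h1]
      have h3 : HasDerivAt (fun t : ℝ => (n : ℝ) * t) n t := by
        simpa using (hasDerivAt_id t).const_mul (n : ℝ)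
      exact ((hq.differentiable (by simp) (n * t)).hasDerivAt.comp t h3).const_mul _
    rw [h2.deriv]
    have h4 : (n : ℝ)⁻¹ * (deriv q (n * t) * n) = deriv q (n * t) := by field_simp
    rw [h4]
    exact hq' _

theorem eventually_one_le_mul {t : ℝ} (ht : 0 < t) : ∀ᶠ n : ℕ in atTop, 1 ≤ (n : ℝ) * t := by
  have : Tendsto (fun n : ℕ => (n : ℝ) * t) atTop atTop :=
    tendsto_natCast_atTop_atTop.atTop_mul_const ht
  exact this.eventually_ge_atTop 1

theorem eventually_smoothPos_eq (t : ℝ) : ∀ᶠ n in atTop, smoothPos n t = max t 0 := by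
  rcases le_or_gt t 0 with h | h
  · exact Eventually.of_forall fun n => by rw [smoothPos_of_nonpos n h, max_eq_right h]
  · filter_upwards [eventually_one_le_mul h] with n hn
    rw [smoothPos_of_one_le hn, max_eq_left h.le]

theorem eventually_deriv_smoothPos_eq {t : ℝ} (ht : t ≠ 0) :
    ∀ᶠ n in atTop, deriv (smoothPos n) t = if 0 < t then 1 else 0 := by
  rcases lt_or_gt_of_ne ht with h | h
  · refine Eventually.of_forall fun n => ?_
    have : smoothPos n =ᶠ[𝓝 t] fun _ => 0 := by
      filter_upwards [gt_mem_nhds h] with u hu using smoothPos_of_nonpos n hu.le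
    rw [this.deriv_eq, if_neg h.not_gt]; simp
  · filter_upwards [eventually_one_le_mul (half_pos h)] with n hn
    have : smoothPos n =ᶠ[𝓝 t] fun u => u := by
      filter_upwards [lt_mem_nhds (half_lt_self h)] with u hu
      exact smoothPos_of_one_le (hn.trans (mul_le_mul_of_nonneg_left hu.le (by positivity)))
    rw [this.deriv_eq, if_pos h]; simp

/-- A smooth approximation of the projection onto `[a, b]`. -/
def smoothClamp (a b : ℝ) (n : ℕ) (t : ℝ) : ℝ := a + smoothPos n (t - a) - smoothPos n (t - b)

section
variable {a b : ℝ}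

theorem contDiff_smoothClamp (n : ℕ) : ContDiff ℝ ∞ (smoothClamp a b n) :=
  (contDiff_const.add ((contDiff_smoothPos n).comp (contDiff_id.sub contDiff_const))).sub
    ((contDiff_smoothPos n).comp (contDiff_id.sub contDiff_const))

/-- The lower bound is essential, as `Z` is smooth only on the positive axis. The condition on `n`
makes the approximation of `(t - a)⁺` exact by the time the second transition begins at `b`. -/
theorem smoothClamp_mem {n : ℕ} (hn : 1 ≤ n * (b - a)) (hab : a < b) (t : ℝ) :
    smoothClamp a b n t ∈ Set.Icc a (max a t) := by
  unfold smoothClamp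
  rcases le_total t b with h | h
  · rw [smoothPos_of_nonpos n (sub_nonpos.2 h), sub_zero]
    refine ⟨by linarith [smoothPos_nonneg n (t - a)], ?_⟩
    rcases le_total t a with h1 | h1
    · rw [smoothPos_of_nonpos n (sub_nonpos.2 h1), add_zero]; exact le_max_left _ _
    · refine le_trans ?_ (le_max_right _ _)
      linarith [smoothPos_le n (sub_nonneg.2 h1)]
  · rw [smoothPos_of_one_le (n := n) (t := t - a) (hn.trans
      (mul_le_mul_of_nonneg_left (by linarith) (by positivity)))]
    have h1 := smoothPos_le n (sub_nonneg.2 h)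
    have h2 := smoothPos_nonneg n (t - b)
    exact ⟨by linarith, le_trans (by linarith) (le_max_right _ _)⟩

theorem smoothClamp_of_large {n : ℕ} (hab : a < b) {t : ℝ} (ht : 1 ≤ n * (t - b)) :
    smoothClamp a b n t = b := by
  unfold smoothClamp
  rw [smoothPos_of_one_le ht, smoothPos_of_one_le (ht.trans
    (mul_le_mul_of_nonneg_left (by linarith) (by positivity)))]
  ring

theorem eventually_smoothClamp_eq (hab : a < b) (t : ℝ) :
    ∀ᶠ n in atTop, smoothClamp a b n t = min (max t a) b := by
  filter_upwards [eventually_smoothPos_eq (t - a), eventually_smoothPos_eq (t - b)] with n h1 h2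
  rw [smoothClamp, h1, h2]
  rcases le_total t a with h | h
  · rw [max_eq_right (by linarith), max_eq_right (by linarith), max_eq_right h,
      min_eq_left hab.le]
    ring
  rcases le_total t b with h' | h'
  · rw [max_eq_left (by linarith), max_eq_right (by linarith), max_eq_left h, min_eq_left h']
    ring
  · rw [max_eq_left (by linarith), max_eq_left (by linarith), max_eq_left h, min_eq_right h']
    ring

theorem deriv_smoothClamp (n : ℕ) (t : ℝ) :
    deriv (smoothClamp a b n) t = deriv (smoothPos n) (t - a) - deriv (smoothPos n) (t - b) := by
  have hd : Differentiable ℝ (smoothPos n) := (contDiff_smoothPos n).differentiable (by simp)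
  have h1 : ∀ e, HasDerivAt (fun t => smoothPos n (t - e)) (deriv (smoothPos n) (t - e)) t :=
    fun e => by simpa using (hd (t - e)).hasDerivAt.comp_sub_const t e
  exact (((h1 a).const_add a).sub (h1 b)).deriv

theorem eventually_deriv_smoothClamp_eq {t : ℝ} (ha : t ≠ a) (hb : t ≠ b) (hab : a < b) :
    ∀ᶠ n in atTop, deriv (smoothClamp a b n) t = if a < t ∧ t < b then 1 else 0 := by
  filter_upwards [eventually_deriv_smoothPos_eq (sub_ne_zero.2 ha),
    eventually_deriv_smoothPos_eq (sub_ne_zero.2 hb)] with n h1 h2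
  rw [deriv_smoothClamp, h1, h2]
  rcases lt_or_gt_of_ne ha with h | h
  · rw [if_neg (by linarith), if_neg (by linarith), if_neg (by intro h'; linarith [h'.1])]; simp
  rcases lt_or_gt_of_ne hb with h' | h'
  · rw [if_pos (by linarith), if_neg (by linarith), if_pos ⟨h, h'⟩]; simp
  · rw [if_pos (by linarith), if_pos (by linarith), if_neg (by intro h''; linarith [h''.2])]; simp

end

/-- Truncated profiles are limits of smooth ones. -/
theorem exists_smooth_profile {Z : ℝ → ℝ} (hZ : ∀ u, 0 < u → ContDiffAt ℝ ∞ Z u) {a b T : ℝ}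
    (ha : 0 < a) (hab : a < b) (hbT : b < T) :
    ∃ (F : ℕ → ℝ → ℝ) (M : ℝ), (∀ᶠ n in atTop, ContDiff ℝ ∞ (F n) ∧ (∀ t, T ≤ t → F n t = 0) ∧
        ∀ t, t ≤ T → |F n t| ≤ M ∧ |deriv (F n) t| ≤ M) ∧
      (∀ t, ∀ᶠ n in atTop, F n t = Z (min (max t a) b) - Z b) ∧
      ∀ t, t ≠ a → t ≠ b → ∀ᶠ n in atTop,
        deriv (F n) t = if a < t ∧ t < b then deriv Z t else 0 := by
  have hZc : ContinuousOn Z (Set.Icc a T) := fun u hu =>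
    (hZ u (ha.trans_le hu.1)).continuousAt.continuousWithinAt
  have hZd : ∀ u, 0 < u → DifferentiableAt ℝ Z u := fun u hu =>
    (hZ u hu).differentiableAt (by simp)
  have hZ'c : ContinuousOn (deriv Z) (Set.Icc a T) := fun u hu =>
    (((hZ u (ha.trans_le hu.1)).derivWithin (m := 0) (by simp)).continuousAt).continuousWithinAt
  obtain ⟨M₁, hM₁⟩ := isCompact_Icc.exists_bound_of_continuousOn hZc
  obtain ⟨M₂, hM₂⟩ := isCompact_Icc.exists_bound_of_continuousOn hZ'c
  obtain ⟨M₃, hM₃⟩ := exists_abs_deriv_smoothPos_le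
  have hder : ∀ n t, 0 < smoothClamp a b n t → HasDerivAt (fun t => Z (smoothClamp a b n t) - Z b)
      (deriv Z (smoothClamp a b n t) * deriv (smoothClamp a b n) t) t := fun n t ht =>
    ((hZd _ ht).hasDerivAt.comp t
      ((contDiff_smoothClamp n).differentiable (by simp) t).hasDerivAt).sub_const _
  refine ⟨fun n t => Z (smoothClamp a b n t) - Z b, max (M₁ + M₁) (M₂ * (M₃ + M₃)), ?_, ?_, ?_⟩
  · filter_upwards [eventually_one_le_mul (sub_pos.2 hab), eventually_one_le_mul (sub_pos.2 hbT)]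
      with n h1 h2
    have hmem := fun t => smoothClamp_mem h1 hab t
    refine ⟨?_, fun t ht => ?_, fun t ht => ?_⟩
    · rw [contDiff_iff_contDiffAt]
      intro t
      exact ((hZ _ (ha.trans_le (hmem t).1)).comp t (contDiff_smoothClamp n).contDiffAt).sub
        contDiffAt_const
    · rw [smoothClamp_of_large hab (h2.trans
        (mul_le_mul_of_nonneg_left (by linarith) (by positivity))), sub_self]
    · have hI : smoothClamp a b n t ∈ Set.Icc a T :=
        ⟨(hmem t).1, (hmem t).2.trans (max_le (by linarith) ht)⟩
      constructor
      · refine le_trans ?_ (le_max_left _ _)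
        refine (abs_sub _ _).trans (add_le_add (hM₁ _ hI) (hM₁ _ ⟨hab.le, hbT.le⟩))
      · refine le_trans ?_ (le_max_right _ _)
        rw [(hder n t (ha.trans_le (hmem t).1)).deriv, abs_mul, deriv_smoothClamp]
        have h3 := hM₂ _ hI
        refine mul_le_mul h3 ((abs_sub _ _).trans (add_le_add (hM₃ _ _) (hM₃ _ _)))
          (abs_nonneg _) ((norm_nonneg _).trans h3)
  · intro t
    filter_upwards [eventually_smoothClamp_eq hab t] with n hn
    rw [hn]
  · intro t hta htb
    filter_upwards [eventually_smoothClamp_eq hab t, eventually_deriv_smoothClamp_eq hta htb hab,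
      eventually_one_le_mul (sub_pos.2 hab)] with n h1 h2 h3
    rw [(hder n t (ha.trans_le (smoothClamp_mem h3 hab t).1)).deriv, h1, h2]
    split_ifs with h
    · rw [max_eq_left h.1.le, min_eq_left h.2.le, mul_one]
    · rw [mul_zero]

/-- Dominated convergence, including the integrability of the limit. -/
theorem integrable_and_tendsto_integral_of_dominated {α : Type*} [MeasurableSpace α]
    {μ : Measure α} {F : ℕ → α → ℝ} {f bound : α → ℝ}
    (hF : ∀ᶠ n in atTop, AEStronglyMeasurable (F n) μ)
    (hb : ∀ᶠ n in atTop, ∀ᵐ x ∂μ, ‖F n x‖ ≤ bound x) (hbi : Integrable bound μ)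
    (hlim : ∀ᵐ x ∂μ, Tendsto (fun n => F n x) atTop (𝓝 (f x))) :
    Integrable f μ ∧ Tendsto (fun n => ∫ x, F n x ∂μ) atTop (𝓝 (∫ x, f x ∂μ)) := by
  refine ⟨?_, tendsto_integral_filter_of_dominated_convergence bound hF hb hbi hlim⟩
  obtain ⟨N, hN⟩ := eventually_atTop.1 (hF.and hb)
  refine hbi.mono' (aestronglyMeasurable_of_tendsto_ae atTop
    (fun n => (hN (n + N) (Nat.le_add_left _ _)).1)
    (hlim.mono fun x hx => hx.comp (tendsto_add_atTop_nat N))) ?_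
  filter_upwards [hlim, ae_all_iff.2 fun n => (hN (n + N) (Nat.le_add_left _ _)).2] with x h1 h2
  exact le_of_tendsto (h1.comp (tendsto_add_atTop_nat N)).norm (Eventually.of_forall h2)

/-- The first variation inequality for truncated radial profiles. -/
theorem integral_radialIntegrand_truncated_nonneg {d m : ℕ} (hd : 3 ≤ d)
    {γ : Module.Basis (Fin d) ℝ (E d)}
    (U : SobolevMap γ m) {K ρ : ℝ} (hK : 0 ≤ K) {k₀ : E d}
    (h : ∀ X : E d → E d, ContDiff ℝ ∞ X → (∀ x ∉ Metric.closedBall k₀ ρ, X x = 0) →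
      0 ≤ (∫ x in Metric.closedBall k₀ ρ, stress (fderiv ℝ X x) fun i => U.grad i x)
        + K * ∫ x in Metric.closedBall k₀ ρ,
          ((∑ i, entrySum (U.grad i x)) + 1) * (‖fderiv ℝ X x‖ + ‖X x‖))
    {Z : ℝ → ℝ} (hZ : ∀ u, 0 < u → ContDiffAt ℝ ∞ Z u) {R₁ R₂ : ℝ} (hR₁ : 0 < R₁)
    (hR : R₁ < R₂) (hρ : R₂ < ρ) :
    IntegrableOn (fun x => radialIntegrand U K k₀
      (Z (min (max (‖x - k₀‖ ^ 2) (R₁ ^ 2)) (R₂ ^ 2)) - Z (R₂ ^ 2))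
      (if R₁ ^ 2 < ‖x - k₀‖ ^ 2 ∧ ‖x - k₀‖ ^ 2 < R₂ ^ 2 then deriv Z (‖x - k₀‖ ^ 2) else 0) x)
      (Metric.closedBall k₀ ρ) ∧
    0 ≤ ∫ x in Metric.closedBall k₀ ρ, radialIntegrand U K k₀
      (Z (min (max (‖x - k₀‖ ^ 2) (R₁ ^ 2)) (R₂ ^ 2)) - Z (R₂ ^ 2))
      (if R₁ ^ 2 < ‖x - k₀‖ ^ 2 ∧ ‖x - k₀‖ ^ 2 < R₂ ^ 2 then deriv Z (‖x - k₀‖ ^ 2) else 0) x := by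
  have hBc : IsCompact (Metric.closedBall k₀ ρ) := isCompact_closedBall k₀ ρ
  have hρ0 : 0 < ρ := by linarith
  have hab : R₁ ^ 2 < R₂ ^ 2 := pow_lt_pow_left₀ hR hR₁.le two_ne_zero
  have hbT : R₂ ^ 2 < ρ ^ 2 := pow_lt_pow_left₀ hρ (by linarith) two_ne_zero
  obtain ⟨F, M, hF, hF0, hF1⟩ := exists_smooth_profile hZ (pow_pos hR₁ 2) hab hbT
  have hd0 : (2 : ℝ) - d ≤ 0 := by
    have : (3 : ℝ) ≤ d := by exact_mod_cast hd
    linarith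
  have hcr : Continuous fun x : E d => ‖x - k₀‖ := (continuous_id.sub continuous_const).norm
  -- The corners of the truncated profile lie on two spheres, which are null; elsewhere the
  -- approximants eventually equal the limit.
  have hsphere : ∀ R : ℝ, 0 < R → ∀ᵐ x ∂volume.restrict (Metric.closedBall k₀ ρ),
      ‖x - k₀‖ ^ 2 ≠ R ^ 2 := by
    intro R hR
    have h0 : volume (Metric.sphere k₀ R) = 0 := Measure.addHaar_sphere_of_ne_zero volume k₀ hR.ne'
    refine ae_restrict_of_ae ?_
    filter_upwards [measure_eq_zero_iff_ae_notMem.1 h0] with x hx hx'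
    rw [mem_sphere_iff_norm] at hx
    exact hx ((pow_left_inj₀ (norm_nonneg _) hR.le two_ne_zero).1 hx')
  have hlim := integrable_and_tendsto_integral_of_dominated (μ := volume.restrict
    (Metric.closedBall k₀ ρ))
    (F := fun n x => radialIntegrand U K k₀ (F n (‖x - k₀‖ ^ 2)) (deriv (F n) (‖x - k₀‖ ^ 2)) x)
    (f := fun x => radialIntegrand U K k₀
      (Z (min (max (‖x - k₀‖ ^ 2) (R₁ ^ 2)) (R₂ ^ 2)) - Z (R₂ ^ 2))
      (if R₁ ^ 2 < ‖x - k₀‖ ^ 2 ∧ ‖x - k₀‖ ^ 2 < R₂ ^ 2 then deriv Z (‖x - k₀‖ ^ 2) else 0) x)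
    -- The `6` is `2` from the divergence term plus `4` from the radial term, the latter being
    -- bounded by the full gradient.
    (bound := fun x => (d * M + 6 * M * ρ ^ 2) * gradNormSq U x
      + K * (((∑ i, entrySum (U.grad i x)) + 1) * (M * (1 + ρ) + 2 * M * ρ ^ 2))) ?_ ?_ ?_ ?_
  · refine ⟨hlim.1, ge_of_tendsto hlim.2 ?_⟩
    filter_upwards [hF] with n hn
    exact integral_radialIntegrand_nonneg U hK h hρ0 hn.1 hn.2.1
  · filter_upwards [hF] with n hn
    have hc1 : Continuous fun x : E d => F n (‖x - k₀‖ ^ 2) := hn.1.continuous.comp (hcr.pow 2)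
    have hc2 : Continuous fun x : E d => deriv (F n) (‖x - k₀‖ ^ 2) :=
      (hn.1.continuous_deriv (by simp)).comp (hcr.pow 2)
    have m1 := (U.integrableOn_gradNormSq hBc).1
    have m2 := aestronglyMeasurable_matNormSq_radialDeriv U k₀ hBc
    have m3 := (U.integrableOn_entrySum hBc).1
    refine (AEStronglyMeasurable.add (AEStronglyMeasurable.mul
      (Continuous.aestronglyMeasurable ?_) m1) (AEStronglyMeasurable.mul
      (Continuous.aestronglyMeasurable ?_) m2)).add (AEStronglyMeasurable.const_mul
      ((m3.add aestronglyMeasurable_const).mul (Continuous.aestronglyMeasurable ?_)) K)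
    · exact (continuous_const.mul hc1).sub ((continuous_const.mul hc2).mul (hcr.pow 2))
    · exact (continuous_const.mul hc2).mul (hcr.pow 2)
    · exact (hc1.abs.mul (continuous_const.add hcr)).add
        ((continuous_const.mul hc2.abs).mul (hcr.pow 2))
  · filter_upwards [hF] with n hn
    filter_upwards [ae_restrict_mem hBc.measurableSet] with x hx
    rw [mem_closedBall_iff_norm] at hx
    set r := ‖x - k₀‖ with hr
    have hr0 : 0 ≤ r := norm_nonneg _
    have hr2 : r ^ 2 ≤ ρ ^ 2 := pow_le_pow_left₀ hr0 hx 2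
    obtain ⟨b1, b2⟩ := hn.2.2 (r ^ 2) hr2
    set f := F n (r ^ 2)
    set f' := deriv (F n) (r ^ 2)
    have hG := gradNormSq_nonneg U x
    have hN := matNormSq_nonneg (radialDeriv U k₀ x)
    have hN' := matNormSq_radialDeriv_le U k₀ x
    have hP : 0 ≤ (∑ i, entrySum (U.grad i x)) + 1 :=
      add_nonneg (Finset.sum_nonneg fun _ _ => entrySum_nonneg _) zero_le_one
    have hM : 0 ≤ M := (abs_nonneg _).trans b1
    have e1 : |f'| * r ^ 2 ≤ M * ρ ^ 2 := mul_le_mul b2 hr2 (by positivity) hM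
    have t1 : |((2 - d) * f - 2 * f' * r ^ 2) * gradNormSq U x|
        ≤ (d * M + 2 * (M * ρ ^ 2)) * gradNormSq U x := by
      rw [abs_mul, abs_of_nonneg hG]
      refine mul_le_mul_of_nonneg_right ((abs_sub _ _).trans (add_le_add ?_ ?_)) hG
      · rw [abs_mul, abs_of_nonpos hd0]
        exact mul_le_mul (by linarith) b1 (abs_nonneg _) (by positivity)
      · rw [abs_mul, abs_mul, abs_two, abs_of_nonneg (by positivity : 0 ≤ r ^ 2)]
        linarith
    have t2 : |4 * f' * r ^ 2 * matNormSq (radialDeriv U k₀ x)|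
        ≤ 4 * (M * ρ ^ 2) * gradNormSq U x := by
      rw [abs_mul, abs_of_nonneg hN]
      refine mul_le_mul ?_ hN' hN (by positivity)
      rw [abs_mul, abs_mul, abs_of_nonneg (by positivity : 0 ≤ r ^ 2),
        abs_of_nonneg (by norm_num : (0 : ℝ) ≤ 4)]
      linarith
    have t3 : |K * (((∑ i, entrySum (U.grad i x)) + 1) * (|f| * (1 + r) + 2 * |f'| * r ^ 2))|
        ≤ K * (((∑ i, entrySum (U.grad i x)) + 1) * (M * (1 + ρ) + 2 * M * ρ ^ 2)) := by
      rw [abs_of_nonneg (by positivity)]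
      refine mul_le_mul_of_nonneg_left (mul_le_mul_of_nonneg_left (add_le_add ?_ ?_) hP) hK
      · exact mul_le_mul b1 (by linarith) (by positivity) hM
      · linarith
    rw [Real.norm_eq_abs, radialIntegrand]
    refine (abs_add_three _ _ _).trans ?_
    linarith
  · refine Integrable.add ((U.integrableOn_gradNormSq hBc).const_mul _) (Integrable.const_mul ?_ K)
    refine Integrable.mul_const ?_ _
    exact (U.integrableOn_entrySum hBc).add (continuous_const.continuousOn.integrableOn_compact hBc)
  · filter_upwards [hsphere R₁ hR₁, hsphere R₂ (by linarith)] with x h1 h2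
    refine tendsto_const_nhds.congr' ?_
    filter_upwards [hF0 (‖x - k₀‖ ^ 2), hF1 (‖x - k₀‖ ^ 2) h1 h2] with n e1 e2
    rw [e1, e2]

/-! ### The monotonicity inequality -/

/-- The integral of `|x - k₀|^{1-d}` over balls. -/
theorem integral_ball_norm_inv_pow {n : ℕ} (k₀ : E (n + 2)) {R : ℝ} (hR : 0 ≤ R) :
    IntegrableOn (fun x => (‖x - k₀‖ ^ (n + 1))⁻¹) (Metric.ball k₀ R) ∧
      ∫ x in Metric.ball k₀ R, (‖x - k₀‖ ^ (n + 1))⁻¹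
        = (n + 2) * (volume : Measure (E (n + 2))).real (Metric.ball 0 1) * R := by
  let f : ℝ → ℝ := (Set.Iio R).indicator fun y => (y ^ (n + 1))⁻¹
  have hdim : Module.finrank ℝ (E (n + 2)) - 1 = n + 1 := by simp
  -- In polar coordinates the weight `y ^ (n + 1)` cancels the singularity, leaving the indicator of
  -- `y < R`.
  have hEq : Set.EqOn (fun y : ℝ => y ^ (Module.finrank ℝ (E (n + 2)) - 1) • f y)
      ((Set.Iio R).indicator fun _ => 1) (Set.Ioi 0) := by
    intro y hy
    have hy' : y ≠ 0 := ne_of_gt hy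
    by_cases h : y < R
    · simp only [f, Set.indicator_of_mem (Set.mem_Iio.2 h), hdim, smul_eq_mul]
      field_simp
    · simp only [f, Set.indicator_of_notMem (show y ∉ Set.Iio R from h), smul_zero]
  have hf : (fun x : E (n + 2) => (Metric.ball k₀ R).indicator
      (fun x => (‖x - k₀‖ ^ (n + 1))⁻¹) x) = fun x => f ‖x - k₀‖ := by
    funext x
    by_cases h : ‖x - k₀‖ < R
    · simp only [f, Set.indicator_of_mem (mem_ball_iff_norm.2 h),
        Set.indicator_of_mem (Set.mem_Iio.2 h)]
    · rw [Set.indicator_of_notMem (fun h' => h (mem_ball_iff_norm.1 h'))]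
      simp only [f, Set.indicator_of_notMem (show ‖x - k₀‖ ∉ Set.Iio R from h)]
  have hint : Integrable fun x : E (n + 2) => f ‖x‖ := by
    have : Nontrivial (E (n + 2)) := inferInstance
    rw [integrable_fun_norm_addHaar, integrableOn_congr_fun hEq measurableSet_Ioi]
    refine (integrable_indicator_iff measurableSet_Iio).2 ?_
    have : IntegrableOn (fun _ : ℝ => (1 : ℝ)) (Set.Ioo 0 R) := by simp
    rw [IntegrableOn, Measure.restrict_restrict measurableSet_Iio, Set.inter_comm,
      Set.Ioi_inter_Iio]
    exact this
  constructor
  · rw [← integrable_indicator_iff measurableSet_ball]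
    change Integrable fun x => (Metric.ball k₀ R).indicator (fun x => (‖x - k₀‖ ^ (n + 1))⁻¹) x
    rw [hf]
    exact hint.comp_sub_right k₀
  · rw [← integral_indicator measurableSet_ball, hf,
      integral_sub_right_eq_self (fun x : E (n + 2) => f ‖x‖) k₀, integral_fun_norm_addHaar,
      setIntegral_congr_fun measurableSet_Ioi hEq, setIntegral_indicator measurableSet_Iio,
      Set.Ioi_inter_Iio]
    simp [hR]
    ring

/-- The profile in terms of the squared radius. -/
def profile (n : ℕ) (Λ : ℝ) (u : ℝ) : ℝ := (√u ^ n)⁻¹ * (1 + Λ * √u) / n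

theorem contDiffAt_profile (n : ℕ) (Λ : ℝ) {u : ℝ} (hu : 0 < u) :
    ContDiffAt ℝ ∞ (profile n Λ) u := by
  have h1 : ContDiffAt ℝ ∞ (fun u : ℝ => √u) u := contDiffAt_id.sqrt hu.ne'
  have h2 : √u ^ n ≠ 0 := (pow_pos (Real.sqrt_pos.2 hu) n).ne'
  exact (((h1.pow n).inv h2).mul (contDiffAt_const.add (contDiffAt_const.mul h1))).div_const _

theorem profile_sq (n : ℕ) (Λ : ℝ) {r : ℝ} (hr : 0 ≤ r) :
    profile n Λ (r ^ 2) = (r ^ n)⁻¹ * (1 + Λ * r) / n := by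
  rw [profile, Real.sqrt_sq hr]

/-- The left side is `r d/dr` of the profile at `r ^ 2`, so the explicit formula in `r` can be
differentiated. -/
theorem deriv_profile_sq {n : ℕ} (hn : 1 ≤ n) (Λ : ℝ) {r : ℝ} (hr : 0 < r) :
    2 * deriv (profile n Λ) (r ^ 2) * r ^ 2 = -((r ^ n)⁻¹ * (1 + Λ * r - Λ * r / n)) := by
  have hn0 : (n : ℝ) ≠ 0 := by positivity
  have h1 : HasDerivAt (profile n Λ) (deriv (profile n Λ) (r ^ 2)) (r ^ 2) :=
    ((contDiffAt_profile n Λ (pow_pos hr 2)).differentiableAt (by simp)).hasDerivAt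
  have h2 : HasDerivAt (fun r : ℝ => profile n Λ (r ^ 2))
      (deriv (profile n Λ) (r ^ 2) * (2 * r)) r := by
    have h3 : HasDerivAt (fun r : ℝ => r ^ 2) (2 * r) r := by simpa using hasDerivAt_pow 2 r
    exact HasDerivAt.comp (h₂ := profile n Λ) (h := fun r : ℝ => r ^ 2) r h1 h3
  have h4 : HasDerivAt (fun r : ℝ => (r ^ n)⁻¹ * (1 + Λ * r) / n)
      ((-(n * r ^ (n - 1)) / (r ^ n) ^ 2 * (1 + Λ * r) + (r ^ n)⁻¹ * Λ) / n) r := by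
    have h5 : HasDerivAt (fun r : ℝ => 1 + Λ * r) Λ r := by
      simpa using ((hasDerivAt_id r).const_mul Λ).const_add 1
    exact (((hasDerivAt_pow n r).fun_inv (pow_pos hr n).ne').mul h5).div_const _
  have h6 : (fun r : ℝ => profile n Λ (r ^ 2)) =ᶠ[𝓝 r] fun r => (r ^ n)⁻¹ * (1 + Λ * r) / n := by
    filter_upwards [lt_mem_nhds hr] with t ht using profile_sq n Λ ht.le
  have h7 := h2.unique (h4.congr_of_eventuallyEq h6)
  obtain ⟨k, rfl⟩ : ∃ k, n = k + 1 := ⟨n - 1, by omega⟩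
  have h8 : 2 * deriv (profile (k + 1) Λ) (r ^ 2) * r ^ 2
      = deriv (profile (k + 1) Λ) (r ^ 2) * (2 * r) * r := by ring
  rw [h8, h7, Nat.add_sub_cancel]
  field_simp
  ring

/-- Monotonicity of `t ↦ t^{-n} (1 + Λ t)`. -/
theorem inv_pow_mul_antitone {n : ℕ} (hn : 1 ≤ n) {Λ s t : ℝ} (hΛ : 0 ≤ Λ) (hs : 0 < s)
    (hst : s ≤ t) : (t ^ n)⁻¹ * (1 + Λ * t) ≤ (s ^ n)⁻¹ * (1 + Λ * s) := by
  have ht : 0 < t := hs.trans_le hst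
  have key : ∀ u : ℝ, 0 < u → (u ^ n)⁻¹ * (1 + Λ * u) = (u ^ n)⁻¹ + Λ * (u ^ (n - 1))⁻¹ := by
    intro u hu
    obtain ⟨k, rfl⟩ : ∃ k, n = k + 1 := ⟨n - 1, by omega⟩
    rw [Nat.add_sub_cancel]
    field_simp
    ring
  rw [key t ht, key s hs]
  gcongr

section
variable {d m : ℕ} {γ : Module.Basis (Fin d) ℝ (E d)} (U : SobolevMap γ m)

/-- Young's inequality on each of the `d m²` entries; the summand `1` is absorbed since `t ≤ 1`. It
is used with `t = r` on the shell and `t = R₁` inside. -/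
theorem sum_entrySum_add_one_le {t : ℝ} (ht : 0 < t) (ht1 : t ≤ 1) (x : E d) :
    (∑ i, entrySum (U.grad i x)) + 1 ≤ t * gradNormSq U x + (d * m ^ 2 + 1) / t := by
  have h1 : ∀ z : ℂ, ‖z‖ ≤ t * ‖z‖ ^ 2 + 1 / t := by
    intro z
    have h := sq_nonneg (t * ‖z‖ - 1)
    have h0 : 0 ≤ t * ‖z‖ := mul_nonneg ht.le (norm_nonneg _)
    have e : t * ‖z‖ ^ 2 + 1 / t = ((t * ‖z‖) ^ 2 + 1) / t := by field_simp
    rw [e, le_div_iff₀ ht]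
    nlinarith
  have h2 : ∀ i, entrySum (U.grad i x) ≤ t * matNormSq (U.grad i x) + m ^ 2 * (1 / t) := by
    intro i
    rw [matNormSq_eq, Finset.sum_comm]
    calc _ ≤ ∑ a, ∑ b, (t * ‖U.grad i x a b‖ ^ 2 + 1 / t) :=
          Finset.sum_le_sum fun a _ => Finset.sum_le_sum fun b _ => h1 _
      _ = _ := by
          simp only [Finset.sum_add_distrib, ← Finset.mul_sum]
          simp; ring
  have h3 : ∑ i, entrySum (U.grad i x) ≤ t * gradNormSq U x + d * (m ^ 2 * (1 / t)) := by
    calc _ ≤ ∑ i, (t * matNormSq (U.grad i x) + m ^ 2 * (1 / t)) :=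
          Finset.sum_le_sum fun i _ => h2 i
      _ = _ := by
          rw [Finset.sum_add_distrib, ← Finset.mul_sum]
          simp [gradNormSq]
  have h4 : 1 ≤ 1 / t := by rw [le_div_iff₀ ht]; linarith
  have h5 : (d * m ^ 2 + 1) / t = d * (m ^ 2 * (1 / t)) + 1 / t := by ring
  rw [h5]
  linarith

end

/-- The algebra behind the monotonicity inequality on the shell. -/
theorem shell_integrand_le {n : ℕ} (hn : 1 ≤ n) {K Λ r w W f g G N Q c : ℝ} (hK : 0 ≤ K)
    (hΛ : Λ = 6 * K * n) (hr : 0 < r) (hr1 : r ≤ 1) (hΛr : Λ * r ≤ 1) (hw : 0 < w)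
    (hf : n * f = w * (1 + Λ * r) - W) (hf0 : 0 ≤ f) (hW : 0 ≤ W)
    (hg : 2 * g * r ^ 2 = -(w * (1 + Λ * r - Λ * r / n))) (hN : 0 ≤ N)
    (hQ : Q ≤ r * G + c / r) (hQ0 : 0 ≤ Q) :
    (-n * f - 2 * g * r ^ 2) * G + 4 * g * r ^ 2 * N
      + K * (Q * (|f| * (1 + r) + 2 * |g| * r ^ 2))
      ≤ W * G - 2 * (N * w) + 6 * K * c * (w / r) := by
  have hn1 : (1 : ℝ) ≤ n := by exact_mod_cast hn
  have hn0 : (0 : ℝ) < n := by linarith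
  have hΛ0 : 0 ≤ Λ * r := by rw [hΛ]; positivity
  have hβ1 : Λ * r / n ≤ Λ * r := div_le_self hΛ0 hn1
  have hβ0 : 0 ≤ Λ * r / n := by positivity
  set β := 1 + Λ * r - Λ * r / n with hβ
  have hβl : 1 ≤ β := by linarith
  have hβu : β ≤ 2 := by linarith
  have hgneg : g ≤ 0 := by
    by_contra! h
    have h1 : 0 < 2 * g * r ^ 2 := by positivity
    rw [hg] at h1
    have h2 : 0 < w * β := by positivity
    linarith
  have hfw : f ≤ 2 * w := by
    have h1 : n * f ≤ 2 * w := by rw [hf]; nlinarith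
    nlinarith
  -- At most `4w` from the profile and `2w` from its derivative: this is the `6` in `Λ = 6 K n`.
  have hsum : |f| * (1 + r) + 2 * |g| * r ^ 2 ≤ 6 * w := by
    rw [abs_of_nonneg hf0, abs_of_nonpos hgneg]
    have h1 : f * (1 + r) ≤ 2 * w * 2 := mul_le_mul hfw (by linarith) (by linarith) (by linarith)
    have h2 : 2 * -g * r ^ 2 = w * β := by linarith
    have h3 : w * β ≤ w * 2 := mul_le_mul_of_nonneg_left hβu hw.le
    linarith
  have h4 : K * (Q * (|f| * (1 + r) + 2 * |g| * r ^ 2)) ≤ K * ((r * G + c / r) * (6 * w)) := by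
    refine mul_le_mul_of_nonneg_left ?_ hK
    exact mul_le_mul hQ hsum (by positivity) (hQ0.trans hQ)
  -- The terms `w (1 + Λ r)` cancel, and the surviving `-Λ r w / n = -6 K w r` exactly offsets the
  -- gradient part of the error in `h8`.
  have h5 : -n * f - 2 * g * r ^ 2 = W - 6 * K * (w * r) := by
    rw [neg_mul, hf, hg, hβ]
    have : Λ * r / n = 6 * K * r := by rw [hΛ]; field_simp
    rw [this]; ring
  have h6 : 4 * g * r ^ 2 * N ≤ -2 * (N * w) := by
    have e : 4 * g * r ^ 2 * N = -2 * (N * (w * β)) := by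
      have : 4 * g * r ^ 2 = -2 * (w * β) := by linarith
      rw [this]; ring
    have h7 : N * w ≤ N * (w * β) :=
      mul_le_mul_of_nonneg_left (le_mul_of_one_le_right hw.le hβl) hN
    rw [e]; linarith
  have h8 : K * ((r * G + c / r) * (6 * w)) = 6 * K * (w * r) * G + 6 * K * c * (w / r) := by ring
  rw [h5]
  linarith

/-- The algebra behind the monotonicity inequality on the inner ball. -/
theorem inner_integrand_le {n : ℕ} (hn : 1 ≤ n) {K Λ r R w W f G Q c : ℝ} (hK : 0 ≤ K)
    (hΛ : Λ = 6 * K * n) (hr : 0 ≤ r) (hrR : r ≤ R) (hR : 0 < R) (hR1 : R ≤ 1)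
    (hΛR : Λ * R ≤ 1) (hw : 0 < w) (hf : n * f = w * (1 + Λ * R) - W) (hf0 : 0 ≤ f) (hW : 0 ≤ W)
    (hG : 0 ≤ G) (hQ : Q ≤ R * G + c / R) (hQ0 : 0 ≤ Q) :
    -n * f * G + K * (Q * (|f| * (1 + r))) ≤ (W - w) * G + 6 * K * c * (w / R) := by
  have hn1 : (1 : ℝ) ≤ n := by exact_mod_cast hn
  have hfw : f ≤ 2 * w := by
    have h1 : n * f ≤ 2 * w := by rw [hf]; nlinarith
    nlinarith
  have hsum : |f| * (1 + r) ≤ 6 * w := by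
    rw [abs_of_nonneg hf0]
    have h1 : f * (1 + r) ≤ 2 * w * 2 := mul_le_mul hfw (by linarith) (by linarith) (by linarith)
    linarith
  have h4 : K * (Q * (|f| * (1 + r))) ≤ K * ((R * G + c / R) * (6 * w)) := by
    refine mul_le_mul_of_nonneg_left ?_ hK
    exact mul_le_mul hQ hsum (by positivity) (hQ0.trans hQ)
  have h5 : -n * f * G = (W - w) * G - Λ * (w * R) * G := by
    rw [neg_mul, hf]; ring
  -- The profile is constant here, so all of `Λ` is available for absorption, and `Λ ≥ 6 K` because
  -- `n ≥ 1`.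
  have h6 : 6 * K * (w * R) * G ≤ Λ * (w * R) * G := by
    have : 6 * K ≤ Λ := by rw [hΛ]; exact le_mul_of_one_le_right (by positivity) hn1
    have h0 : 0 ≤ w * R * G := by positivity
    nlinarith
  have h8 : K * ((R * G + c / R) * (6 * w)) = 6 * K * (w * R) * G + 6 * K * c * (w / R) := by ring
  linarith

theorem zpow_two_sub (n : ℕ) (r : ℝ) : r ^ (2 - ((n + 2 : ℕ) : ℤ)) = (r ^ n)⁻¹ := by
  have : (2 - ((n + 2 : ℕ) : ℤ)) = -(n : ℤ) := by push_cast; ring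
  rw [this, zpow_neg, zpow_natCast]

section
variable {d m : ℕ} {γ : Module.Basis (Fin d) ℝ (E d)} (U : SobolevMap γ m)

theorem radialDensity_nonneg (k₀ x : E d) : 0 ≤ radialDensity U k₀ x :=
  mul_nonneg (matNormSq_nonneg _) (zpow_nonneg (norm_nonneg _) _)

theorem scaledEnergy_nonneg (k₀ : E d) {R : ℝ} (hR : 0 ≤ R) : 0 ≤ scaledEnergy U k₀ R :=
  mul_nonneg (zpow_nonneg hR _) (integral_nonneg fun x => gradNormSq_nonneg U x)

end

theorem measurableSet_shell {d : ℕ} (k₀ : E d) (R₁ R₂ : ℝ) :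
    MeasurableSet {k : E d | R₁ < ‖k - k₀‖ ∧ ‖k - k₀‖ < R₂} := by
  have hc : Continuous fun x : E d => ‖x - k₀‖ := (continuous_id.sub continuous_const).norm
  exact ((isOpen_lt continuous_const hc).inter (isOpen_lt hc continuous_const)).measurableSet

section
variable {n m : ℕ} {γ : Module.Basis (Fin (n + 2)) ℝ (E (n + 2))} (U : SobolevMap γ m)

/-- Away from the center, the radial density is integrable. -/
theorem integrableOn_radialDensity_diff (k₀ : E (n + 2)) {r R : ℝ} (hr : 0 < r) :
    IntegrableOn (radialDensity U k₀) {k | r < ‖k - k₀‖ ∧ ‖k - k₀‖ < R} := by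
  have hBc : IsCompact (Metric.closedBall k₀ R) := isCompact_closedBall k₀ R
  have hsub : {k | r < ‖k - k₀‖ ∧ ‖k - k₀‖ < R} ⊆ Metric.closedBall k₀ R := fun k hk =>
    mem_closedBall_iff_norm.2 hk.2.le
  have hi := ((integrableOn_matNormSq_radialDeriv U k₀ hBc).mono_set hsub).mul_const (r ^ n)⁻¹
  have hz : Measurable fun x : E (n + 2) => (‖x - k₀‖ ^ n)⁻¹ := by fun_prop
  refine Integrable.mono' hi ?_ ?_
  · have h1 := (aestronglyMeasurable_matNormSq_radialDeriv U k₀ hBc).mono_set hsub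
    have h2 := h1.mul (hz.aestronglyMeasurable
      (μ := volume.restrict {k | r < ‖k - k₀‖ ∧ ‖k - k₀‖ < R}))
    refine h2.congr (Eventually.of_forall fun x => ?_)
    simp only [Pi.mul_apply, radialDensity, zpow_two_sub]
  · filter_upwards [ae_restrict_mem (measurableSet_shell k₀ r R)] with x hx
    rw [Real.norm_of_nonneg (radialDensity_nonneg U k₀ x), radialDensity, zpow_two_sub]
    refine mul_le_mul_of_nonneg_left ?_ (matNormSq_nonneg _)
    exact inv_anti₀ (pow_pos hr n) (pow_le_pow_left₀ hr.le hx.1.le n)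

/-- The monotonicity inequality. -/
theorem scaledEnergy_monotonicity (hn : 1 ≤ n) {K Λ ρ : ℝ} (hK : 0 ≤ K) (hΛ : Λ = 6 * K * n)
    {k₀ : E (n + 2)}
    (h : ∀ X : E (n + 2) → E (n + 2), ContDiff ℝ ∞ X →
      (∀ x ∉ Metric.closedBall k₀ ρ, X x = 0) →
      0 ≤ (∫ x in Metric.closedBall k₀ ρ, stress (fderiv ℝ X x) fun i => U.grad i x)
        + K * ∫ x in Metric.closedBall k₀ ρ,
          ((∑ i, entrySum (U.grad i x)) + 1) * (‖fderiv ℝ X x‖ + ‖X x‖))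
    {R₁ R₂ : ℝ} (hR₁ : 0 < R₁) (hR : R₁ < R₂) (hρ : R₂ < ρ) (hR₂ : R₂ ≤ 1) (hΛR : Λ * R₂ ≤ 1) :
    scaledEnergy U k₀ R₁ + ∫ k in {k | R₁ < ‖k - k₀‖ ∧ ‖k - k₀‖ < R₂}, 2 * radialDensity U k₀ k
      ≤ (1 + Λ * R₂) * scaledEnergy U k₀ R₂ + 6 * K * ((n + 2) * m ^ 2 + 1)
        * ((n + 2) * (volume : Measure (E (n + 2))).real (Metric.ball 0 1) * R₂) := by
  have hR₂0 : 0 < R₂ := hR₁.trans hR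
  have hn0 : (0 : ℝ) < n := by exact_mod_cast hn
  have hΛ0 : 0 ≤ Λ := by rw [hΛ]; positivity
  set B := Metric.closedBall k₀ ρ with hB
  set S : Set (E (n + 2)) := {k | R₁ < ‖k - k₀‖ ∧ ‖k - k₀‖ < R₂} with hS
  have hBc : IsCompact B := isCompact_closedBall k₀ ρ
  obtain ⟨hint, hpos⟩ := integral_radialIntegrand_truncated_nonneg (by omega) U hK h
    (Z := profile n Λ) (fun u hu => contDiffAt_profile n Λ hu) hR₁ hR hρ
  set W := (R₂ ^ n)⁻¹ * (1 + Λ * R₂) with hW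
  set c : ℝ := ((n + 2 : ℕ) : ℝ) * m ^ 2 + 1 with hc
  have hW0 : 0 ≤ W := by positivity
  have hc0 : 0 ≤ c := by positivity
  have hball₂ : Metric.ball k₀ R₂ ⊆ B :=
    (Metric.ball_subset_ball hρ.le).trans Metric.ball_subset_closedBall
  have hball₁ : Metric.ball k₀ R₁ ⊆ B := (Metric.ball_subset_ball hR.le).trans hball₂
  have hshell : S ⊆ B := fun x hx => hball₂ (mem_ball_iff_norm.2 hx.2)
  obtain ⟨hpow, hpow'⟩ := integral_ball_norm_inv_pow k₀ hR₂0.le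
  have hG := U.integrableOn_gradNormSq hBc
  have j1 : IntegrableOn (fun x => W * gradNormSq U x + 6 * K * c * (‖x - k₀‖ ^ (n + 1))⁻¹)
      (Metric.ball k₀ R₂) := ((hG.mono_set hball₂).const_mul W).add (hpow.const_mul _)
  have j2 : IntegrableOn (fun x => (R₁ ^ n)⁻¹ * gradNormSq U x) (Metric.ball k₀ R₁) :=
    (hG.mono_set hball₁).const_mul _
  have j3 : IntegrableOn (fun x => 2 * radialDensity U k₀ x) S :=
    (integrableOn_radialDensity_diff U k₀ hR₁).const_mul 2
  have k1 := (j1.integrable_indicator measurableSet_ball).integrableOn (s := B)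
  have k2 := (j2.integrable_indicator measurableSet_ball).integrableOn (s := B)
  have k3 := (j3.integrable_indicator (measurableSet_shell k₀ R₁ R₂)).integrableOn (s := B)
  have hne : ∀ᵐ x ∂volume.restrict B, x ≠ k₀ := ae_restrict_of_ae (by
    filter_upwards [measure_eq_zero_iff_ae_notMem.1
      (measure_singleton (μ := (volume : Measure (E (n + 2)))) k₀)] with x hx using hx)
  -- A pointwise comparison on shell, inner ball and exterior; its integral is the claimed
  -- inequality. The center itself is excluded as a null set.
  have hle : ∀ᵐ x ∂volume.restrict B, radialIntegrand U K k₀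
      (profile n Λ (min (max (‖x - k₀‖ ^ 2) (R₁ ^ 2)) (R₂ ^ 2)) - profile n Λ (R₂ ^ 2))
      (if R₁ ^ 2 < ‖x - k₀‖ ^ 2 ∧ ‖x - k₀‖ ^ 2 < R₂ ^ 2 then
        deriv (profile n Λ) (‖x - k₀‖ ^ 2) else 0) x
      ≤ (Metric.ball k₀ R₂).indicator
          (fun x => W * gradNormSq U x + 6 * K * c * (‖x - k₀‖ ^ (n + 1))⁻¹) x
        - (Metric.ball k₀ R₁).indicator (fun x => (R₁ ^ n)⁻¹ * gradNormSq U x) x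
        - S.indicator (fun x => 2 * radialDensity U k₀ x) x := by
    filter_upwards [hne] with x hx
    set r := ‖x - k₀‖ with hr
    have hr0 : 0 < r := norm_pos_iff.2 (sub_ne_zero.2 hx)
    have hGx := gradNormSq_nonneg U x
    have hN := matNormSq_nonneg (radialDeriv U k₀ x)
    have hQ0 : 0 ≤ (∑ i, entrySum (U.grad i x)) + 1 :=
      add_nonneg (Finset.sum_nonneg fun _ _ => entrySum_nonneg _) zero_le_one
    have hcoef : (2 : ℝ) - ((n + 2 : ℕ) : ℝ) = -n := by push_cast; ring
    have hsq : ∀ s t : ℝ, 0 ≤ s → 0 ≤ t → (s ^ 2 ≤ t ^ 2 ↔ s ≤ t) := fun s t hs ht =>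
      pow_le_pow_iff_left₀ hs ht two_ne_zero
    have hsq' : ∀ s t : ℝ, 0 ≤ s → 0 ≤ t → (s ^ 2 < t ^ 2 ↔ s < t) := fun s t hs ht =>
      pow_lt_pow_iff_left₀ hs ht two_ne_zero
    have hprof : ∀ t : ℝ, 0 < t → t ≤ R₂ →
        n * (profile n Λ (t ^ 2) - profile n Λ (R₂ ^ 2)) = (t ^ n)⁻¹ * (1 + Λ * t) - W ∧
        0 ≤ profile n Λ (t ^ 2) - profile n Λ (R₂ ^ 2) := by
      intro t ht htR
      have e : n * (profile n Λ (t ^ 2) - profile n Λ (R₂ ^ 2)) = (t ^ n)⁻¹ * (1 + Λ * t) - W := by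
        rw [profile_sq n Λ ht.le, profile_sq n Λ hR₂0.le, hW]
        field_simp
      refine ⟨e, ?_⟩
      have h1 := inv_pow_mul_antitone hn hΛ0 ht htR
      refine nonneg_of_mul_nonneg_right (a := (n : ℝ)) ?_ hn0
      rw [e]; linarith
    simp only [hsq' R₁ r hR₁.le hr0.le, hsq' r R₂ hr0.le hR₂0.le]
    unfold radialIntegrand
    rw [hcoef, ← hr]
    rcases lt_or_ge r R₂ with hrR₂ | hrR₂
    · rw [Set.indicator_of_mem (mem_ball_iff_norm.2 hrR₂)]
      rcases lt_or_ge R₁ r with hrR₁ | hrR₁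
      · have e1 : x ∉ Metric.ball k₀ R₁ := fun h' => by
          have := mem_ball_iff_norm.1 h'
          linarith
        have e2 : min (max (r ^ 2) (R₁ ^ 2)) (R₂ ^ 2) = r ^ 2 := by
          rw [max_eq_left ((hsq _ _ hR₁.le hr0.le).2 hrR₁.le),
            min_eq_left ((hsq _ _ hr0.le hR₂0.le).2 hrR₂.le)]
        rw [Set.indicator_of_notMem e1, Set.indicator_of_mem (show x ∈ S from ⟨hrR₁, hrR₂⟩),
          if_pos ⟨hrR₁, hrR₂⟩, e2]
        obtain ⟨p1, p2⟩ := hprof r hr0 hrR₂.le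
        have hΛr : Λ * r ≤ 1 := (mul_le_mul_of_nonneg_left hrR₂.le hΛ0).trans hΛR
        have := shell_integrand_le hn hK hΛ hr0 (by linarith) hΛr
          (inv_pos.2 (pow_pos hr0 n)) p1 p2 hW0 (deriv_profile_sq hn Λ hr0) hN
          (G := gradNormSq U x) (sum_entrySum_add_one_le U hr0 (by linarith) x) hQ0
        refine this.trans (le_of_eq ?_)
        rw [radialDensity, zpow_two_sub, ← hr, pow_succ r, mul_inv, div_eq_mul_inv]
        ring
      · have e2 : min (max (r ^ 2) (R₁ ^ 2)) (R₂ ^ 2) = R₁ ^ 2 := by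
          rw [max_eq_right ((hsq _ _ hr0.le hR₁.le).2 hrR₁),
            min_eq_left ((hsq _ _ hR₁.le hR₂0.le).2 hR.le)]
        have e3 : x ∉ S := fun h' => by
          have := h'.1
          linarith
        rw [Set.indicator_of_notMem e3, if_neg (by intro h'; linarith [h'.1]), e2]
        obtain ⟨p1, p2⟩ := hprof R₁ hR₁ hR.le
        have hΛr : Λ * R₁ ≤ 1 := (mul_le_mul_of_nonneg_left hR.le hΛ0).trans hΛR
        have h1 := inner_integrand_le hn hK hΛ hr0.le hrR₁ hR₁ (by linarith) hΛr
          (inv_pos.2 (pow_pos hR₁ n)) p1 p2 hW0 hGx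
          (sum_entrySum_add_one_le U hR₁ (by linarith) x) hQ0
        -- Since `r ≤ R₁`, the constant error inside is dominated by the same singular weight as on
        -- the shell, so one integral over the large ball covers both.
        have h2 : (R₁ ^ n)⁻¹ / R₁ ≤ (r ^ (n + 1))⁻¹ := by
          rw [div_eq_mul_inv, ← mul_inv, ← pow_succ]
          exact inv_anti₀ (pow_pos hr0 _) (pow_le_pow_left₀ hr0.le hrR₁ _)
        have h3 : 6 * K * c * ((R₁ ^ n)⁻¹ / R₁) ≤ 6 * K * c * (r ^ (n + 1))⁻¹ :=
          mul_le_mul_of_nonneg_left h2 (by positivity)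
        have h4 : (Metric.ball k₀ R₁).indicator (fun x => (R₁ ^ n)⁻¹ * gradNormSq U x) x
            ≤ (R₁ ^ n)⁻¹ * gradNormSq U x :=
          Set.indicator_le_self'
            (fun y _ => mul_nonneg (inv_pos.2 (pow_pos hR₁ n)).le (gradNormSq_nonneg U y)) x
        simp only [mul_zero, zero_mul, sub_zero, add_zero, abs_zero]
        linarith
    · have e0 : x ∉ Metric.ball k₀ R₂ := fun h' => by
        have := mem_ball_iff_norm.1 h'
        linarith
      have e1 : x ∉ Metric.ball k₀ R₁ := fun h' => e0 (Metric.ball_subset_ball hR.le h')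
      have e3 : x ∉ S := fun h' => by
        have := h'.2
        linarith
      have e2 : min (max (r ^ 2) (R₁ ^ 2)) (R₂ ^ 2) = R₂ ^ 2 :=
        min_eq_right (((hsq _ _ hR₂0.le hr0.le).2 hrR₂).trans (le_max_left _ _))
      rw [Set.indicator_of_notMem e0, Set.indicator_of_notMem e1, Set.indicator_of_notMem e3,
        if_neg (by intro h'; linarith [h'.2]), e2]
      simp
  have hfin := hpos.trans (integral_mono_ae hint ((k1.sub k2).sub k3) hle)
  have e : ∫ x in B, ((Metric.ball k₀ R₂).indicator
          (fun x => W * gradNormSq U x + 6 * K * c * (‖x - k₀‖ ^ (n + 1))⁻¹) x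
        - (Metric.ball k₀ R₁).indicator (fun x => (R₁ ^ n)⁻¹ * gradNormSq U x) x
        - S.indicator (fun x => 2 * radialDensity U k₀ x) x)
      = W * (∫ x in Metric.ball k₀ R₂, gradNormSq U x)
        + 6 * K * c * ((n + 2) * (volume : Measure (E (n + 2))).real (Metric.ball 0 1) * R₂)
        - (R₁ ^ n)⁻¹ * (∫ x in Metric.ball k₀ R₁, gradNormSq U x)
        - ∫ x in S, 2 * radialDensity U k₀ x := by
    refine (integral_sub (k1.sub k2) k3).trans ?_
    have s : ∫ x in B, ((Metric.ball k₀ R₂).indicator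
          (fun x => W * gradNormSq U x + 6 * K * c * (‖x - k₀‖ ^ (n + 1))⁻¹)
        - (Metric.ball k₀ R₁).indicator (fun x => (R₁ ^ n)⁻¹ * gradNormSq U x)) x
        = _ - _ := integral_sub k1 k2
    rw [s,
      setIntegral_indicator measurableSet_ball, setIntegral_indicator measurableSet_ball,
      setIntegral_indicator (measurableSet_shell k₀ R₁ R₂), Set.inter_eq_right.2 hball₂,
      Set.inter_eq_right.2 hball₁, Set.inter_eq_right.2 hshell,
      integral_add ((hG.mono_set hball₂).const_mul W) (hpow.const_mul _), integral_const_mul,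
      integral_const_mul, integral_const_mul, hpow']
  have hfin' := hfin.trans (le_of_eq e)
  unfold scaledEnergy
  rw [zpow_two_sub, zpow_two_sub]
  have hc' : c = (n + 2) * m ^ 2 + 1 := by rw [hc]; push_cast; ring
  rw [← hc']
  have : (1 + Λ * R₂) * ((R₂ ^ n)⁻¹ * ∫ k in Metric.ball k₀ R₂, gradNormSq U k)
      = W * ∫ k in Metric.ball k₀ R₂, gradNormSq U k := by rw [hW]; ring
  rw [this]
  linarith

end

/-! ### Passage to small radii -/

/-- A nonnegative function that is increasing up to an error vanishing at the origin has a limit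
there. -/
theorem exists_tendsto_of_almost_monotone {f : ℝ → ℝ} {a r : ℝ} (ha : 0 ≤ a) (hr : 0 < r)
    (hf : ∀ x, 0 < x → 0 ≤ f x)
    (h : ∀ x y, 0 < x → x ≤ y → y ≤ r → f x ≤ a * y + (1 + a * y) * f y) :
    ∃ L, Tendsto f (𝓝[>] 0) (𝓝 L) := by
  set B := a * r + (1 + a * r) * f r with hB
  have hfB : ∀ x, 0 < x → x ≤ r → f x ≤ B := fun x hx hxr => h x r hx hxr le_rfl
  have hev : ∀ y : ℝ, 0 < y → ∀ᶠ x in 𝓝[>] (0 : ℝ), 0 < x ∧ x ≤ y := fun y hy =>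
    mem_of_superset (Ioc_mem_nhdsGT hy) fun x hx => hx
  have hbdd : IsBoundedUnder (· ≤ ·) (𝓝[>] 0) f :=
    isBoundedUnder_of_eventually_le ((hev r hr).mono fun x hx => hfB x hx.1 hx.2)
  have hcobdd : IsCoboundedUnder (· ≤ ·) (𝓝[>] 0) f :=
    (isBoundedUnder_of_eventually_ge ((hev r hr).mono fun x hx => hf x hx.1)).isCoboundedUnder_le
  refine ⟨limsup f (𝓝[>] 0), tendsto_order.2 ⟨fun b hb => ?_, fun b hb =>
    eventually_lt_of_limsup_lt hb hbdd⟩⟩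
  -- Taking the limsup in the smaller variable bounds it by the value at `y` plus an error; the
  -- uniform bound `B` turns the multiplicative error into an additive one linear in `y`.
  have hlow : ∀ y, 0 < y → y ≤ r → limsup f (𝓝[>] 0) - a * (1 + B) * y ≤ f y := by
    intro y hy hyr
    have h1 : limsup f (𝓝[>] 0) ≤ a * y + (1 + a * y) * f y :=
      limsup_le_of_le hcobdd ((hev y hy).mono fun x hx => h x y hx.1 hx.2 hyr)
    have h2 : a * y * f y ≤ a * y * B :=
      mul_le_mul_of_nonneg_left (hfB y hy hyr) (mul_nonneg ha hy.le)
    linarith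
  have hlim : Tendsto (fun y : ℝ => limsup f (𝓝[>] 0) - a * (1 + B) * y) (𝓝[>] 0)
      (𝓝 (limsup f (𝓝[>] 0))) := by
    have : Continuous fun y : ℝ => limsup f (𝓝[>] 0) - a * (1 + B) * y := by fun_prop
    simpa using (this.tendsto 0).mono_left nhdsWithin_le_nhds
  filter_upwards [hlim.eventually_const_lt hb, hev r hr] with y h1 h2
  exact h1.trans_le (hlow y h2.1 h2.2)

section
variable {n m : ℕ} {γ : Module.Basis (Fin (n + 2)) ℝ (E (n + 2))} (U : SobolevMap γ m)

/-- If the radial energy of the shells around `k₀` is bounded, the radial density is integrable near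
`k₀`. -/
theorem integrableOn_radialDensity_ball_of_bounded (k₀ : E (n + 2)) {R I : ℝ}
    (h : ∀ r, 0 < r → ∫ k in {k | r < ‖k - k₀‖ ∧ ‖k - k₀‖ < R}, radialDensity U k₀ k ≤ I) :
    IntegrableOn (radialDensity U k₀) (Metric.ball k₀ R) := by
  have hpos : ∀ i : ℕ, (0 : ℝ) < 1 / ((i : ℝ) + 1) := fun i => by positivity
  have hsub : ∀ r : ℝ, {k : E (n + 2) | r < ‖k - k₀‖ ∧ ‖k - k₀‖ < R} ⊆ Metric.ball k₀ R :=
    fun r k hk => mem_ball_iff_norm.2 hk.2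
  -- The shells with inner radius `1 / (i + 1)` exhaust the ball up to its center, so bounded
  -- integrals of a nonnegative function imply integrability.
  have hcover : AECover (volume.restrict (Metric.ball k₀ R)) atTop
      fun i : ℕ => {k : E (n + 2) | 1 / ((i : ℝ) + 1) < ‖k - k₀‖ ∧ ‖k - k₀‖ < R} := by
    refine ⟨?_, fun i => measurableSet_shell k₀ _ R⟩
    filter_upwards [ae_restrict_mem measurableSet_ball, ae_restrict_of_ae
      (measure_eq_zero_iff_ae_notMem.1
        (measure_singleton (μ := (volume : Measure (E (n + 2)))) k₀))] with x hx hx0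
    filter_upwards [(tendsto_one_div_add_atTop_nhds_zero_nat (𝕜 := ℝ)).eventually_lt_const
      (norm_pos_iff.2 (sub_ne_zero.2 hx0))] with i hi
    exact ⟨hi, mem_ball_iff_norm.1 hx⟩
  refine hcover.integrable_of_integral_bounded_of_nonneg_ae I
    (fun i => (integrableOn_radialDensity_diff U k₀ (hpos i)).mono_measure
      Measure.restrict_le_self)
    (Eventually.of_forall fun x => radialDensity_nonneg U k₀ x)
    (Eventually.of_forall fun i => ?_)
  rw [Measure.restrict_restrict_of_subset (hsub _)]
  exact h _ (hpos i)

/-- Integrability of the radial density near `k₀` implies integrability on all balls. -/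
theorem integrableOn_radialDensity_ball_of_pos (k₀ : E (n + 2)) {r : ℝ} (hr : 0 < r)
    (h : IntegrableOn (radialDensity U k₀) (Metric.ball k₀ r)) (R : ℝ) :
    IntegrableOn (radialDensity U k₀) (Metric.ball k₀ R) := by
  refine (h.union (integrableOn_radialDensity_diff U k₀ (R := R) (half_pos hr))).mono_set
    fun x hx => ?_
  rcases lt_or_ge ‖x - k₀‖ r with hxr | hxr
  · exact Or.inl (mem_ball_iff_norm.2 hxr)
  · exact Or.inr ⟨by linarith, mem_ball_iff_norm.1 hx⟩

end

/-- The integral of an integrable function over small balls tends to zero. -/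
theorem tendsto_setIntegral_ball_zero {d : ℕ} (hd : d ≠ 0) {f : E d → ℝ} {k₀ : E d} {r : ℝ}
    (hr : 0 < r) (hf : IntegrableOn f (Metric.ball k₀ r)) :
    Tendsto (fun R => ∫ k in Metric.ball k₀ R, f k) (𝓝[>] 0) (𝓝 0) := by
  have hvol : Tendsto (fun R : ℝ => (volume : Measure (E d)) (Metric.ball k₀ R))
      (𝓝[>] 0) (𝓝 0) := by
    have h0 : Tendsto (fun R : ℝ => ENNReal.ofReal (R ^ d)) (𝓝[>] 0) (𝓝 0) := by
      have : Continuous fun R : ℝ => ENNReal.ofReal (R ^ d) :=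
        ENNReal.continuous_ofReal.comp (continuous_pow d)
      simpa [hd] using (this.tendsto 0).mono_left nhdsWithin_le_nhds
    have h1 := ENNReal.Tendsto.mul_const (b := (volume : Measure (E d)) (Metric.ball 0 1)) h0
      (Or.inr measure_ball_lt_top.ne)
    rw [zero_mul] at h1
    refine h1.congr' ?_
    filter_upwards [self_mem_nhdsWithin] with R hR
    rw [Measure.addHaar_ball_of_pos _ _ hR, finrank_euclideanSpace_fin]
  have hvol' : Tendsto (volume.restrict (Metric.ball k₀ r) ∘ fun R : ℝ => Metric.ball k₀ R)
      (𝓝[>] 0) (𝓝 0) :=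
    tendsto_of_tendsto_of_tendsto_of_le_of_le tendsto_const_nhds hvol (fun _ => zero_le)
      fun R => Measure.restrict_apply_le _ _
  refine (Integrable.tendsto_setIntegral_nhds_zero hf hvol').congr' ?_
  filter_upwards [Ioc_mem_nhdsGT hr] with R hR
  rw [Measure.restrict_restrict_of_subset (Metric.ball_subset_ball hR.2)]

/-- The monotonicity inequality for minimizers, with constants independent of the center. -/
theorem exists_monotonicity_constants {n m : ℕ} (hn : 1 ≤ n)
    {γ : Module.Basis (Fin (n + 2)) ℝ (E (n + 2))} {χ : Fin m → E (n + 2) → Hf γ}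
    (hτ : ∀ a, MemHTau γ (χ a)) (hs : ∀ a, ContDiff ℝ ∞ (χ a)) {c : ℝ} (hc : 0 < c)
    {U : SobolevMap γ m} (hU : IsMinimizer c χ U) :
    ∃ C R' : ℝ, 0 < C ∧ 0 < R' ∧ ∀ (k₀ : E (n + 2)) (R₁ R₂ : ℝ), 0 < R₁ → R₁ ≤ R₂ → R₂ ≤ R' →
      scaledEnergy U k₀ R₁
          + ∫ k in {k | R₁ < ‖k - k₀‖ ∧ ‖k - k₀‖ < R₂}, 2 * radialDensity U k₀ k
        ≤ 2 * C * R₂ + (1 + 2 * C * R₂) * scaledEnergy U k₀ R₂ := by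
  obtain ⟨ρ, hρ, hsep, hcell⟩ := exists_separation_radius γ
  obtain ⟨K, hK, h⟩ := exists_first_variation_bound hτ hs hc hU hρ hsep hcell
  set Λ := 6 * K * n with hΛ
  have hΛ0 : 0 ≤ Λ := by positivity
  set D := 6 * K * ((n + 2) * m ^ 2 + 1)
    * ((n + 2) * (volume : Measure (E (n + 2))).real (Metric.ball 0 1)) with hD
  have hD0 : 0 ≤ D := by positivity
  -- The three radii ensure `R₂ < ρ`, `R₂ ≤ 1` and `Λ R₂ ≤ 1`; the extra `1` in the constant keeps
  -- it positive.
  refine ⟨Λ + D + 1, min (ρ / 2) (min 1 (Λ + 1)⁻¹), by positivity, by positivity,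
    fun k₀ R₁ R₂ hR₁ hR hR₂ => ?_⟩
  have hR₂0 : 0 < R₂ := hR₁.trans_le hR
  have hE := scaledEnergy_nonneg U k₀ hR₂0.le
  have hb : (1 + Λ * R₂) * scaledEnergy U k₀ R₂ + D * R₂
      ≤ 2 * (Λ + D + 1) * R₂ + (1 + 2 * (Λ + D + 1) * R₂) * scaledEnergy U k₀ R₂ := by
    have h1 : 0 ≤ R₂ * scaledEnergy U k₀ R₂ := mul_nonneg hR₂0.le hE
    have h2 := mul_nonneg (add_nonneg hΛ0 hD0) h1
    have h3 := mul_nonneg hD0 h1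
    have h4 := mul_nonneg hΛ0 hR₂0.le
    have h5 := mul_nonneg hD0 hR₂0.le
    linarith
  refine le_trans ?_ hb
  -- For equal radii no truncated profile exists, but the shell is empty and the claim is immediate.
  rcases hR.eq_or_lt with rfl | hlt
  · have hempty : {k : E (n + 2) | R₁ < ‖k - k₀‖ ∧ ‖k - k₀‖ < R₁} = ∅ :=
      Set.eq_empty_of_forall_notMem fun k hk => lt_asymm hk.1 hk.2
    rw [hempty, setIntegral_empty, add_zero]
    have h1 := mul_nonneg (mul_nonneg hΛ0 hR₂0.le) hE
    have h2 := mul_nonneg hD0 hR₂0.le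
    linarith
  · have hR₂1 : R₂ ≤ 1 := hR₂.trans ((min_le_right _ _).trans (min_le_left _ _))
    have hR₂ρ : R₂ < ρ := (hR₂.trans (min_le_left _ _)).trans_lt (half_lt_self hρ)
    have hR₂Λ : R₂ ≤ (Λ + 1)⁻¹ := hR₂.trans ((min_le_right _ _).trans (min_le_right _ _))
    have hΛR : Λ * R₂ ≤ 1 := by
      have h1 : (Λ + 1) * R₂ ≤ (Λ + 1) * (Λ + 1)⁻¹ :=
        mul_le_mul_of_nonneg_left hR₂Λ (by positivity)
      rw [mul_inv_cancel₀ (by positivity)] at h1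
      linarith
    refine (scaledEnergy_monotonicity U hn hK.le hΛ (h k₀) hR₁ hlt hR₂ρ hR₂1 hΛR).trans
      (le_of_eq ?_)
    rw [hD]
    ring

end
end MarzariVanderbilt

theorem mainTheorem11 (d m : ℕ) (hd : 3 ≤ d)
    (γ : Module.Basis (Fin d) ℝ (MarzariVanderbilt.E d))
    (P : MarzariVanderbilt.E d → (MarzariVanderbilt.Hf γ →L[ℂ] MarzariVanderbilt.Hf γ))
    (hP : MarzariVanderbilt.IsProjectorFamily γ m P)
    (χ : Fin m → MarzariVanderbilt.E d → MarzariVanderbilt.Hf γ)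
    (hχ : MarzariVanderbilt.IsBlochFrame γ P χ)
    (hχ_analytic : ∀ a, AnalyticOnNhd ℝ (χ a) Set.univ)
    (c : ℝ) (hc : 0 < c)
    (U : MarzariVanderbilt.SobolevMap γ m)
    (hU : MarzariVanderbilt.IsMinimizer c χ U) :
    (∃ C R' : ℝ, 0 < C ∧ 0 < R' ∧
      ∀ (k₀ : MarzariVanderbilt.E d) (R₁ R₂ : ℝ), 0 < R₁ → R₁ ≤ R₂ → R₂ ≤ R' →
        MarzariVanderbilt.scaledEnergy U k₀ R₁
            + ∫ k in {k | R₁ < ‖k - k₀‖ ∧ ‖k - k₀‖ < R₂},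
                2 * MarzariVanderbilt.radialDensity U k₀ k
          ≤ 2 * C * R₂ + (1 + 2 * C * R₂) * MarzariVanderbilt.scaledEnergy U k₀ R₂) ∧
    ∀ k₀ : MarzariVanderbilt.E d,
      (∃ L : ℝ, Tendsto (fun R => MarzariVanderbilt.scaledEnergy U k₀ R) (𝓝[>] 0) (𝓝 L)) ∧
      (∀ R : ℝ, 0 < R →
        IntegrableOn (MarzariVanderbilt.radialDensity U k₀) (Metric.ball k₀ R)) ∧
      Tendsto (fun R => ∫ k in Metric.ball k₀ R, MarzariVanderbilt.radialDensity U k₀ k)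
        (𝓝[>] 0) (𝓝 0) := by
  obtain ⟨n, rfl⟩ : ∃ n, d = n + 2 := ⟨d - 2, by omega⟩
  obtain ⟨C, R', hC, hR', h⟩ := MarzariVanderbilt.exists_monotonicity_constants (by omega)
    hχ.mem_HTau (fun a => (hχ_analytic a).contDiff) hc hU
  refine ⟨⟨C, R', hC, hR', h⟩, fun k₀ => ?_⟩
  have hE : ∀ x, 0 < x → 0 ≤ MarzariVanderbilt.scaledEnergy U k₀ x := fun x hx =>
    MarzariVanderbilt.scaledEnergy_nonneg U k₀ hx.le
  have hshell : ∀ x y, 0 ≤ ∫ k in {k | x < ‖k - k₀‖ ∧ ‖k - k₀‖ < y},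
      2 * MarzariVanderbilt.radialDensity U k₀ k := fun x y =>
    integral_nonneg fun x => mul_nonneg zero_le_two
      (MarzariVanderbilt.radialDensity_nonneg U k₀ x)
  -- With the outer radius fixed at `R'`, the right side of the monotonicity inequality does not
  -- involve the inner radius, so it bounds all shell integrals.
  have hball : MeasureTheory.IntegrableOn (MarzariVanderbilt.radialDensity U k₀)
      (Metric.ball k₀ R') := by
    refine MarzariVanderbilt.integrableOn_radialDensity_ball_of_bounded U k₀
      (I := 2 * C * R' + (1 + 2 * C * R') * MarzariVanderbilt.scaledEnergy U k₀ R') fun r hr => ?_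
    have hB : 0 ≤ 2 * C * R' + (1 + 2 * C * R') * MarzariVanderbilt.scaledEnergy U k₀ R' := by
      have := hE R' hR'
      positivity
    rcases le_or_gt r R' with hrR | hrR
    · have h1 := h k₀ r R' hr hrR le_rfl
      have h2 := hE r hr
      have h3 := hshell r R'
      rw [integral_const_mul] at h1 h3
      linarith
    · have hempty : {k : MarzariVanderbilt.E (n + 2) | r < ‖k - k₀‖ ∧ ‖k - k₀‖ < R'} = ∅ :=
        Set.eq_empty_of_forall_notMem fun k hk => lt_asymm hrR (hk.1.trans hk.2)
      rw [hempty, setIntegral_empty]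
      exact hB
  refine ⟨MarzariVanderbilt.exists_tendsto_of_almost_monotone (a := 2 * C) (by positivity) hR' hE
    fun x y hx hxy hy => ?_, fun R _ =>
    MarzariVanderbilt.integrableOn_radialDensity_ball_of_pos U k₀ hR' hball R,
    MarzariVanderbilt.tendsto_setIntegral_ball_zero (by omega) hR' hball⟩
  -- Dropping the nonnegative shell integral leaves the almost monotonicity of the scaled energy.
  have h1 := h k₀ x y hx hxy hy
  have h2 := hshell x y
  linarith
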